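/- All manifolds, bundles, sections and maps are of class $C^\infty$. **Affine foliations.** Let $M$ be a $4$-manifold. A two-dimensional affine foliation on $M$ is a pair $(\mathcal V,\mathrm D)$ consisting of an integrable two-dimensional distribution $\mathcal V\subset TM$ and a flat torsion-free connection $\mathrm D$ on each leaf of $\mathcal V$, depending smoothly on the leaf. A local section $v$ of $\mathcal V$ is $\mathcal V$-parallel if $\mathrm D_uv=0$ for all sections $u$ of $\mathcal V$. A local vector field $w$ on $M$ is $\mathcal V$-projectable if $[w,v]$ is a section of $\mathcal V$ whenever $v$ is. A partial metric for $(M,\mathcal V)$ is a smooth pairing $h$ of $\mathcal V$ and $TM$ which, treated as a morphism $TM\to\mathcal V^*$, has kernel $\mathcal V$. It is skew-affine if $d_v[h(v,w)]=0$ for all $\mathcal V$-parallel local sections $v$ and all $\mathcal V$-projectable local vector fields $w$. **Basic octuples.** A basic octuple $(M,\mathcal V,\mathrm D,h,\alpha,\beta,\theta,\zeta)$ consists of a skew-affine partial metric $h$ for a two-dimensional affine foliation $(\mathcal V,\mathrm D)$ on a $4$-manifold $M$ and of sections $\alpha,\beta,\zeta,\theta$ of $\mathcal V^*$, $T^*M$,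 $[T^*M]^{\wedge2}$, $[\mathcal V^*]^{\wedge2}$, respectively, such that $\beta\ne0$ and $\operatorname{rank}\zeta=2$ everywhere and, for all $\mathcal V$-parallel local sections $u,v,v'$ of $\mathcal V$ and all $\mathcal V$-projectable local vector fields $w,w'$, $$d_u[h(v,w)]=\beta(w)\theta(u,v),\quad d_u[\alpha(v)]=\alpha(u)\alpha(v),\quad d_u[\zeta(w,w')]=\alpha(u)\zeta(w,w'),$$ $$d_u[\beta(w)]=2\alpha(u)\beta(w),\quad d_u[\theta(v,v')]=-2\alpha(u)\theta(v,v'),$$ $$\theta(v,\zeta w)=2h(v,w),\quad \alpha(\zeta w)=2\beta(w),\quad \mathcal V=\operatorname{Ker}\zeta,$$ where $\zeta w$ is the unique section of $\mathcal V$ with $h(\zeta w,\cdot)=\zeta(w,\cdot)$. **Local equivalence.** A basic octuple on $M$ at $x\in M$ and a basic octuple on $M'$ at $x'\in M'$ are locally diffeomorphically equivalent if some diffeomorphism between neighborhoods of $x$ and $x'$ sends $x$ to $x'$ and sends $\mathcal V,\mathrm D,h,\alpha,\beta,\theta,\zeta$ to the corresponding objects on $M'$. **Two-plane systems.** A two-plane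 system $(\Sigma,\xi,\tau,\Pi,c,\Omega)$ consists of a real affine plane $\Sigma$, a two-dimensional real vector space $\Pi$, linearly independent constant $1$-forms $\xi,\tau$ on $\Sigma$, a vector $c\in\Pi\smallsetminus\{0\}$, and a nonzero skew-symmetric bilinear form $\Omega$ on $\Pi$. Its associated octuple lives on $M=\Sigma\times\Pi_+$ with $\Pi_+=\{X\in\Pi:\Omega(X,c)>0\}$. Here $\mathcal V$ is tangent to the $\Pi_+$ factor, and $\mathrm D$ is the standard flat connection on each leaf $\{y\}\times\Pi_+$. Let $X$ be the radial (identity) vector field on $\Pi$, let $\phi=\Omega(X,c)$, and let forms on the factors also denote their pullbacks to $M$. Then $$h(v,w)=\Omega(\xi(w)X+\tau(w)c,\,v),\quad \alpha=-\phi^{-1}d\phi\ (\text{on }\mathcal V),\quad \beta=\phi^{-2}\xi,\quad \theta=\phi^{2}\Omega\ (\text{on }\mathcal V),\quad \zeta=2\phi^{-1}(\xi\otimes\tau-\tau\otimes\xi),$$ where $v$ is vertical and $w$ is arbitrary. This is a basic octuple. **Theorem.** Any two basic octuples, at any two points of their underlying $4$-manifolds, are locally diffeomorphically equivalent. In other words,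 if $(\Sigma,\xi,\tau,\Pi,c,\Omega)$ is any fixed two-plane system, then every basic octuple, at every point, is locally diffeomorphically equivalent to the basic octuple associated with $(\Sigma,\xi,\tau,\Pi,c,\Omega)$ (at any of its points). -/

import Mathlib

open scoped Manifold ContDiff Topology

noncomputable section

namespace Octuples

/-! ### Distributions, sections and vector fields -/

section Foliations

variable {E : Type*} [NormedAddCommGroup E] [NormedSpace ℝ E]
  {M : Type*} [TopologicalSpace M] [ChartedSpace E M]

/-- A vector field on `M`, not assumed to be smooth. A *local* vector field on an open set `U` is
represented by a vector field on `M` of which only the values on `U` matter. -/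
abbrev VecField (E : Type*) [NormedAddCommGroup E] [NormedSpace ℝ E]
    (M : Type*) [TopologicalSpace M] [ChartedSpace E M] :=
  ∀ x : M, TangentSpace 𝓘(ℝ, E) x

/-- A choice of a linear subspace of every tangent space of `M`. -/
abbrev TangentSubspaces (E : Type*) [NormedAddCommGroup E] [NormedSpace ℝ E]
    (M : Type*) [TopologicalSpace M] [ChartedSpace E M] :=
  ∀ x : M, Submodule ℝ (TangentSpace 𝓘(ℝ, E) x)

/-- Sections of `V`, not assumed to be smooth. Local sections on an open set `U` are
represented by sections of which only the values on `U` matter. -/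
abbrev Sec (V : TangentSubspaces E M) := ∀ x : M, V x

/-- A section of `V` viewed as a vector field. -/
abbrev Sec.toField {V : TangentSubspaces E M} (v : Sec V) : VecField E M := fun x => (v x).1

/-- The directional derivative `d_u f` at `x`, for a tangent vector `u` at `x`. -/
def dirDeriv (f : M → ℝ) (x : M) (u : TangentSpace 𝓘(ℝ, E) x) : ℝ :=
  mfderiv 𝓘(ℝ, E) 𝓘(ℝ, ℝ) f x u

/-- `f` is a `C^∞` function on `U`. -/
def SmoothFunOn (E : Type*) [NormedAddCommGroup E] [NormedSpace ℝ E]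
    {M : Type*} [TopologicalSpace M] [ChartedSpace E M] (U : Set M) (f : M → ℝ) : Prop :=
  ContMDiffOn 𝓘(ℝ, E) 𝓘(ℝ, ℝ) ∞ f U

variable [IsManifold 𝓘(ℝ, E) ∞ M]

/-- `w` is a `C^∞` vector field on `U`. -/
def SmoothFieldOn (U : Set M) (w : VecField E M) : Prop :=
  ContMDiffOn 𝓘(ℝ, E) 𝓘(ℝ, E).tangent ∞ (fun x => (⟨x, w x⟩ : TangentBundle 𝓘(ℝ, E) M)) U

/-- `v` is a `C^∞` section of `V` on `U`. -/
def SmoothSecOn {V : TangentSubspaces E M} (U : Set M) (v : Sec V) : Prop :=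
  SmoothFieldOn U v.toField

/-- `V` is a two-dimensional distribution: a `C^∞` vector subbundle of the tangent bundle with
two-dimensional fibres. -/
structure IsPlaneDistribution (V : TangentSubspaces E M) : Prop where
  finrank_eq : ∀ x, Module.finrank ℝ (V x) = 2
  exists_frame : ∀ x, ∃ U : Set M, IsOpen U ∧ x ∈ U ∧ ∃ s : Fin 2 → Sec V,
    (∀ i, SmoothSecOn U (s i)) ∧ ∀ y ∈ U, LinearIndependent ℝ (fun i => s i y)

/-- Integrability of a two-dimensional distribution `V` on a four-dimensional manifold: locally,
`V` is the vertical distribution of a `C^∞` submersion onto an open set in the plane, the (local)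
leaves being the fibres of the submersion. -/
def IsIntegrable (V : TangentSubspaces E M) : Prop :=
  ∀ x : M, ∃ U : Set M, IsOpen U ∧ x ∈ U ∧ ∃ π : M → ℝ × ℝ,
    ContMDiffOn 𝓘(ℝ, E) 𝓘(ℝ, ℝ × ℝ) ∞ π U ∧
    ∀ y ∈ U, Function.Surjective (mfderiv 𝓘(ℝ, E) 𝓘(ℝ, ℝ × ℝ) π y) ∧
      ∀ w : TangentSpace 𝓘(ℝ, E) y,
        w ∈ V y ↔ mfderiv 𝓘(ℝ, E) 𝓘(ℝ, ℝ × ℝ) π y w = 0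

/-- `D` is a flat torsion-free connection on every leaf of `V`, depending smoothly on the leaf. It
is treated as an operator `(u, v) ↦ D u v = D_u v` sending local sections of `V` to local sections
of `V`. -/
structure IsFlatTorsionFree (V : TangentSubspaces E M) (D : Sec V → Sec V → Sec V) : Prop where
  smooth : ∀ U : Set M, IsOpen U → ∀ u v : Sec V, SmoothSecOn U u → SmoothSecOn U v →
    SmoothSecOn U (D u v)
  /-- the values of `D u v` on `U` depend only on the restrictions of `u` and `v` to `U` -/
  isLocal : ∀ U : Set M, IsOpen U → ∀ u v u' v' : Sec V,
    SmoothSecOn U u → SmoothSecOn U v → SmoothSecOn U u' → SmoothSecOn U v' →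
    (∀ x ∈ U, u x = u' x) → (∀ x ∈ U, v x = v' x) → ∀ x ∈ U, D u v x = D u' v' x
  add_left : ∀ U : Set M, IsOpen U → ∀ u u' v : Sec V,
    SmoothSecOn U u → SmoothSecOn U u' → SmoothSecOn U v →
    ∀ x ∈ U, D (fun y => u y + u' y) v x = D u v x + D u' v x
  smul_left : ∀ U : Set M, IsOpen U → ∀ (f : M → ℝ) (u v : Sec V),
    SmoothFunOn E U f → SmoothSecOn U u → SmoothSecOn U v →
    ∀ x ∈ U, D (fun y => f y • u y) v x = f x • D u v x
  add_right : ∀ U : Set M, IsOpen U → ∀ u v v' : Sec V,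
    SmoothSecOn U u → SmoothSecOn U v → SmoothSecOn U v' →
    ∀ x ∈ U, D u (fun y => v y + v' y) x = D u v x + D u v' x
  leibniz : ∀ U : Set M, IsOpen U → ∀ (f : M → ℝ) (u v : Sec V),
    SmoothFunOn E U f → SmoothSecOn U u → SmoothSecOn U v →
    ∀ x ∈ U, D u (fun y => f y • v y) x = f x • D u v x + dirDeriv f x (u x).1 • v x
  torsion_free : ∀ U : Set M, IsOpen U → ∀ u v : Sec V, SmoothSecOn U u → SmoothSecOn U v →
    ∀ x ∈ U, (D u v x).1 - (D v u x).1 = VectorField.mlieBracket 𝓘(ℝ, E) u.toField v.toField x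
  /-- the curvature vanishes; here `z` is the section `[u, v]` -/
  flat : ∀ U : Set M, IsOpen U → ∀ u v w z : Sec V,
    SmoothSecOn U u → SmoothSecOn U v → SmoothSecOn U w → SmoothSecOn U z →
    (∀ x ∈ U, (z x).1 = VectorField.mlieBracket 𝓘(ℝ, E) u.toField v.toField x) →
    ∀ x ∈ U, D u (D v w) x - D v (D u w) x - D z w x = 0

/-- `v` is a `V`-parallel section of `V` on `U`: it is `D`-parallel along each leaf of `V`. -/
def IsParallelOn {V : TangentSubspaces E M} (D : Sec V → Sec V → Sec V) (U : Set M) (v : Sec V) :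
    Prop :=
  SmoothSecOn U v ∧ ∀ u : Sec V, SmoothSecOn U u → ∀ x ∈ U, D u v x = 0

/-- `w` is a `V`-projectable vector field on `U`: if `v` is a section of `V` on `U`, so is
`[w, v]`. -/
def IsProjectableOn (V : TangentSubspaces E M) (U : Set M) (w : VecField E M) : Prop :=
  SmoothFieldOn U w ∧ ∀ v : Sec V, SmoothSecOn U v →
    ∀ x ∈ U, VectorField.mlieBracket 𝓘(ℝ, E) w v.toField x ∈ V x

/-- `h` is a partial metric for `(M, V)`: a `C^∞` pairing of `V` and the tangent bundle of `M`
which, treated as a morphism from the tangent bundle to the dual of `V`, has the kernel `V`. -/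
structure IsPartialMetric (V : TangentSubspaces E M)
    (h : ∀ x : M, V x →ₗ[ℝ] TangentSpace 𝓘(ℝ, E) x →ₗ[ℝ] ℝ) : Prop where
  smooth : ∀ U : Set M, IsOpen U → ∀ (v : Sec V) (w : VecField E M),
    SmoothSecOn U v → SmoothFieldOn U w → SmoothFunOn E U (fun x => h x (v x) (w x))
  kernel : ∀ (x : M) (w : TangentSpace 𝓘(ℝ, E) x), (∀ v : V x, h x v w = 0) ↔ w ∈ V x

/-- The pairing `h` is skew-affine: `d_v [h(v, w)] = 0` for all `V`-parallel local sections `v` of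
`V` and all `V`-projectable local vector fields `w`. -/
def IsSkewAffine (V : TangentSubspaces E M) (D : Sec V → Sec V → Sec V)
    (h : ∀ x : M, V x →ₗ[ℝ] TangentSpace 𝓘(ℝ, E) x →ₗ[ℝ] ℝ) : Prop :=
  ∀ U : Set M, IsOpen U → ∀ (v : Sec V) (w : VecField E M),
    IsParallelOn D U v → IsProjectableOn V U w →
    ∀ x ∈ U, dirDeriv (fun y => h y (v y) (w y)) x (v x).1 = 0

end Foliations

/-! ### Basic octuples -/

/-- The data `(V, D, h, α, β, θ, ζ)` on the manifold `M`, without any conditions. -/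
structure OctupleData (E : Type*) [NormedAddCommGroup E] [NormedSpace ℝ E]
    (M : Type*) [TopologicalSpace M] [ChartedSpace E M] where
  V : TangentSubspaces E M
  D : Sec V → Sec V → Sec V
  h : ∀ x : M, V x →ₗ[ℝ] TangentSpace 𝓘(ℝ, E) x →ₗ[ℝ] ℝ
  α : ∀ x : M, V x →ₗ[ℝ] ℝ
  β : ∀ x : M, TangentSpace 𝓘(ℝ, E) x →ₗ[ℝ] ℝ
  θ : ∀ x : M, V x →ₗ[ℝ] V x →ₗ[ℝ] ℝ
  ζ : ∀ x : M, TangentSpace 𝓘(ℝ, E) x →ₗ[ℝ] TangentSpace 𝓘(ℝ, E) x →ₗ[ℝ] ℝ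

section Basic

variable {E : Type*} [NormedAddCommGroup E] [NormedSpace ℝ E]
  {M : Type*} [TopologicalSpace M] [ChartedSpace E M] [IsManifold 𝓘(ℝ, E) ∞ M]

/-- `(M, V, D, h, α, β, θ, ζ)` is a basic octuple. -/
structure OctupleData.IsBasic (O : OctupleData E M) : Prop where
  dim_eq : Module.finrank ℝ E = 4
  isPlaneDistribution : IsPlaneDistribution O.V
  isIntegrable : IsIntegrable O.V
  isFlatTorsionFree : IsFlatTorsionFree O.V O.D
  isPartialMetric : IsPartialMetric O.V O.h
  isSkewAffine : IsSkewAffine O.V O.D O.h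
  α_smooth : ∀ U : Set M, IsOpen U → ∀ v : Sec O.V, SmoothSecOn U v →
    SmoothFunOn E U (fun x => O.α x (v x))
  β_smooth : ∀ U : Set M, IsOpen U → ∀ w : VecField E M, SmoothFieldOn U w →
    SmoothFunOn E U (fun x => O.β x (w x))
  θ_smooth : ∀ U : Set M, IsOpen U → ∀ v v' : Sec O.V, SmoothSecOn U v → SmoothSecOn U v' →
    SmoothFunOn E U (fun x => O.θ x (v x) (v' x))
  ζ_smooth : ∀ U : Set M, IsOpen U → ∀ w w' : VecField E M, SmoothFieldOn U w →
    SmoothFieldOn U w' → SmoothFunOn E U (fun x => O.ζ x (w x) (w' x))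
  θ_alt : ∀ x, (O.θ x).IsAlt
  ζ_alt : ∀ x, (O.ζ x).IsAlt
  β_ne_zero : ∀ x, O.β x ≠ 0
  ζ_rank : ∀ x, Module.finrank ℝ (LinearMap.range (O.ζ x)) = 2
  /-- `d_u [h(v, w)] = β(w) θ(u, v)` -/
  dh : ∀ U : Set M, IsOpen U → ∀ (u v : Sec O.V) (w : VecField E M),
    IsParallelOn O.D U u → IsParallelOn O.D U v → IsProjectableOn O.V U w →
    ∀ x ∈ U, dirDeriv (fun y => O.h y (v y) (w y)) x (u x).1 = O.β x (w x) * O.θ x (u x) (v x)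
  /-- `d_u [α(v)] = α(u) α(v)` -/
  dα : ∀ U : Set M, IsOpen U → ∀ u v : Sec O.V,
    IsParallelOn O.D U u → IsParallelOn O.D U v →
    ∀ x ∈ U, dirDeriv (fun y => O.α y (v y)) x (u x).1 = O.α x (u x) * O.α x (v x)
  /-- `d_u [ζ(w, w')] = α(u) ζ(w, w')` -/
  dζ : ∀ U : Set M, IsOpen U → ∀ (u : Sec O.V) (w w' : VecField E M),
    IsParallelOn O.D U u → IsProjectableOn O.V U w → IsProjectableOn O.V U w' →
    ∀ x ∈ U, dirDeriv (fun y => O.ζ y (w y) (w' y)) x (u x).1 =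
      O.α x (u x) * O.ζ x (w x) (w' x)
  /-- `d_u [β(w)] = 2 α(u) β(w)` -/
  dβ : ∀ U : Set M, IsOpen U → ∀ (u : Sec O.V) (w : VecField E M),
    IsParallelOn O.D U u → IsProjectableOn O.V U w →
    ∀ x ∈ U, dirDeriv (fun y => O.β y (w y)) x (u x).1 = 2 * O.α x (u x) * O.β x (w x)
  /-- `d_u [θ(v, v')] = -2 α(u) θ(v, v')` -/
  dθ : ∀ U : Set M, IsOpen U → ∀ u v v' : Sec O.V,
    IsParallelOn O.D U u → IsParallelOn O.D U v → IsParallelOn O.D U v' →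
    ∀ x ∈ U, dirDeriv (fun y => O.θ y (v y) (v' y)) x (u x).1 =
      -2 * O.α x (u x) * O.θ x (v x) (v' x)
  /-- `θ(v, ζw) = 2 h(v, w)` and `α(ζw) = 2 β(w)`, where `z = ζw` is the vector in `V`
  characterized by `h(ζw, w') = ζ(w, w')` for all `w'` (unique, as `h` is a partial metric) -/
  sharp : ∀ (x : M) (w : TangentSpace 𝓘(ℝ, E) x), ∃ z : O.V x,
    (∀ w' : TangentSpace 𝓘(ℝ, E) x, O.h x z w' = O.ζ x w w') ∧
    (∀ v : O.V x, O.θ x v z = 2 * O.h x v w) ∧ O.α x z = 2 * O.β x w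
  /-- `V = Ker ζ` -/
  ker_ζ : ∀ x, O.V x = LinearMap.ker (O.ζ x)

end Basic

/-- The local diffeomorphism `Φ` (defined on `Φ.source`) sends the octuple `O` to the octuple
`O'`: the differential of `Φ` sends each object of `O` to the corresponding object of `O'`. -/
structure OctupleData.IsTransportedBy
    {E : Type*} [NormedAddCommGroup E] [NormedSpace ℝ E]
    {M : Type*} [TopologicalSpace M] [ChartedSpace E M] [IsManifold 𝓘(ℝ, E) ∞ M]
    {E' : Type*} [NormedAddCommGroup E'] [NormedSpace ℝ E']
    {M' : Type*} [TopologicalSpace M'] [ChartedSpace E' M'] [IsManifold 𝓘(ℝ, E') ∞ M']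
    (O : OctupleData E M) (O' : OctupleData E' M') (Φ : OpenPartialHomeomorph M M') : Prop where
  map_V : ∀ x ∈ Φ.source, ∀ w : TangentSpace 𝓘(ℝ, E) x,
    mfderiv 𝓘(ℝ, E) 𝓘(ℝ, E') Φ x w ∈ O'.V (Φ x) ↔ w ∈ O.V x
  /-- if the local sections `u`, `v` of `V` correspond to `u'`, `v'`, then `D_u v` corresponds to
  `D'_{u'} v'` -/
  map_D : ∀ U : Set M, IsOpen U → U ⊆ Φ.source → ∀ (u v : Sec O.V) (u' v' : Sec O'.V),
    SmoothSecOn U u → SmoothSecOn U v → SmoothSecOn (Φ '' U) u' → SmoothSecOn (Φ '' U) v' →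
    (∀ x ∈ U, (u' (Φ x)).1 = mfderiv 𝓘(ℝ, E) 𝓘(ℝ, E') Φ x (u x).1) →
    (∀ x ∈ U, (v' (Φ x)).1 = mfderiv 𝓘(ℝ, E) 𝓘(ℝ, E') Φ x (v x).1) →
    ∀ x ∈ U, (O'.D u' v' (Φ x)).1 = mfderiv 𝓘(ℝ, E) 𝓘(ℝ, E') Φ x (O.D u v x).1
  map_h : ∀ x ∈ Φ.source, ∀ (v : O.V x) (v' : O'.V (Φ x)) (w : TangentSpace 𝓘(ℝ, E) x),
    v'.1 = mfderiv 𝓘(ℝ, E) 𝓘(ℝ, E') Φ x v.1 →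
    O'.h (Φ x) v' (mfderiv 𝓘(ℝ, E) 𝓘(ℝ, E') Φ x w) = O.h x v w
  map_α : ∀ x ∈ Φ.source, ∀ (v : O.V x) (v' : O'.V (Φ x)),
    v'.1 = mfderiv 𝓘(ℝ, E) 𝓘(ℝ, E') Φ x v.1 → O'.α (Φ x) v' = O.α x v
  map_β : ∀ x ∈ Φ.source, ∀ w : TangentSpace 𝓘(ℝ, E) x,
    O'.β (Φ x) (mfderiv 𝓘(ℝ, E) 𝓘(ℝ, E') Φ x w) = O.β x w
  map_θ : ∀ x ∈ Φ.source, ∀ (u v : O.V x) (u' v' : O'.V (Φ x)),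
    u'.1 = mfderiv 𝓘(ℝ, E) 𝓘(ℝ, E') Φ x u.1 → v'.1 = mfderiv 𝓘(ℝ, E) 𝓘(ℝ, E') Φ x v.1 →
    O'.θ (Φ x) u' v' = O.θ x u v
  map_ζ : ∀ x ∈ Φ.source, ∀ w w' : TangentSpace 𝓘(ℝ, E) x,
    O'.ζ (Φ x) (mfderiv 𝓘(ℝ, E) 𝓘(ℝ, E') Φ x w) (mfderiv 𝓘(ℝ, E) 𝓘(ℝ, E') Φ x w') =
      O.ζ x w w'

/-- A basic octuple `(M, V, D, h, α, β, θ, ζ)` on the manifold `M`. -/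
structure BasicOctuple (E : Type*) [NormedAddCommGroup E] [NormedSpace ℝ E]
    (M : Type*) [TopologicalSpace M] [ChartedSpace E M] [IsManifold 𝓘(ℝ, E) ∞ M]
    extends OctupleData E M where
  isBasic : toOctupleData.IsBasic

/-- The basic octuple `O` at the point `x` is locally diffeomorphically equivalent to `O'` at the
point `x'`: some diffeomorphism between neighbourhoods of `x` and `x'` sends `x` to `x'` and `O`
to `O'`. -/
def BasicOctuple.LocallyEquivalentAt
    {E : Type*} [NormedAddCommGroup E] [NormedSpace ℝ E]
    {M : Type*} [TopologicalSpace M] [ChartedSpace E M] [IsManifold 𝓘(ℝ, E) ∞ M]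
    {E' : Type*} [NormedAddCommGroup E'] [NormedSpace ℝ E']
    {M' : Type*} [TopologicalSpace M'] [ChartedSpace E' M'] [IsManifold 𝓘(ℝ, E') ∞ M']
    (O : BasicOctuple E M) (x : M) (O' : BasicOctuple E' M') (x' : M') : Prop :=
  ∃ Φ : OpenPartialHomeomorph M M', x ∈ Φ.source ∧ Φ x = x' ∧
    ContMDiffOn 𝓘(ℝ, E) 𝓘(ℝ, E') ∞ Φ Φ.source ∧
    ContMDiffOn 𝓘(ℝ, E') 𝓘(ℝ, E) ∞ Φ.symm Φ.target ∧
    O.toOctupleData.IsTransportedBy O'.toOctupleData Φ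

/-! ### Two-plane systems -/

/-- A two-plane system: a real affine plane `S` (with the translation space `A`), a real vector
plane `P`, two linearly independent constant `1`-forms `ξ`, `τ` on `S`, a nonzero constant vector
field `c` on `P`, and a nonzero constant `2`-form `Ω` on `P`. The norms on `A` and `P`, any two of
which are equivalent, serve only to make `S` and `P` into manifolds. -/
structure TwoPlaneSystem (A : Type*) [NormedAddCommGroup A] [NormedSpace ℝ A]
    (S : Type*) [MetricSpace S] [NormedAddTorsor A S]
    (P : Type*) [NormedAddCommGroup P] [NormedSpace ℝ P] where
  finrank_A : Module.finrank ℝ A = 2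
  finrank_P : Module.finrank ℝ P = 2
  ξ : A →ₗ[ℝ] ℝ
  τ : A →ₗ[ℝ] ℝ
  linearIndependent : LinearIndependent ℝ ![ξ, τ]
  c : P
  c_ne_zero : c ≠ 0
  Ω : P →ₗ[ℝ] P →ₗ[ℝ] ℝ
  Ω_alt : Ω.IsAlt
  Ω_ne_zero : Ω ≠ 0

namespace TwoPlaneSystem

variable {A : Type*} [NormedAddCommGroup A] [NormedSpace ℝ A]
  {S : Type*} [MetricSpace S] [NormedAddTorsor A S]
  {P : Type*} [NormedAddCommGroup P] [NormedSpace ℝ P]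

/-- The product `S × P₊`, where `P₊` is the open half-plane in `P` on which `Ω(·, c) > 0`. -/
def Space (T : TwoPlaneSystem A S P) : Type _ := S × {X : P // 0 < T.Ω X T.c}

instance (T : TwoPlaneSystem A S P) : TopologicalSpace T.Space :=
  inferInstanceAs (TopologicalSpace (S × {X : P // 0 < T.Ω X T.c}))

/-- The global affine coordinates on `S × P₊`, for some origin in `S`. -/
def coord (T : TwoPlaneSystem A S P) (z : T.Space) : A × P :=
  (z.1 -ᵥ Classical.choice (AddTorsor.nonempty (G := A) (P := S)), z.2.1)

theorem exists_pos (T : TwoPlaneSystem A S P) : ∃ X : P, 0 < T.Ω X T.c := by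
  have hfin : FiniteDimensional ℝ P := Module.finite_of_finrank_eq_succ T.finrank_P
  by_contra! hneg
  have h0 : ∀ X, T.Ω X T.c = 0 := by
    intro X
    have h1 := hneg X
    have h2 := hneg (-X)
    simp only [map_neg, LinearMap.neg_apply] at h2
    linarith
  have hc : ∀ X, T.Ω T.c X = 0 := fun X => by rw [← T.Ω_alt.neg, h0, neg_zero]
  apply T.Ω_ne_zero
  obtain ⟨d, hd⟩ : ∃ d : P, d ∉ Submodule.span ℝ {T.c} := by
    by_contra! hall
    have htop : Submodule.span ℝ {T.c} = ⊤ := by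
      rw [Submodule.eq_top_iff']; exact hall
    have h1 := finrank_span_singleton (K := ℝ) T.c_ne_zero
    rw [htop, finrank_top, T.finrank_P] at h1
    omega
  have hli : LinearIndependent ℝ ![T.c, d] := by
    rw [LinearIndependent.pair_iff' T.c_ne_zero]
    intro a ha
    exact hd (Submodule.mem_span_singleton.2 ⟨a, ha⟩)
  let b := basisOfLinearIndependentOfCardEqFinrank hli (by simp [T.finrank_P])
  refine b.ext fun i => b.ext fun j => ?_
  fin_cases i <;> fin_cases j <;> simp [b, h0, hc, T.Ω_alt.self_eq_zero]

instance (T : TwoPlaneSystem A S P) : Nonempty T.Space :=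
  ⟨(Classical.choice (AddTorsor.nonempty (G := A) (P := S)),
    ⟨T.exists_pos.choose, T.exists_pos.choose_spec⟩)⟩

theorem isOpenEmbedding_coord (T : TwoPlaneSystem A S P) : Topology.IsOpenEmbedding T.coord := by
  have hfin : FiniteDimensional ℝ P := Module.finite_of_finrank_eq_succ T.finrank_P
  have hopen : IsOpen {X : P | 0 < T.Ω X T.c} :=
    isOpen_lt continuous_const (LinearMap.continuous_of_finiteDimensional (T.Ω.flip T.c))
  exact (IsometryEquiv.vaddConst
    (Classical.choice (AddTorsor.nonempty (G := A) (P := S)))).symm.toHomeomorph.isOpenEmbedding.prodMap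
    hopen.isOpenEmbedding_subtypeVal

/-- The manifold structure of `S × P₊`, given by a single chart consisting of affine coordinates.
The tangent space at every point is `A × P`. -/
instance (T : TwoPlaneSystem A S P) : ChartedSpace (A × P) T.Space :=
  T.isOpenEmbedding_coord.singletonChartedSpace

instance (T : TwoPlaneSystem A S P) : IsManifold 𝓘(ℝ, A × P) ∞ T.Space :=
  T.isOpenEmbedding_coord.isManifold_singleton

/-- The distribution on `S × P₊` tangent to the `P₊` factor. -/
def vertical (T : TwoPlaneSystem A S P) : TangentSubspaces (A × P) T.Space :=
  fun _ => LinearMap.ker (LinearMap.fst ℝ A P)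

/-- The `P` component of a section of the vertical distribution. -/
def comp {T : TwoPlaneSystem A S P} (v : Sec T.vertical) (z : T.Space) : P :=
  (show A × P from (v z).1).2

/-- The function `φ = Ω(X, c)` on `S × P₊`, with `X` standing for the radial vector field on
`P`. -/
def φ (T : TwoPlaneSystem A S P) (z : T.Space) : ℝ := T.Ω z.2.1 T.c

/-- The assignment `w ↦ Y_w = ξ(w) X + τ(w) c` at the point `z`. -/
def Y (T : TwoPlaneSystem A S P) (z : T.Space) : A × P →ₗ[ℝ] P :=
  ((T.ξ.smulRight z.2.1 + T.τ.smulRight T.c).comp (LinearMap.fst ℝ A P))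

/-- The octuple associated with a two-plane system. -/
def octuple (T : TwoPlaneSystem A S P) : OctupleData (A × P) T.Space where
  V := T.vertical
  -- the standard flat connection of each leaf: the directional derivative of `P`-valued functions
  D u v z := ⟨show A × P from
    (0, mfderiv 𝓘(ℝ, A × P) 𝓘(ℝ, P) (comp v) z (u z).1), by
      change LinearMap.fst ℝ A P (0, _) = 0; rfl⟩
  -- `h(v, w) = Ω(Y_w, v)`
  h z := ((T.Ω.comp (T.Y z)).flip.comp (LinearMap.snd ℝ A P)).comp (T.vertical z).subtype
  -- `α = -φ⁻¹ dφ` on the vertical distribution, where `dφ = Ω(·, c)`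
  α z := (-(T.φ z)⁻¹) • ((T.Ω.flip T.c).comp (LinearMap.snd ℝ A P)).comp (T.vertical z).subtype
  -- `β = φ⁻² ξ`
  β z := ((T.φ z) ^ 2)⁻¹ • T.ξ.comp (LinearMap.fst ℝ A P)
  -- `θ = φ² Ω` on the vertical distribution
  θ z := (T.φ z) ^ 2 • T.Ω.compl₁₂ ((LinearMap.snd ℝ A P).comp (T.vertical z).subtype)
    ((LinearMap.snd ℝ A P).comp (T.vertical z).subtype)
  -- `ζ = 2 φ⁻¹ ξ ∧ τ`, with `ξ ∧ τ = ξ ⊗ τ - τ ⊗ ξ`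
  ζ z := (2 * (T.φ z)⁻¹) •
    (LinearMap.mk₂ ℝ (fun w w' : A × P => T.ξ w.1 * T.τ w'.1 - T.τ w.1 * T.ξ w'.1)
      (fun _ _ _ => by simp only [Prod.fst_add, map_add]; ring)
      (fun _ _ _ => by simp only [Prod.smul_fst, map_smul, smul_eq_mul]; ring)
      (fun _ _ _ => by simp only [Prod.fst_add, map_add]; ring)
      (fun _ _ _ => by simp only [Prod.smul_fst, map_smul, smul_eq_mul]; ring))

/-! ### The octuple associated with a two-plane system is basic

Everything in this section serves only to prove `octuple_isBasic`. -/

section Verification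

set_option linter.unusedSectionVars false
set_option linter.unusedVariables false

variable {F : Type*} [NormedAddCommGroup F] [NormedSpace ℝ F]
  (T : TwoPlaneSystem A S P)

theorem ext_source (z : T.Space) : (extChartAt 𝓘(ℝ, A × P) z).source = Set.univ := by
  rw [extChartAt_source]
  rfl

def σ (z : T.Space) : A × P → T.Space := (extChartAt 𝓘(ℝ, A × P) z).symm

theorem σ_coord (z y : T.Space) : T.σ z (T.coord y) = y := by
  have := (extChartAt 𝓘(ℝ, A × P) z).left_inv (x := y) (by rw [ext_source]; trivial)
  exact this

theorem coord_σ (z : T.Space) : ∀ᶠ y in nhds (T.coord z), T.coord (T.σ z y) = y := by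
  have h := extChartAt_target_mem_nhds (I := 𝓘(ℝ, A × P)) z
  filter_upwards [h] with y hy
  exact (extChartAt 𝓘(ℝ, A × P) z).right_inv hy

abbrev fld {T : TwoPlaneSystem A S P} (w : VecField (A × P) T.Space) : T.Space → A × P := w

abbrev tl {F : Type*} (f : T.Space → F) (z : T.Space) : A × P → F := fun y => f (T.σ z y)

theorem smoothField_iff (U : Set T.Space) (w : VecField (A × P) T.Space) :
    SmoothFieldOn U w ↔ ContMDiffOn 𝓘(ℝ, A × P) 𝓘(ℝ, A × P) ∞ (fun z => (w z : A × P)) U := by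
  unfold SmoothFieldOn
  refine forall₂_congr fun z hz => ?_
  rw [Bundle.contMDiffWithinAt_section]
  have : ∀ x : T.Space, (trivializationAt (A × P) (TangentSpace 𝓘(ℝ, A × P)) z ⟨x, w x⟩).2 = w x := by
    intro x
    exact tangentCoordChange_self (I := 𝓘(ℝ, A × P)) (x := x) (z := x) (v := w x) (by rw [ext_source]; trivial)
  simp only [this]

theorem mfderiv_eq {f : T.Space → F} {z : T.Space} (hf : MDifferentiableAt 𝓘(ℝ, A × P) 𝓘(ℝ, F) f z) :
    mfderiv 𝓘(ℝ, A × P) 𝓘(ℝ, F) f z = fderiv ℝ (fun y => f (T.σ z y)) (T.coord z) := by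
  have h := hf.mfderiv
  rw [modelWithCornersSelf_coe, Set.range_id, fderivWithin_univ] at h
  exact h

theorem mdiff_iff {f : T.Space → F} {z : T.Space} (hf : MDifferentiableAt 𝓘(ℝ, A × P) 𝓘(ℝ, F) f z) :
    DifferentiableAt ℝ (fun y => f (T.σ z y)) (T.coord z) := by
  have := ((mdifferentiableAt_iff _ _).1 hf).2
  rw [modelWithCornersSelf_coe, Set.range_id] at this
  exact (differentiableWithinAt_univ.1 this)

theorem mfderiv_coord (z y : T.Space) : mfderiv 𝓘(ℝ, A × P) 𝓘(ℝ, A × P) (extChartAt 𝓘(ℝ, A × P) z) y = ContinuousLinearMap.id ℝ (A × P) := by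
  have hs : MDifferentiableAt 𝓘(ℝ, A × P) 𝓘(ℝ, A × P) (extChartAt 𝓘(ℝ, A × P) z) y :=
    mdifferentiableAt_extChartAt (by change y ∈ (chartAt (A × P) z).source; rw [← extChartAt_source 𝓘(ℝ, A × P), ext_source]; trivial)
  have h := T.mfderiv_eq hs
  refine h.trans ?_
  have : (fun x => (extChartAt 𝓘(ℝ, A × P) z) (T.σ y x)) =ᶠ[nhds (T.coord y)] id := by
    filter_upwards [T.coord_σ y] with x hx
    exact hx
  erw [this.fderiv_eq, fderiv_id]

theorem mfderiv_σ (z : T.Space) : ∀ᶠ y in nhds (T.coord z),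
    mfderivWithin 𝓘(ℝ, A × P) 𝓘(ℝ, A × P) (extChartAt 𝓘(ℝ, A × P) z).symm (Set.range 𝓘(ℝ, A × P)) y = ContinuousLinearMap.id ℝ (A × P) := by
  have h := extChartAt_target_mem_nhds (I := 𝓘(ℝ, A × P)) z
  filter_upwards [h] with y hy
  have := mfderiv_extChartAt_comp_mfderivWithin_extChartAt_symm (I := 𝓘(ℝ, A × P)) (x := z) hy
  rw [mfderiv_coord] at this
  exact this

theorem bracket_eq (u v : VecField (A × P) T.Space) {z : T.Space}
    (hu : MDifferentiableAt 𝓘(ℝ, A × P) 𝓘(ℝ, A × P) (fld u) z)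
    (hv : MDifferentiableAt 𝓘(ℝ, A × P) 𝓘(ℝ, A × P) (fld v) z) :
    VectorField.mlieBracket 𝓘(ℝ, A × P) u v z =
      (fderiv ℝ (T.tl (fld v) z) (T.coord z) (u z)) -
      (fderiv ℝ (T.tl (fld u) z) (T.coord z) (v z)) := by
  change VectorField.mlieBracketWithin _ u v Set.univ z = _
  rw [VectorField.mlieBracketWithin_apply]
  have key : ∀ u : VecField (A × P) T.Space, VectorField.mpullbackWithin 𝓘(ℝ, A × P) 𝓘(ℝ, A × P) (extChartAt 𝓘(ℝ, A × P) z).symm u (Set.range 𝓘(ℝ, A × P)) =ᶠ[nhds (T.coord z)] fun y => u (T.σ z y) := by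
    intro u
    filter_upwards [T.mfderiv_σ z] with y hy
    rw [VectorField.mpullbackWithin_apply, hy]
    erw [ContinuousLinearMap.inverse_id]
    rfl
  rw [mfderiv_coord]
  erw [ContinuousLinearMap.inverse_id]
  simp only [Set.preimage_univ, Set.univ_inter, modelWithCornersSelf_coe, Set.range_id]
  refine (congrFun (VectorField.lieBracketWithin_univ (𝕜 := ℝ)) (T.coord z)).trans ?_
  have k1 := key u
  have k2 := key v
  simp only [modelWithCornersSelf_coe, Set.range_id] at k1 k2
  rw [Filter.EventuallyEq.lieBracket_vectorField_eq k1 k2]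
  have hz : T.σ z (T.coord z) = z := T.σ_coord z z
  change fderiv ℝ (T.tl (fld v) z) (T.coord z) (fld u (T.σ z (T.coord z))) - fderiv ℝ (T.tl (fld u) z) (T.coord z) (fld v (T.σ z (T.coord z))) = _
  rw [hz]

theorem dirDeriv_eq {f : T.Space → ℝ} {g : A × P → ℝ} {g' : A × P →L[ℝ] ℝ} {z : T.Space}
    (hf : MDifferentiableAt 𝓘(ℝ, A × P) 𝓘(ℝ, ℝ) f z)
    (hg : HasFDerivAt g g' (T.coord z))
    (h : ∀ᶠ y in nhds (T.coord z), f (T.σ z y) = g y) (u : A × P) :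
    dirDeriv f z (show TangentSpace 𝓘(ℝ, A × P) z from u) = g' u := by
  rw [dirDeriv, mfderiv_eq T hf]
  have : (fun y => f (T.σ z y)) =ᶠ[nhds (T.coord z)] g := h
  rw [this.fderiv_eq, hg.fderiv]
  rfl

theorem smooth_coord : ContMDiff 𝓘(ℝ, A × P) 𝓘(ℝ, A × P) ∞ T.coord := by
  have := contMDiff_isOpenEmbedding (I := 𝓘(ℝ, A × P)) (n := ∞) T.isOpenEmbedding_coord
  exact this

theorem smooth_σ (z : T.Space) : ContMDiffOn 𝓘(ℝ, A × P) 𝓘(ℝ, A × P) ∞ (T.σ z) (Set.range T.coord) := by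
  have := contMDiffOn_extChartAt_symm (I := 𝓘(ℝ, A × P)) (n := ∞) z
  refine this.mono ?_
  rintro _ ⟨y, rfl⟩
  exact (extChartAt 𝓘(ℝ, A × P) z).map_source (by rw [ext_source]; trivial)

theorem smooth_tl {f : T.Space → F} {U : Set T.Space} (z : T.Space) 
    (hf : ContMDiffOn 𝓘(ℝ, A × P) 𝓘(ℝ, F) ∞ f U) : ContDiffOn ℝ ∞ (T.tl f z) (T.coord '' U) := by
  rw [← contMDiffOn_iff_contDiffOn]
  refine hf.comp ((T.smooth_σ z).mono (Set.image_subset_range _ _)) ?_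
  rintro _ ⟨y, hy, rfl⟩
  change T.σ z _ ∈ U
  rwa [σ_coord]

theorem smooth_of_tl {f : T.Space → F} {U : Set T.Space} (z : T.Space) 
    (hf : ContDiffOn ℝ ∞ (T.tl f z) (T.coord '' U)) : ContMDiffOn 𝓘(ℝ, A × P) 𝓘(ℝ, F) ∞ f U := by
  have := hf.contMDiffOn.comp (T.smooth_coord.contMDiffOn (s := U)) (fun y hy => ⟨y, hy, rfl⟩)
  refine this.congr fun y hy => ?_
  simp only [Function.comp, tl, σ_coord]

theorem open_image {U : Set T.Space} (hU : IsOpen U) : IsOpen (T.coord '' U) :=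
  T.isOpenEmbedding_coord.isOpenMap _ hU

theorem sec_val (v : Sec T.vertical) (z : T.Space) : (v z).1 = ((0, comp v z) : A × P) := by
  have h : (show A × P from (v z).1).1 = 0 := (v z).2
  exact Prod.ext h rfl

theorem smoothSec_iff (U : Set T.Space) (v : Sec T.vertical) :
    SmoothSecOn U v ↔ ContMDiffOn 𝓘(ℝ, A × P) 𝓘(ℝ, P) ∞ (comp v) U := by
  unfold SmoothSecOn
  rw [smoothField_iff]
  constructor
  · intro h
    exact (contDiff_snd.contMDiff).comp_contMDiffOn h
  · intro h
    have : ContMDiffOn 𝓘(ℝ, A × P) 𝓘(ℝ, A × P) ∞ (fun z => ((0 : A), comp v z)) U :=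
      ((contDiff_const.prodMk contDiff_id : ContDiff ℝ ∞ (fun p : P => ((0:A), p))).contMDiff).comp_contMDiffOn h
    refine this.congr fun y hy => ?_
    exact T.sec_val v y

theorem field_tl {U : Set T.Space} (hU : IsOpen U) {w : VecField (A × P) T.Space} (hw : SmoothFieldOn U w)
    {z : T.Space} (hz : z ∈ U) :
    DifferentiableAt ℝ (T.tl (fld w) z) (T.coord z) := by
  rw [smoothField_iff] at hw
  exact T.mdiff_iff ((hw.contMDiffAt (hU.mem_nhds hz)).mdifferentiableAt (by simp))

theorem sec_md {U : Set T.Space} (hU : IsOpen U) {v : Sec T.vertical} (hw : SmoothSecOn U v)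
    {z : T.Space} (hz : z ∈ U) : MDifferentiableAt 𝓘(ℝ, A × P) 𝓘(ℝ, P) (comp v) z := by
  rw [smoothSec_iff] at hw
  exact ((hw.contMDiffAt (hU.mem_nhds hz)).mdifferentiableAt (by simp))

def cst (b : P) : Sec T.vertical := fun _ => ⟨show A × P from (0, b), by
  change LinearMap.fst ℝ A P (0, _) = 0; rfl⟩

theorem cst_smooth (b : P) (U) : SmoothSecOn U (T.cst b) := by
  rw [smoothSec_iff]
  exact contMDiffOn_const (c := b)

theorem D_comp (u v : Sec T.vertical) {z : T.Space} (h : MDifferentiableAt 𝓘(ℝ, A × P) 𝓘(ℝ, P) (comp v) z) :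
    comp (T.octuple.D u v) z = fderiv ℝ (T.tl (comp v) z) (T.coord z) (0, comp u z) := by
  have : comp (T.octuple.D u v) z = mfderiv 𝓘(ℝ, A × P) 𝓘(ℝ, P) (comp v) z (u z).1 := rfl
  rw [this, mfderiv_eq T h, sec_val]; rfl

theorem sec_ext {z : T.Space} {v w : T.vertical z} (h : (show A × P from v.1).2 = (show A × P from w.1).2) : v = w := by
  apply Subtype.ext
  refine Prod.ext ?_ h
  exact (show (show A × P from v.1).1 = 0 from v.2).trans (show (show A × P from w.1).1 = 0 from w.2).symm

theorem par {U : Set T.Space} (hU : IsOpen U) {v : Sec T.vertical} (hv : IsParallelOn T.octuple.D U v)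
   {z : T.Space} (hz : z ∈ U) (b : P) : fderiv ℝ (T.tl (comp v) z) (T.coord z) (0, b) = 0 := by
  have h := hv.2 (T.cst b) (T.cst_smooth b U) z hz
  have h2 := T.D_comp (T.cst b) v (T.sec_md hU hv.1 hz)
  have h3 : comp (T.octuple.D (T.cst b) v) z = 0 := by
    unfold comp; rw [h]; rfl
  rw [h3] at h2
  exact h2.symm

theorem proj {U : Set T.Space} (hU : IsOpen U) {w : VecField (A × P) T.Space} (hw : IsProjectableOn T.vertical U w)
   {z : T.Space} (hz : z ∈ U) (b : P) : 
   (fderiv ℝ (T.tl (fld w) z) (T.coord z) (0, b)).1 = 0 := by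
  have h := hw.2 (T.cst b) (T.cst_smooth b U) z hz
  have hw1 := (T.smoothField_iff _ _).1 hw.1
  rw [bracket_eq T w (T.cst b).toField ((hw1.contMDiffAt (hU.mem_nhds hz)).mdifferentiableAt (by simp)) (mdifferentiableAt_const (c := ((0 , b) : A × P)))] at h
  have e : (fderiv ℝ (T.tl (fld (T.cst b).toField) z) (T.coord z)) = 0 := 
    fderiv_const_apply (𝕜 := ℝ) (x := T.coord z) ((0 , b) : A × P)
  rw [e] at h
  have h' : ((0 : A × P) - (fderiv ℝ (T.tl (fld w) z) (T.coord z) (0, b))).1 = 0 := h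
  simpa using h'

def Ωc [FiniteDimensional ℝ P] : P →L[ℝ] P →L[ℝ] ℝ :=
  LinearMap.toContinuousLinearMap ((LinearMap.toContinuousLinearMap : (P →ₗ[ℝ] ℝ) ≃ₗ[ℝ] (P →L[ℝ] ℝ)).toLinearMap.comp T.Ω)

def ξc [FiniteDimensional ℝ A] : A →L[ℝ] ℝ := LinearMap.toContinuousLinearMap T.ξ

def τc [FiniteDimensional ℝ A] : A →L[ℝ] ℝ := LinearMap.toContinuousLinearMap T.τ

theorem fdA (T : TwoPlaneSystem A S P) : FiniteDimensional ℝ A := Module.finite_of_finrank_eq_succ T.finrank_A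

theorem fdP (T : TwoPlaneSystem A S P) : FiniteDimensional ℝ P := Module.finite_of_finrank_eq_succ T.finrank_P

theorem φ_pos (z : T.Space) : 0 < T.φ z := z.2.2

theorem h_apply (z : T.Space) (v : T.vertical z) (w : A × P) :
  T.octuple.h z v w = T.Ω (T.ξ w.1 • z.2.1 + T.τ w.1 • T.c) (show A × P from v.1).2 := rfl

theorem α_apply (z : T.Space) (v : T.vertical z) :
  T.octuple.α z v = -(T.φ z)⁻¹ * T.Ω (show A × P from v.1).2 T.c := rfl

theorem β_apply (z : T.Space) (w : A × P) :
  T.octuple.β z w = ((T.φ z)^2)⁻¹ * T.ξ w.1 := rfl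

theorem θ_apply (z : T.Space) (v w : T.vertical z) :
  T.octuple.θ z v w = (T.φ z)^2 * T.Ω (show A × P from v.1).2 (show A × P from w.1).2 := rfl

theorem ζ_apply (z : T.Space) (w w' : A × P) :
  T.octuple.ζ z w w' = (2 * (T.φ z)⁻¹) * (T.ξ w.1 * T.τ w'.1 - T.τ w.1 * T.ξ w'.1) := rfl

theorem inj {a : A} (h1 : T.ξ a = 0) (h2 : T.τ a = 0) : a = 0 := by
  have := T.fdA
  have hli := T.linearIndependent
  let b := basisOfLinearIndependentOfCardEqFinrank hli (by simp [T.finrank_A])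
  rw [← Module.forall_dual_apply_eq_zero_iff ℝ a]
  intro f
  have hf := b.sum_repr f
  rw [← hf]
  simp [b, h1, h2, Fin.sum_univ_two]

theorem Ωcc (X : P) : T.Ω T.c X = - T.Ω X T.c := (T.Ω_alt.neg X T.c).symm ▸ rfl

theorem Ω_span (z : T.Space) {v : P} (h1 : T.Ω z.2.1 v = 0) (h2 : T.Ω T.c v = 0) : v = 0 := by
  have := T.fdP
  have hφ : T.Ω z.2.1 T.c ≠ 0 := (T.φ_pos z).ne'
  have hli : LinearIndependent ℝ ![z.2.1, T.c] := by
    rw [LinearIndependent.pair_iff]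
    intro s t hst
    have e1 := congrArg (fun x => T.Ω x T.c) hst
    have e2 := congrArg (fun x => T.Ω z.2.1 x) hst
    simp [T.Ω_alt.self_eq_zero, hφ] at e1 e2
    exact ⟨e1, e2⟩
  let b := basisOfLinearIndependentOfCardEqFinrank hli (by simp [T.finrank_P])
  have hv := b.sum_repr v
  simp only [Fin.sum_univ_two, b, coe_basisOfLinearIndependentOfCardEqFinrank, Matrix.cons_val_zero, Matrix.cons_val_one] at hv
  generalize ((basisOfLinearIndependentOfCardEqFinrank hli _).repr v) 0 = s0 at hv
  generalize ((basisOfLinearIndependentOfCardEqFinrank hli _).repr v) 1 = s1 at hv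
  rw [← hv] at h1 h2
  simp [T.Ω_alt.self_eq_zero, hφ, T.Ωcc] at h1 h2
  rw [← hv, h1, h2]; simp

theorem tl_D {U : Set T.Space} (hU : IsOpen U) {u v : Sec T.vertical} (hv : SmoothSecOn U v) (z : T.Space) :
    ∀ y ∈ T.coord '' U, T.tl (comp (T.octuple.D u v)) z y = fderiv ℝ (T.tl (comp v) z) y (0, T.tl (comp u) z y) := by
  rintro _ ⟨x, hx, rfl⟩
  have := T.D_comp u v (T.sec_md hU hv hx)
  simp only [tl, σ_coord] at this ⊢
  exact this

theorem D_val (u v : Sec T.vertical) {z : T.Space} {w : T.vertical z} (h : comp (T.octuple.D u v) z = (show A × P from w.1).2) :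
   T.octuple.D u v z = w := T.sec_ext h

theorem two_le' : (2 : WithTop ℕ∞) ≤ ∞ := ENat.LEInfty.out

theorem two_le : (1 + 1 : WithTop ℕ∞) ≤ ∞ := by rw [one_add_one_eq_two]; exact two_le'

theorem D_smooth {U : Set T.Space} (hU : IsOpen U) {u v : Sec T.vertical} (hu : SmoothSecOn U u) (hv : SmoothSecOn U v) :
    SmoothSecOn U (T.octuple.D u v) := by
    rcases isEmpty_or_nonempty T.Space with h | ⟨⟨z⟩⟩
    · intro x; exact h.elim x
    replace hu := (T.smoothSec_iff _ _).1 hu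
    replace hv := (T.smoothSec_iff _ _).1 hv
    refine (T.smoothSec_iff U (T.octuple.D u v)).2 ?_
    refine smooth_of_tl (F := P) T z ?_
    have h1 : ContDiffOn ℝ ∞ (fun y => fderiv ℝ (T.tl (comp v) z) y (0, T.tl (comp u) z y)) (T.coord '' U) := by
      have h4 := T.smooth_tl z hu
      have h2 : ContDiffOn ℝ ∞ (fun y => ((0 : A), T.tl (comp u) z y)) (T.coord '' U) := (contDiffOn_const (c := (0:A))).prodMk h4
      have h3 : ContDiffOn ℝ ∞ (fderiv ℝ (T.tl (comp v) z)) (T.coord '' U) := (T.smooth_tl z hv).fderiv_of_isOpen (m := ∞) (T.open_image hU) (by simp)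
      exact h3.clm_apply h2
    exact h1.congr (T.tl_D hU ((T.smoothSec_iff _ _).2 hv) z)

theorem D_D {U : Set T.Space} (hU : IsOpen U) {u v w : Sec T.vertical} (hv : SmoothSecOn U v) (hw : SmoothSecOn U w) {z : T.Space} (hz : z ∈ U) :
    comp (T.octuple.D u (T.octuple.D v w)) z = 
      fderiv ℝ (fderiv ℝ (T.tl (comp w) z)) (T.coord z) (0, comp u z) (0, comp v z) + 
      fderiv ℝ (T.tl (comp w) z) (T.coord z) (0, comp (T.octuple.D u v) z) := by
  rw [T.D_comp _ _ (T.sec_md hU (T.D_smooth hU hv hw) hz), T.D_comp _ _ (T.sec_md hU hv hz)]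
  have e : T.tl (comp (T.octuple.D v w)) z =ᶠ[nhds (T.coord z)] fun y => fderiv ℝ (T.tl (comp w) z) y (0, T.tl (comp v) z y) := by
    filter_upwards [(T.open_image hU).mem_nhds ⟨z, hz, rfl⟩] with y hy
    exact T.tl_D hU hw z y hy
  rw [e.fderiv_eq]
  have hw1 := (T.smooth_tl z ((T.smoothSec_iff _ _).1 hw)).contDiffAt ((T.open_image hU).mem_nhds ⟨z, hz, rfl⟩)
  have h1 : HasFDerivAt (fderiv ℝ (T.tl (comp w) z)) (fderiv ℝ (fderiv ℝ (T.tl (comp w) z)) (T.coord z)) (T.coord z) :=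
    ((hw1.fderiv_right (m := 1) two_le).differentiableAt (by simp)).hasFDerivAt
  have h2 := (HasFDerivAt.prodMk (hasFDerivAt_const (0:A) (T.coord z)) (T.mdiff_iff (T.sec_md hU hv hz)).hasFDerivAt)
  have h3 := (h1.clm_apply h2).fderiv
  rw [h3]
  simp [σ_coord]
  rw [add_comm]

theorem torsf {U : Set T.Space} (hU : IsOpen U) {u v : Sec T.vertical} (hu : SmoothSecOn U u) (hv : SmoothSecOn U v) {z : T.Space} (hz : z ∈ U) :
    (T.octuple.D u v z).1 - (T.octuple.D v u z).1 = VectorField.mlieBracket 𝓘(ℝ, A × P) u.toField v.toField z := by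
    have hu1 := (T.smoothField_iff _ _).1 hu
    have hv1 := (T.smoothField_iff _ _).1 hv
    rw [bracket_eq T _ _ ((hu1.contMDiffAt (hU.mem_nhds hz)).mdifferentiableAt (by simp)) ((hv1.contMDiffAt (hU.mem_nhds hz)).mdifferentiableAt (by simp))]
    have key : ∀ u v : Sec T.vertical, SmoothSecOn U v → (T.octuple.D u v z).1 = (fderiv ℝ (T.tl (fld v.toField) z) (T.coord z)) (u.toField z) := by
      intro u v hv
      refine (T.sec_val _ _).trans ?_
      rw [T.D_comp _ _ (T.sec_md hU hv hz)]
      have e : T.tl (fld v.toField) z = fun y => ((0:A), T.tl (comp v) z y) := by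
        ext1 y; exact T.sec_val _ _
      rw [e]
      have := (HasFDerivAt.prodMk (hasFDerivAt_const (0:A) (T.coord z)) (T.mdiff_iff (T.sec_md hU hv hz)).hasFDerivAt).fderiv
      refine Eq.trans ?_ (congrArg (fun L => L (u.toField z)) this).symm
      simp only [Sec.toField]
      rw [sec_val]
      simp
      rfl
    exact congrArg₂ (fun a b : A × P => a - b) (key u v hv) (key v u hu)

theorem flatTF : IsFlatTorsionFree T.vertical T.octuple.D where
  smooth U hU u v hu hv := T.D_smooth hU hu hv
  isLocal U hU u v u' v' hu hv hu' hv' e1 e2 z hz := by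
    apply T.D_val
    rw [T.D_comp u v (T.sec_md hU hv hz)]
    change _ = comp (T.octuple.D u' v') z
    rw [T.D_comp u' v' (T.sec_md hU hv' hz)]
    have : T.tl (comp v) z =ᶠ[nhds (T.coord z)] T.tl (comp v') z := by
      filter_upwards [(T.open_image hU).mem_nhds ⟨z, hz, rfl⟩]
      rintro _ ⟨x, hx, rfl⟩
      have hx' : T.σ z (T.coord x) = x := T.σ_coord z x
      have e := e2 (T.σ z (T.coord x)) (by rw [hx']; exact hx)
      simp only [tl, comp, e]
    rw [this.fderiv_eq]
    unfold comp
    rw [e1 z hz]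
  add_left U hU u u' v hu hu' hv z hz := by
    apply T.D_val
    change _ = comp (T.octuple.D u v) z + comp (T.octuple.D u' v) z
    simp only [T.D_comp _ v (T.sec_md hU hv hz)]
    rw [← map_add]
    congr 1
    simp [Prod.ext_iff]; rfl
  smul_left U hU f u v hf hu hv z hz := by
    apply T.D_val
    change _ = f z • comp (T.octuple.D u v) z
    simp only [T.D_comp _ v (T.sec_md hU hv hz)]
    rw [← map_smul]
    congr 1
    simp [Prod.ext_iff]; rfl
  add_right U hU u v v' hu hv hv' z hz := by
    apply T.D_val
    change _ = comp (T.octuple.D u v) z + comp (T.octuple.D u v') z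
    have e : comp (fun y => v y + v' y) = comp v + comp v' := rfl
    rw [T.D_comp _ _ (T.sec_md hU hv hz), T.D_comp _ _ (T.sec_md hU hv' hz), T.D_comp]
    · rw [e]
      have := fderiv_add (T.mdiff_iff (T.sec_md hU hv hz)) (T.mdiff_iff (T.sec_md hU hv' hz))
      exact congrArg (fun L => L (0, comp u z)) this
    · rw [e]
      exact (T.sec_md hU hv hz).add (T.sec_md hU hv' hz)
  leibniz U hU f u v hf hu hv z hz := by
    apply T.D_val
    change _ = f z • comp (T.octuple.D u v) z + dirDeriv f z (u z).1 • comp v z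
    have e : comp (fun y => f y • v y) = fun y => f y • comp v y := rfl
    have hf' : MDifferentiableAt 𝓘(ℝ, A × P) 𝓘(ℝ, ℝ) f z := (hf.contMDiffAt (hU.mem_nhds hz)).mdifferentiableAt (by simp)
    rw [T.D_comp _ _ (T.sec_md hU hv hz), T.D_comp]
    · rw [e]
      have := fderiv_fun_smul (T.mdiff_iff hf') (T.mdiff_iff (T.sec_md hU hv hz))
      refine (congrArg (fun L => L (0, comp u z)) this).trans ?_
      simp only [σ_coord]
      rw [dirDeriv, mfderiv_eq T hf', sec_val]
      rfl
    · rw [e]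
      have h1 := (T.smoothSec_iff _ _).1 hv
      exact ((hf.smul h1).contMDiffAt (hU.mem_nhds hz)).mdifferentiableAt (by simp)
  torsion_free U hU u v hu hv z hz := T.torsf hU hu hv hz
  flat U hU u v w x hu hv hw hx hbr z hz := by
    have hb := hbr z hz
    rw [← T.torsf hU hu hv hz] at hb
    have hb' : comp x z = comp (T.octuple.D u v) z - comp (T.octuple.D v u) z := congrArg (fun a : A × P => a.2) hb
    apply T.sec_ext
    change comp (T.octuple.D u (T.octuple.D v w)) z - comp (T.octuple.D v (T.octuple.D u w)) z - comp (T.octuple.D x w) z = 0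
    rw [T.D_D hU hv hw hz, T.D_D hU hu hw hz, T.D_comp x w (T.sec_md hU hw hz), hb']
    have hw1 := (T.smooth_tl z ((T.smoothSec_iff _ _).1 hw)).contDiffAt ((T.open_image hU).mem_nhds ⟨z, hz, rfl⟩)
    have hs := (hw1.isSymmSndFDerivAt (by simpa using two_le')).eq (0, comp u z) (0, comp v z)
    rw [hs]
    have : ((0 : A), comp (T.octuple.D u v) z - comp (T.octuple.D v u) z) = (0, comp (T.octuple.D u v) z) - (0, comp (T.octuple.D v u) z) := by simp
    rw [this, map_sub]
    abel

def pt (w w' : VecField (A × P) T.Space) (v v' : Sec T.vertical) (x : T.Space) : A × A × P × P × P :=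
  ((fld w x).1, (fld w' x).1, (T.coord x).2, comp v x, comp v' x)

theorem pt_smooth {U : Set T.Space} {w w' : VecField (A × P) T.Space} {v v' : Sec T.vertical}
    (hw : SmoothFieldOn U w) (hw' : SmoothFieldOn U w') (hv : SmoothSecOn U v) (hv' : SmoothSecOn U v') :
    ContMDiffOn 𝓘(ℝ, A × P) 𝓘(ℝ, A × A × P × P × P) ∞ (T.pt w w' v v') U := by
  rcases isEmpty_or_nonempty T.Space with h | ⟨⟨z⟩⟩
  · intro x; exact h.elim x
  refine T.smooth_of_tl z ?_
  have h1 := T.smooth_tl z ((T.smoothSec_iff _ _).1 hv)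
  have h1' := T.smooth_tl z ((T.smoothSec_iff _ _).1 hv')
  have h2 := T.smooth_tl z ((T.smoothField_iff _ _).1 hw)
  have h2' := T.smooth_tl z ((T.smoothField_iff _ _).1 hw')
  have h3 := T.smooth_tl z (T.smooth_coord.contMDiffOn (s := U))
  exact h2.fst.prodMk (h2'.fst.prodMk (h3.snd.prodMk (h1.prodMk h1')))

theorem F_smooth {U : Set T.Space} (hU : IsOpen U) {w w' : VecField (A × P) T.Space} {v v' : Sec T.vertical}
    (hw : SmoothFieldOn U w) (hw' : SmoothFieldOn U w') (hv : SmoothSecOn U v) (hv' : SmoothSecOn U v')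
    {F : A × A × P × P × P → ℝ} (hF : ∀ x, ContDiffAt ℝ ∞ F (T.pt w w' v v' x)) :
    SmoothFunOn (A × P) U (fun x => F (T.pt w w' v v' x)) := by
  intro x hx
  exact ((hF x).contMDiffAt.comp_contMDiffWithinAt x (T.pt_smooth hw hw' hv hv' x hx))

theorem chain {U : Set T.Space} (hU : IsOpen U) {w w' : VecField (A × P) T.Space} {v v' : Sec T.vertical}
    (hw : IsProjectableOn T.vertical U w) (hw' : IsProjectableOn T.vertical U w')
    (hv : IsParallelOn T.octuple.D U v) (hv' : IsParallelOn T.octuple.D U v')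
    {F : A × A × P × P × P → ℝ} (hF : ∀ x, ContDiffAt ℝ ∞ F (T.pt w w' v v' x)) {z : T.Space} (hz : z ∈ U)
    (u : T.vertical z) {d : ℝ} 
    (hd : HasDerivAt (fun t : ℝ => F ((fld w z).1, (fld w' z).1, (T.coord z).2 + t • (show A × P from u.1).2, comp v z, comp v' z)) d 0) :
    dirDeriv (fun x => F (T.pt w w' v v' x)) z u.1 = d := by
  set b : P := (show A × P from u.1).2 with hb
  have hu : u.1 = ((0, b) : A × P) := Prod.ext u.2 rfl
  have sm := ((T.F_smooth hU hw.1 hw'.1 hv.1 hv'.1 hF).contMDiffAt (hU.mem_nhds hz)).mdifferentiableAt (by simp)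
  have hFd : HasFDerivAt F (fderiv ℝ F (T.pt w w' v v' z)) (T.pt w w' v v' z) := ((hF z).differentiableAt (by simp)).hasFDerivAt
  have p1 := (T.field_tl hU hw.1 hz).hasFDerivAt
  have p2 := (T.field_tl hU hw'.1 hz).hasFDerivAt
  have p3 := (T.mdiff_iff (T.sec_md hU hv.1 hz)).hasFDerivAt
  have p4 := (T.mdiff_iff (T.sec_md hU hv'.1 hz)).hasFDerivAt
  have pp := p1.fst.prodMk (p2.fst.prodMk ((hasFDerivAt_snd (𝕜 := ℝ) (p := T.coord z)).prodMk (p3.prodMk p4)))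
  have hg : HasFDerivAt F (fderiv ℝ F (T.pt w w' v v' z)) 
    ((T.tl (fld w) z (T.coord z)).1, (T.tl (fld w') z (T.coord z)).1, (T.coord z).2, comp v (T.σ z (T.coord z)), comp v' (T.σ z (T.coord z))) := by
    simp only [tl, σ_coord]; exact hFd
  have key := hg.comp (T.coord z) pp
  have := T.dirDeriv_eq sm key (by
    filter_upwards [T.coord_σ z] with y hy
    simp only [Function.comp, pt, hy, tl]) (0, b)
  have l1 : dirDeriv (fun x => F (T.pt w w' v v' x)) z u.1 = dirDeriv (fun x => F (T.pt w w' v v' x)) z (show TangentSpace 𝓘(ℝ, A × P) z from ((0, b) : A × P)) := by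
    rw [hu]
  rw [l1, this]
  have q1 := T.proj hU hw hz b
  have q2 := T.proj hU hw' hz b
  have q3 := T.par hU hv hz b
  have q4 := T.par hU hv' hz b
  have line : HasDerivAt (fun t : ℝ => ((fld w z).1, (fld w' z).1, (T.coord z).2 + t • b, comp v z, comp v' z)) ((0 : A), (0 : A), b, (0 : P), (0 : P)) 0 := by
    have hl : HasDerivAt (fun t : ℝ => (T.coord z).2 + t • b) b 0 := by
      simpa using ((hasDerivAt_id (0:ℝ)).smul_const b).const_add (T.coord z).2
    exact (hasDerivAt_const _ _).prodMk ((hasDerivAt_const _ _).prodMk (hl.prodMk ((hasDerivAt_const _ _).prodMk (hasDerivAt_const _ _))))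
  have hFd' : HasFDerivAt F (fderiv ℝ F (T.pt w w' v v' z)) ((fld w z).1, (fld w' z).1, (T.coord z).2 + (0:ℝ) • b, comp v z, comp v' z) := by
    simpa [pt] using hFd
  have hd2 := hFd'.comp_hasDerivAt (0:ℝ) line
  rw [hd.unique hd2, ContinuousLinearMap.comp_apply]
  congr 1
  refine Prod.ext q1 (Prod.ext q2 (Prod.ext rfl (Prod.ext q3 q4)))

def zw (T : TwoPlaneSystem A S P) : VecField (A × P) T.Space := fun _ => ((0 : A × P))

theorem zw_smooth (U) : SmoothFieldOn U T.zw := by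
  rw [smoothField_iff]; exact contMDiffOn_const (c := (0 : A × P))

theorem zw_proj (U) : IsProjectableOn T.vertical U T.zw := by
  refine ⟨T.zw_smooth U, fun v hv x hx => ?_⟩
  have : VectorField.mlieBracket 𝓘(ℝ, A × P) T.zw v.toField = 0 := VectorField.mlieBracket_zero_left
  rw [this]
  exact zero_mem (T.vertical x)

theorem zv_par {U} (hU : IsOpen U) : IsParallelOn T.octuple.D U (T.cst 0) := by
  refine ⟨T.cst_smooth 0 U, fun u hu x hx => ?_⟩
  apply T.D_val
  refine (T.D_comp _ _ (T.sec_md hU (T.cst_smooth 0 U) hx)).trans ?_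
  have e : T.tl (comp (T.cst 0)) x = fun _ => 0 := rfl
  rw [e]
  simp
  rfl

variable [FiniteDimensional ℝ A] [FiniteDimensional ℝ P]

def Fh : A × A × P × P × P → ℝ := fun q => T.Ωc (T.ξc q.1 • q.2.2.1 + T.τc q.1 • T.c) q.2.2.2.1

def Fα : A × A × P × P × P → ℝ := fun q => -(T.Ωc q.2.2.1 T.c)⁻¹ * T.Ωc q.2.2.2.1 T.c

def Fβ : A × A × P × P × P → ℝ := fun q => ((T.Ωc q.2.2.1 T.c)^2)⁻¹ * T.ξc q.1

def Fθ : A × A × P × P × P → ℝ := fun q => ((T.Ωc q.2.2.1 T.c)^2) * T.Ωc q.2.2.2.1 q.2.2.2.2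

def Fζ : A × A × P × P × P → ℝ := fun q => (2 * (T.Ωc q.2.2.1 T.c)⁻¹) * (T.ξc q.1 * T.τc q.2.1 - T.τc q.1 * T.ξc q.2.1)

theorem Fh_s (q) : ContDiffAt ℝ ∞ T.Fh q := by
  unfold Fh
  generalize T.Ωc = Ω; generalize T.ξc = ξ; generalize T.τc = τ
  fun_prop

theorem Fα_s (q : A × A × P × P × P) (hq : T.Ωc q.2.2.1 T.c ≠ 0) : ContDiffAt ℝ ∞ T.Fα q := by
  unfold Fα
  generalize T.Ωc = Ω at *
  fun_prop (disch := assumption)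

theorem Fβ_s (q : A × A × P × P × P) (hq : T.Ωc q.2.2.1 T.c ≠ 0) : ContDiffAt ℝ ∞ T.Fβ q := by
  have := pow_ne_zero 2 hq
  unfold Fβ
  generalize T.Ωc = Ω at *;  generalize T.ξc = ξ
  fun_prop (disch := assumption)

theorem Fθ_s (q : A × A × P × P × P) : ContDiffAt ℝ ∞ T.Fθ q := by
  unfold Fθ
  generalize T.Ωc = Ω at *
  fun_prop (disch := assumption)

theorem Fζ_s (q : A × A × P × P × P) (hq : T.Ωc q.2.2.1 T.c ≠ 0) : ContDiffAt ℝ ∞ T.Fζ q := by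
  unfold Fζ
  generalize T.Ωc = Ω at *;  generalize T.ξc = ξ; generalize T.τc = τ
  fun_prop (disch := assumption)

theorem pt_ne (w w' v v') (x : T.Space) : T.Ωc (T.pt w w' v v' x).2.2.1 T.c ≠ 0 := (T.φ_pos x).ne'

theorem Ωφ (x : T.Space) : (T.Ωc (T.coord x).2) T.c = T.φ x := rfl

theorem linΩ {x : T.Space} (u : T.vertical x) : HasDerivAt (fun t : ℝ => T.Ωc ((T.coord x).2 + t • (show A × P from u.1).2) T.c) (T.Ω (show A × P from u.1).2 T.c) 0 := by
  have hl : HasDerivAt (fun t : ℝ => (T.coord x).2 + t • (show A × P from u.1).2) (show A × P from u.1).2 0 := by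
      simpa using ((hasDerivAt_id (0:ℝ)).smul_const (show A × P from u.1).2).const_add (T.coord x).2
  exact ((T.Ωc.flip T.c).hasFDerivAt.comp_hasDerivAt (0:ℝ) hl)

theorem kerζ (x : T.Space) : T.octuple.V x = LinearMap.ker (T.octuple.ζ x) := by
  have hφ := (T.φ_pos x).ne'
  ext w
  rw [LinearMap.mem_ker]
  constructor
  · intro h
    have h1 : (show A × P from w).1 = 0 := h
    ext w'
    refine (T.ζ_apply x w w').trans ?_
    change 2 * (T.φ x)⁻¹ * (T.ξ (show A × P from w).1 * _ - T.τ (show A × P from w).1 * _) = 0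
    rw [h1]; simp
  · intro h
    have hh : ∀ a : A, T.ξ (show A × P from w).1 * T.τ a - T.τ (show A × P from w).1 * T.ξ a = 0 := by
      intro a
      have := congrArg (fun L : A × P →ₗ[ℝ] ℝ => L (a, 0)) h
      have h2 : 2 * (T.φ x)⁻¹ * (T.ξ (show A × P from w).1 * T.τ a - T.τ (show A × P from w).1 * T.ξ a) = 0 := this
      simpa [hφ] using h2
    have hli := T.linearIndependent
    rw [LinearIndependent.pair_iff] at hli
    have := hli (-T.τ (show A × P from w).1) (T.ξ (show A × P from w).1) (by
      ext a
      have := hh a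
      simp only [LinearMap.add_apply, LinearMap.smul_apply, smul_eq_mul, LinearMap.zero_apply]
      linarith)
    exact T.inj this.2 (neg_eq_zero.1 this.1)

theorem frV (x : T.Space) : Module.finrank ℝ (T.vertical x) = 2 := by
      have h := LinearMap.finrank_range_add_finrank_ker (LinearMap.fst ℝ A P)
      rw [LinearMap.range_eq_top.2 LinearMap.fst_surjective, finrank_top, Module.finrank_prod, T.finrank_A, T.finrank_P] at h
      change Module.finrank ℝ (LinearMap.ker (LinearMap.fst ℝ A P)) = 2
      omega

theorem dhl {U : Set T.Space} (hU : IsOpen U) {v : Sec T.vertical} {w : VecField (A × P) T.Space}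
   (hv : IsParallelOn T.octuple.D U v) (hw : IsProjectableOn T.vertical U w) {x : T.Space} (hx : x ∈ U) (u : T.vertical x) :
   dirDeriv (fun y => T.octuple.h y (v y) (w y)) x u.1 = T.octuple.β x (w x) * T.octuple.θ x u (v x) := by
    refine T.chain hU hw hw hv (T.zv_par hU) (fun x => T.Fh_s _) hx u ?_
    have hl : HasDerivAt (fun t : ℝ => (T.coord x).2 + t • (show A × P from u.1).2) (show A × P from u.1).2 0 := by
      simpa using ((hasDerivAt_id (0:ℝ)).smul_const (show A × P from u.1).2).const_add (T.coord x).2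
    have h2 := ((hl.const_smul (T.ξc (fld w x).1)).add_const (T.τc (fld w x).1 • T.c))
    have h3 := ((T.Ωc.flip (comp v x)).hasFDerivAt.comp_hasDerivAt (0:ℝ) h2)
    refine h3.congr_deriv ?_
    rw [show T.octuple.θ x u (v x) = _ from T.θ_apply x u (v x), show T.octuple.β x (w x) = _ from T.β_apply x (w x)]
    have := (T.φ_pos x).ne'
    change T.Ω (T.ξ (fld w x).1 • (show A × P from u.1).2) (comp v x) = ((T.φ x)^2)⁻¹ * T.ξ (fld w x).1 * ((T.φ x)^2 * T.Ω (show A × P from u.1).2 (comp v x))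
    simp
    field_simp

theorem octuple_isBasic : T.octuple.IsBasic where
  dim_eq := by rw [Module.finrank_prod, T.finrank_A, T.finrank_P]
  isPlaneDistribution := by
    have hr : ∀ x : T.Space, Module.finrank ℝ (T.vertical x) = 2 := by
      intro x
      have h := LinearMap.finrank_range_add_finrank_ker (LinearMap.fst ℝ A P)
      rw [LinearMap.range_eq_top.2 LinearMap.fst_surjective, finrank_top, Module.finrank_prod, T.finrank_A, T.finrank_P] at h
      change Module.finrank ℝ (LinearMap.ker (LinearMap.fst ℝ A P)) = 2
      omega
    refine ⟨hr, fun x => ⟨Set.univ, isOpen_univ, trivial, fun i => T.cst (Module.finBasisOfFinrankEq ℝ P T.finrank_P i), fun i => T.cst_smooth _ _, fun y _ => ?_⟩⟩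
    have hb := (Module.finBasisOfFinrankEq ℝ P T.finrank_P).linearIndependent
    refine LinearIndependent.of_comp ((LinearMap.snd ℝ A P).comp (T.vertical y).subtype) ?_
    exact hb
  isIntegrable := by
    intro x
    have hl : ContDiff ℝ ∞ (fun y : A × P => (T.ξc y.1, T.τc y.1)) := by
      generalize T.ξc = ξ; generalize T.τc = τ
      fun_prop
    have hs : ContMDiff 𝓘(ℝ, A × P) 𝓘(ℝ, ℝ × ℝ) ∞ (fun z : T.Space => (T.ξc (T.coord z).1, T.τc (T.coord z).1)) :=
      hl.contMDiff.comp T.smooth_coord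
    refine ⟨Set.univ, isOpen_univ, trivial, _, hs.contMDiffOn, fun y _ => ?_⟩
    have hd : ∀ w : A × P, mfderiv 𝓘(ℝ, A × P) 𝓘(ℝ, ℝ × ℝ) (fun z : T.Space => (T.ξc (T.coord z).1, T.τc (T.coord z).1)) y (show TangentSpace 𝓘(ℝ, A × P) y from w) = ((T.ξ w.1, T.τ w.1) : ℝ × ℝ) := by
      intro w
      rw [mfderiv_eq T (hs.contMDiffAt.mdifferentiableAt (by simp))]
      have e : (fun x => (fun z : T.Space => (T.ξc (T.coord z).1, T.τc (T.coord z).1)) (T.σ y x)) =ᶠ[nhds (T.coord y)] (fun y : A × P => (T.ξc y.1, T.τc y.1)) := by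
        filter_upwards [T.coord_σ y] with q hq
        simp only [hq]
      rw [e.fderiv_eq]
      have := (((T.ξc.comp (ContinuousLinearMap.fst ℝ A P)).hasFDerivAt (x := T.coord y)).prodMk ((T.τc.comp (ContinuousLinearMap.fst ℝ A P)).hasFDerivAt (x := T.coord y))).fderiv
      exact congrArg (fun L => L w) this
    constructor
    · have hinj : Function.Injective (T.ξ.prod T.τ) := by
        rw [injective_iff_map_eq_zero]
        intro a ha
        exact T.inj (congrArg Prod.fst ha) (congrArg Prod.snd ha)
      have hsurj := (LinearMap.injective_iff_surjective_of_finrank_eq_finrank (by rw [T.finrank_A]; simp)).1 hinj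
      intro q
      obtain ⟨a, ha⟩ := hsurj q
      exact ⟨((a, 0) : A × P), (hd (a, 0)).trans ha⟩
    · intro w
      have hw := hd w
      constructor
      · intro h
        have h1 : (show A × P from w).1 = 0 := h
        refine hw.trans ?_
        rw [h1]; simp; rfl
      · intro h
        have h' := hw.symm.trans h
        have h1 : (show A × P from w).1 = 0 := T.inj (congrArg Prod.fst h') (congrArg Prod.snd h')
        exact h1
  isFlatTorsionFree := T.flatTF
  isPartialMetric := by
    refine ⟨fun U hU v w hv hw => T.F_smooth hU hw (T.zw_smooth U) hv (T.cst_smooth 0 U) (fun x => T.Fh_s _), ?_⟩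
    intro x w
    constructor
    · intro h
      have h1 : ∀ b : P, T.Ω b (T.ξ (show A × P from w).1 • x.2.1 + T.τ (show A × P from w).1 • T.c) = 0 := by
        intro b
        rw [← T.Ω_alt.neg]
        have := h (T.cst b x)
        rw [neg_eq_zero]; exact this
      have h2 := T.Ω_span x (h1 _) (h1 _)
      have e1 := congrArg (fun q => T.Ω q T.c) h2
      have e2 := congrArg (fun q => T.Ω x.2.1 q) h2
      have hφ : T.Ω x.2.1 T.c ≠ 0 := (T.φ_pos x).ne'
      simp [T.Ω_alt.self_eq_zero, hφ] at e1 e2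
      exact T.inj e1 e2
    · intro h v
      have h1 : (show A × P from w).1 = 0 := h
      refine (T.h_apply x v w).trans ?_
      change T.Ω (T.ξ (show A × P from w).1 • x.2.1 + T.τ (show A × P from w).1 • T.c) _ = 0
      rw [h1]; simp
  isSkewAffine := by
    intro U hU v w hv hw x hx
    rw [T.dhl hU hv hw hx (v x), show T.octuple.θ x (v x) (v x) = _ from T.θ_apply x (v x) (v x)]
    rw [T.Ω_alt.self_eq_zero, mul_zero, mul_zero]
  α_smooth U hU v hv := T.F_smooth hU (T.zw_smooth U) (T.zw_smooth U) hv (T.cst_smooth 0 U) (fun x => T.Fα_s _ (T.pt_ne _ _ _ _ _))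
  β_smooth U hU w hw := T.F_smooth hU hw (T.zw_smooth U) (T.cst_smooth 0 U) (T.cst_smooth 0 U) (fun x => T.Fβ_s _ (T.pt_ne _ _ _ _ _))
  θ_smooth U hU v v' hv hv' := T.F_smooth hU (T.zw_smooth U) (T.zw_smooth U) hv hv' (fun x => T.Fθ_s _)
  ζ_smooth U hU w w' hw hw' := T.F_smooth hU hw hw' (T.cst_smooth 0 U) (T.cst_smooth 0 U) (fun x => T.Fζ_s _ (T.pt_ne _ _ _ _ _))
  θ_alt x v := by
    refine (T.θ_apply x v v).trans ?_
    rw [T.Ω_alt.self_eq_zero, mul_zero]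
  ζ_alt x w := by
    refine (T.ζ_apply x w w).trans ?_; ring
  β_ne_zero x h := by
    have hξ : T.ξ ≠ 0 := T.linearIndependent.ne_zero 0
    apply hξ
    ext a
    have := congrArg (fun L : A × P →ₗ[ℝ] ℝ => L (a, 0)) h
    have h2 : ((T.φ x)^2)⁻¹ * T.ξ a = 0 := this
    simpa [(T.φ_pos x).ne'] using h2
  ζ_rank x := by
    have e := T.kerζ x
    have h4 : Module.finrank ℝ (TangentSpace 𝓘(ℝ, A × P) x) = 4 := by
      change Module.finrank ℝ (A × P) = 4
      rw [Module.finrank_prod, T.finrank_A, T.finrank_P]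
    have h5 : Module.finrank ℝ (LinearMap.ker (T.octuple.ζ x)) = 2 := by
      rw [← e]; exact T.frV x
    have : FiniteDimensional ℝ (TangentSpace 𝓘(ℝ, A × P) x) := inferInstanceAs (FiniteDimensional ℝ (A × P))
    have h := LinearMap.finrank_range_add_finrank_ker (T.octuple.ζ x)
    rw [h4] at h
    have h6 := h5
    omega
  dh U hU u v w hu hv hw x hx := T.dhl hU hv hw hx (u x)
  dα U hU u v hu hv x hx := by
    refine T.chain hU (T.zw_proj U) (T.zw_proj U) hv (T.zv_par hU) (fun x => T.Fα_s _ (T.pt_ne _ _ _ _ _)) hx (u x) ?_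
    refine (((T.linΩ (u x)).fun_inv (by simpa [Ωφ] using (T.φ_pos x).ne')).fun_neg.mul_const (T.Ωc (comp v x) T.c)).congr_deriv ?_
    rw [show T.octuple.α x (u x) = _ from T.α_apply x (u x), show T.octuple.α x (v x) = _ from T.α_apply x (v x)]
    have := (T.φ_pos x).ne'
    simp
    change _ = (T.φ x)⁻¹ * (T.Ω (comp u x) T.c) * ((T.φ x)⁻¹ * T.Ω (comp v x) T.c)
    change -(-T.Ω (comp u x) T.c / (T.φ x)^2 * (T.Ω (comp v x) T.c)) = _
    field_simp
  dζ U hU u w w' hu hw hw' x hx := by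
    refine T.chain hU hw hw' (T.zv_par hU) (T.zv_par hU) (fun x => T.Fζ_s _ (T.pt_ne _ _ _ _ _)) hx (u x) ?_
    refine ((((T.linΩ (u x)).fun_inv (by simpa [Ωφ] using (T.φ_pos x).ne')).const_mul 2).mul_const (T.ξc (fld w x).1 * T.τc (fld w' x).1 - T.τc (fld w x).1 * T.ξc (fld w' x).1)).congr_deriv ?_
    rw [show T.octuple.α x (u x) = _ from T.α_apply x (u x), show T.octuple.ζ x (w x) (w' x) = _ from T.ζ_apply x (w x) (w' x)]
    have := (T.φ_pos x).ne'
    simp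
    change 2 * (-T.Ω (comp u x) T.c / (T.φ x)^2) * (T.ξ (fld w x).1 * T.τ (fld w' x).1 - T.τ (fld w x).1 * T.ξ (fld w' x).1) = - ((T.φ x)⁻¹ * (T.Ω (comp u x) T.c) * (2 * (T.φ x)⁻¹ * (T.ξ (fld w x).1 * T.τ (fld w' x).1 - T.τ (fld w x).1 * T.ξ (fld w' x).1)))
    field_simp
  dβ U hU u w hu hw x hx := by
    refine T.chain hU hw hw (T.zv_par hU) (T.zv_par hU) (fun x => T.Fβ_s _ (T.pt_ne _ _ _ _ _)) hx (u x) ?_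
    refine ((((T.linΩ (u x)).fun_pow 2).fun_inv (by simpa [Ωφ] using (T.φ_pos x).ne')).mul_const (T.ξc (fld w x).1)).congr_deriv ?_
    rw [show T.octuple.α x (u x) = _ from T.α_apply x (u x), show T.octuple.β x (w x) = _ from T.β_apply x (w x)]
    have := (T.φ_pos x).ne'
    simp
    change -(2 * T.φ x * T.Ω (comp u x) T.c) / ((T.φ x)^2)^2 * T.ξ (fld w x).1 = - (2 * ((T.φ x)⁻¹ * T.Ω (comp u x) T.c) * (((T.φ x)^2)⁻¹ * T.ξ (fld w x).1))
    field_simp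
  dθ U hU u v v' hu hv hv' x hx := by
    refine T.chain hU (T.zw_proj U) (T.zw_proj U) hv hv' (fun x => T.Fθ_s _) hx (u x) ?_
    refine (((T.linΩ (u x)).fun_pow 2).mul_const (T.Ωc (comp v x) (comp v' x))).congr_deriv ?_
    rw [show T.octuple.α x (u x) = _ from T.α_apply x (u x), show T.octuple.θ x (v x) (v' x) = _ from T.θ_apply x (v x) (v' x)]
    have := (T.φ_pos x).ne'
    simp
    change (2 * T.φ x * T.Ω (comp u x) T.c) * T.Ω (comp v x) (comp v' x) = 2 * ((T.φ x)⁻¹ * T.Ω (comp u x) T.c) * ((T.φ x)^2 * T.Ω (comp v x) (comp v' x))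
    field_simp
  sharp x w := by
    have hφ := (T.φ_pos x).ne'
    refine ⟨⟨show A × P from (0, (-2 * ((T.φ x)^2)⁻¹) • T.Y x w), by change LinearMap.fst ℝ A P (0, _) = 0; rfl⟩, ?_, ?_, ?_⟩
    · intro w'
      change T.Ω (T.ξ (show A × P from w').1 • x.2.1 + T.τ (show A × P from w').1 • T.c) ((-2 * ((T.φ x)^2)⁻¹) • (T.ξ (show A × P from w).1 • x.2.1 + T.τ (show A × P from w).1 • T.c)) = (2 * (T.φ x)⁻¹) * (T.ξ (show A × P from w).1 * T.τ (show A × P from w').1 - T.τ (show A × P from w).1 * T.ξ (show A × P from w').1)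
      have : T.Ω x.2.1 T.c = T.φ x := rfl
      simp [T.Ω_alt.self_eq_zero, T.Ωcc, this]
      field_simp
      ring
    · intro v
      change (T.φ x)^2 * T.Ω (show A × P from v.1).2 ((-2 * ((T.φ x)^2)⁻¹) • T.Y x w) = 2 * T.Ω (T.Y x w) (show A × P from v.1).2
      have e := T.Ω_alt.neg (T.Y x w) (show A × P from v.1).2
      rw [map_smul, smul_eq_mul, ← e]
      field_simp
    · change -(T.φ x)⁻¹ * T.Ω ((-2 * ((T.φ x)^2)⁻¹) • (T.ξ (show A × P from w).1 • x.2.1 + T.τ (show A × P from w).1 • T.c)) T.c = 2 * (((T.φ x)^2)⁻¹ * T.ξ (show A × P from w).1)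
      have : T.Ω x.2.1 T.c = T.φ x := rfl
      simp [T.Ω_alt.self_eq_zero, this]
      field_simp
  ker_ζ x := T.kerζ x

end Verification

/-- The basic octuple associated with a two-plane system. -/
def basicOctuple (T : TwoPlaneSystem A S P) : BasicOctuple (A × P) T.Space where
  toOctupleData := T.octuple
  isBasic := by
    have hA := T.fdA
    have hP := T.fdP
    exact T.octuple_isBasic

end TwoPlaneSystem

end Octuples

end

open scoped Manifold ContDiff Topology

/-! Near any point, a basic octuple has coordinates `y₁, y₂, X₁, X₂` in which all its objects are
given by fixed formulas without parameters (`IsNormalOn`). They are the formulas of a two-plane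
system with ξ = dy₁, τ = dy₂, Ω = dX₁ ∧ dX₂ and c = ∂/∂X₂, except that X₁ may be negative. Two
octuples are then matched by matching coordinates, once the coordinates have been normalized at the
base points. The octuple of a two-plane system is simply one more basic octuple.

Construction of the coordinates. Flatness of D gives local parallel frames of V. For parallel v, the
equation for α says that all functions α(v) have the same logarithmic derivative α(u) along the
leaves. Quotients of such functions are leafwise constant, and so there is a parallel frame e₁, e₂
with α(e₂) = 0 and a = α(e₁) nowhere zero (`exists_isFrameOn`). The reciprocal 1/a is affine on each
leaf; it becomes X₁.

The identity α(ζw) = 2β(w), with V = Ker ζ, shows that β vanishes on V. Since β(w), for projectable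
w, has the logarithmic derivative 2α(u), the form β/a² descends to the local leaf space, which is a
plane. There a nonzero 1-form equals g dy₁ with g > 0, and g is absorbed by replacing e₁ with √g e₁,
so that β = a² dy₁ (`exists_normalized_frame`). Similarly a² θ(e₁, e₂) is leafwise constant, and
rescaling e₂ makes it equal to -1.

The two algebraic identities for ζw now give h(e₂, ·) = a⁻¹ dy₁ and ζ = 2a dy₁ ∧ h(e₁, ·)
(`h_ζ_of_frame`). Only the 1-form h(e₁, ·) = S dq₁ + T dq₂ remains, with q₁ = y₁ and q₂ the
coordinates on the leaf space. By the equation for h, T is leafwise constant, while S has derivative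
0 along e₁ and 1 along e₂. If ∂Z/∂q₂ = T, then h(e₁, ·) = dy₂ + X₂ dy₁ with y₂ = Z and X₂ = S -
∂Z/∂q₁, which completes the normal form (`exists_isNormalOn`). An explicit affine change of
coordinates preserving the normal form moves the base point to (0, 0, 1, 0) (`exists_centered`).

The analysis behind this is smooth dependence of solutions of ordinary differential equations on
parameters. It follows from the inverse function theorem in a Banach space of curves, and yields
parallel sections, the integrating factor and the primitive Z. -/

namespace Octuples

set_option linter.unusedSectionVars false

/-! ### Inverse function theorem -/

section InverseFunction

variable {E F : Type*} [NormedAddCommGroup E] [NormedSpace ℝ E] [CompleteSpace E]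
  [NormedAddCommGroup F] [NormedSpace ℝ F]

/-- The inverse function theorem for maps that are `C^∞` near a point. -/
theorem exists_openPartialHomeomorph_of_hasFDerivAt {f : E → F} {a : E}
    (hf : ∀ᶠ y in 𝓝 a, ContDiffAt ℝ ∞ f y) {f' : E ≃L[ℝ] F}
    (hf' : HasFDerivAt f (f' : E →L[ℝ] F) a) :
    ∃ φ : OpenPartialHomeomorph E F, a ∈ φ.source ∧ (∀ y, φ y = f y) ∧
      ContDiffOn ℝ ∞ φ φ.source ∧ ContDiffOn ℝ ∞ φ.symm φ.target ∧
      ∀ y ∈ φ.source, (fderiv ℝ f y).IsInvertible := by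
  have ha := hf.self_of_nhds
  let φ := ha.toOpenPartialHomeomorph f hf' (by simp)
  have hφ : ∀ y, φ y = f y := fun y => rfl
  have haφ : a ∈ φ.source := ha.mem_toOpenPartialHomeomorph_source hf' (by simp)
  have hcont : ContinuousAt (fderiv ℝ f) a := (ha.continuousAt_fderiv (by simp))
  -- Invertible operators form an open set. Shrinking to where the derivative is invertible is what
  -- makes the inverse smooth on its whole domain, and not only at the image of `a`.
  have hinv : ∀ᶠ y in 𝓝 a, (fderiv ℝ f y).IsInvertible := by
    have h1 : (fderiv ℝ f a) ∈ Set.range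
        (ContinuousLinearEquiv.toContinuousLinearMap : (E ≃L[ℝ] F) → E →L[ℝ] F) :=
      ⟨f', hf'.fderiv.symm⟩
    exact hcont.eventually (ContinuousLinearEquiv.isOpen.mem_nhds h1)
  obtain ⟨U, hU, hUo, haU⟩ := eventually_nhds_iff.1 (hf.and hinv)
  refine ⟨φ.restrOpen U hUo, ⟨haφ, haU⟩, hφ, ?_, ?_, ?_⟩
  · intro y hy
    exact (hU y hy.2).1.contDiffWithinAt
  · intro y hy
    have hy' : (φ.symm y) ∈ U := hy.2
    obtain ⟨e, he⟩ := (hU _ hy').2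
    have hd : HasFDerivAt φ (e : E →L[ℝ] F) (φ.symm y) := by
      rw [he]
      exact ((hU _ hy').1.differentiableAt (by simp)).hasFDerivAt
    exact (φ.contDiffAt_symm hy.1 hd (hU _ hy').1).contDiffWithinAt
  · intro y hy
    exact (hU y hy.2).2

end InverseFunction

/-! ### Smoothness of composition operators on spaces of continuous curves -/

section Nemytskii

variable {K : Type} [TopologicalSpace K] [CompactSpace K]
  {E F : Type} [NormedAddCommGroup E] [NormedSpace ℝ E] [NormedAddCommGroup F] [NormedSpace ℝ F]

/-- Pointwise evaluation of a curve of operators on a curve of vectors. -/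
noncomputable def pointwiseApply : C(K, E →L[ℝ] F) →L[ℝ] C(K, E) →L[ℝ] C(K, F) :=
  LinearMap.mkContinuous₂
    (LinearMap.mk₂ ℝ (fun (A : C(K, E →L[ℝ] F)) (η : C(K, E)) =>
        (⟨fun s => A s (η s), by fun_prop⟩ : C(K, F)))
      (fun _ _ _ => by ext; simp) (fun _ _ _ => by ext; simp)
      (fun _ _ _ => by ext; simp) (fun _ _ _ => by ext; simp)) 1
    (fun A η => by
      rw [one_mul, ContinuousMap.norm_le _ (by positivity)]
      intro s
      exact (A s).le_of_opNorm_le_of_le (A.norm_coe_le_norm s) (η.norm_coe_le_norm s))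

/-- The range of `γ` is compact, so `f'` varies by less than ε on balls of one fixed radius δ about
all points of the range. The mean value inequality on these balls bounds the remainder by ε‖η‖,
uniformly in the parameter of the curve. -/
theorem hasFDerivAt_comp_continuousMap {f : C(E, F)} {f' : C(E, E →L[ℝ] F)}
    (hf : ∀ x, HasFDerivAt f (f' x) x) (γ : C(K, E)) :
    HasFDerivAt (fun γ : C(K, E) => f.comp γ) (pointwiseApply (f'.comp γ)) γ := by
  rw [hasFDerivAt_iff_isLittleO_nhds_zero, Asymptotics.isLittleO_iff]
  intro ε hε
  have hK : IsCompact (Set.range γ) := isCompact_range γ.continuous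
  have hu := hK.uniformContinuousAt_of_continuousAt f' (fun a _ => f'.continuous.continuousAt)
    (Metric.dist_mem_uniformity hε)
  obtain ⟨δ, hδ, hδu⟩ := Metric.mem_uniformity_dist.1 hu
  filter_upwards [Metric.ball_mem_nhds (0 : C(K, E)) hδ] with η hη
  rw [ContinuousMap.norm_le _ (by positivity)]
  intro s
  have hηs : ‖η s‖ < δ := (η.norm_coe_le_norm s).trans_lt (by simpa using hη)
  have key := (convex_ball (γ s) δ).norm_image_sub_le_of_norm_hasFDerivWithin_le' (𝕜 := ℝ)
    (f := f) (f' := f') (C := ε) (φ := f' (γ s)) (x := γ s) (y := γ s + η s)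
    (fun x _ => (hf x).hasFDerivWithinAt)
    (fun x hx => by
      have := hδu (a := γ s) (b := x) (by rw [dist_comm]; exact hx) ⟨s, rfl⟩
      have h : dist (f' (γ s)) (f' x) < ε := this
      rw [dist_comm, dist_eq_norm] at h
      exact h.le)
    (Metric.mem_ball_self hδ) (by simpa using hηs)
  rw [add_sub_cancel_left] at key
  exact key.trans (by gcongr; exact η.norm_coe_le_norm s)

/-- Composition with a `C^∞` map is a `C^∞` map between spaces of continuous curves. -/
theorem contDiff_comp_continuousMap (n : ℕ) : ∀ {F : Type} [NormedAddCommGroup F] [NormedSpace ℝ F]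
    (f : C(E, F)), ContDiff ℝ ∞ f → ContDiff ℝ n (fun γ : C(K, E) => f.comp γ) := by
  -- The target `F` must vary in the induction: the derivative is again a composition operator, now
  -- with `fderiv ℝ f` valued in operators, followed by the fixed linear map `pointwiseApply`.
  induction n with
  | zero =>
    intro F _ _ f _
    exact contDiff_zero.2 (ContinuousMap.continuous_postcomp f)
  | succ n ih =>
    intro F _ _ f hf
    have hf' : ContDiff ℝ ∞ (fderiv ℝ f) := hf.fderiv_right (by simp)
    let f' : C(E, E →L[ℝ] F) := ⟨fderiv ℝ f, hf'.continuous⟩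
    push_cast
    rw [contDiff_succ_iff_hasFDerivAt]
    refine ⟨fun γ => pointwiseApply (f'.comp γ),
      (ih f' hf').continuousLinearMap_comp pointwiseApply, ?_⟩
    exact hasFDerivAt_comp_continuousMap
      fun x => (hf.differentiable (by simp) x).hasFDerivAt

end Nemytskii

/-! ### Ordinary differential equations with parameters -/

section ODE

variable {P F : Type} [NormedAddCommGroup P] [NormedSpace ℝ P]
  [NormedAddCommGroup F] [NormedSpace ℝ F]

theorem zero_mem_Icc_neg_one_one : (0 : ℝ) ∈ Set.Icc (-1 : ℝ) 1 := by constructor <;> norm_num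

/-- The primitive vanishing at `0` of a curve defined on `[-1, 1]`. -/
noncomputable def primitiveCLM : C(Set.Icc (-1 : ℝ) 1, F) →L[ℝ] C(Set.Icc (-1 : ℝ) 1, F) :=
  LinearMap.mkContinuous
    { toFun := fun η => ⟨fun s => ∫ σ in (0 : ℝ)..s, η.IccExtend (by norm_num) σ, by
        refine Continuous.comp (g := fun s : ℝ => ∫ σ in (0 : ℝ)..s,
          η.IccExtend (by norm_num) σ) ?_ continuous_subtype_val
        exact intervalIntegral.continuous_primitive
          (fun a b => (ContinuousMap.continuous _).intervalIntegrable a b) 0⟩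
      map_add' := fun η η' => by
        ext s
        exact intervalIntegral.integral_add
          ((η.IccExtend (by norm_num : (-1 : ℝ) ≤ 1)).continuous.intervalIntegrable _ _)
          ((η'.IccExtend (by norm_num : (-1 : ℝ) ≤ 1)).continuous.intervalIntegrable _ _)
      map_smul' := fun c η => by
        ext s
        exact intervalIntegral.integral_smul c _ } 1
    (fun η => by
      rw [one_mul, ContinuousMap.norm_le _ (by positivity)]
      intro s
      refine (intervalIntegral.norm_integral_le_of_norm_le_const (C := ‖η‖)
        fun σ _ => η.norm_coe_le_norm _).trans ?_
      have : |(s : ℝ) - 0| ≤ 1 := by rw [sub_zero]; exact abs_le.2 s.2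
      exact mul_le_of_le_one_right (norm_nonneg _) this)

theorem primitiveCLM_apply (η : C(Set.Icc (-1 : ℝ) 1, F)) (s : Set.Icc (-1 : ℝ) 1) :
    primitiveCLM η s = ∫ σ in (0 : ℝ)..s, η.IccExtend (by norm_num) σ := rfl

/-- The curve `s ↦ (p, t s, γ s)`. -/
noncomputable def curveCLM : (P × ℝ) × C(Set.Icc (-1 : ℝ) 1, F) →L[ℝ]
    C(Set.Icc (-1 : ℝ) 1, P × ℝ × F) :=
  ((ContinuousLinearMap.inl ℝ P (ℝ × F)).compLeftContinuous ℝ _ ∘L ContinuousLinearMap.const ℝ _) ∘L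
      (ContinuousLinearMap.fst ℝ P ℝ ∘L ContinuousLinearMap.fst ℝ (P × ℝ) _) +
    (ContinuousLinearMap.toSpanSingleton ℝ (⟨fun s => (0, s, 0), by fun_prop⟩ :
      C(Set.Icc (-1 : ℝ) 1, P × ℝ × F))) ∘L
      (ContinuousLinearMap.snd ℝ P ℝ ∘L ContinuousLinearMap.fst ℝ (P × ℝ) _) +
    ((ContinuousLinearMap.inr ℝ P (ℝ × F) ∘L ContinuousLinearMap.inr ℝ ℝ F).compLeftContinuous ℝ _)
      ∘L ContinuousLinearMap.snd ℝ (P × ℝ) _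

theorem curveCLM_apply (q : P × ℝ) (γ : C(Set.Icc (-1 : ℝ) 1, F)) (s : Set.Icc (-1 : ℝ) 1) :
    curveCLM (q, γ) s = (q.1, q.2 * s, γ s) := by
  simp [curveCLM]

/-- The map whose zeros in the second component are the solutions of an initial value problem. -/
noncomputable def odeMap (f : C(P × ℝ × F, F)) (g : P → F)
    (z : (P × ℝ) × C(Set.Icc (-1 : ℝ) 1, F)) : (P × ℝ) × C(Set.Icc (-1 : ℝ) 1, F) :=
  (z.1, z.2 - ContinuousMap.const _ (g z.1.1) - z.1.2 • primitiveCLM (f.comp (curveCLM z)))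

theorem contDiff_odeMap {f : C(P × ℝ × F, F)} {g : P → F} (hf : ContDiff ℝ ∞ f)
    (hg : ContDiff ℝ ∞ g) : ContDiff ℝ ∞ (odeMap f g) := by
  refine contDiff_fst.prodMk ((contDiff_snd.sub ?_).sub (contDiff_snd.comp contDiff_fst |>.smul ?_))
  · exact (ContinuousLinearMap.const ℝ (M := F) (Set.Icc (-1 : ℝ) 1)).contDiff.comp
      (hg.comp (contDiff_fst.comp contDiff_fst))
  · exact primitiveCLM.contDiff.comp
      ((contDiff_infty.2 fun n => contDiff_comp_continuousMap n f hf).comp curveCLM.contDiff)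

/-- At t = 0 the integral term contributes to the derivative only through its factor t. The
derivative is therefore triangular with identities on the diagonal, hence invertible, with no
smallness condition on `f`. -/
theorem hasFDerivAt_odeMap {f : C(P × ℝ × F, F)} {g : P → F} (hf : ContDiff ℝ ∞ f)
    (hg : ContDiff ℝ ∞ g) (p : P) (γ : C(Set.Icc (-1 : ℝ) 1, F)) :
    ∃ e : ((P × ℝ) × C(Set.Icc (-1 : ℝ) 1, F)) ≃L[ℝ] ((P × ℝ) × C(Set.Icc (-1 : ℝ) 1, F)),
      HasFDerivAt (odeMap f g) (e : _ →L[ℝ] _) ((p, 0), γ) := by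
  have h1 : ContDiff ℝ ∞ (fun z : (P × ℝ) × C(Set.Icc (-1 : ℝ) 1, F) =>
      primitiveCLM (f.comp (curveCLM z))) := primitiveCLM.contDiff.comp
      ((contDiff_infty.2 fun n => contDiff_comp_continuousMap n f hf).comp curveCLM.contDiff)
  have h2 : HasFDerivAt (fun q : P × ℝ => (ContinuousMap.const (Set.Icc (-1 : ℝ) 1) (g q.1)))
      ((ContinuousLinearMap.const ℝ (M := F) (Set.Icc (-1 : ℝ) 1)) ∘L (fderiv ℝ g p) ∘L
        ContinuousLinearMap.fst ℝ P ℝ) (p, 0) :=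
    (ContinuousLinearMap.const ℝ (M := F) (Set.Icc (-1 : ℝ) 1)).hasFDerivAt.comp (p, 0)
      (((hg.differentiable (by simp) p).hasFDerivAt).comp (p, 0) hasFDerivAt_fst)
  let L : (P × ℝ) →L[ℝ] C(Set.Icc (-1 : ℝ) 1, F) :=
    -((ContinuousLinearMap.const ℝ (M := F) (Set.Icc (-1 : ℝ) 1)) ∘L (fderiv ℝ g p) ∘L
        ContinuousLinearMap.fst ℝ P ℝ) -
      (ContinuousLinearMap.snd ℝ P ℝ).smulRight (primitiveCLM (f.comp (curveCLM ((p, 0), γ))))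
  refine ⟨ContinuousLinearEquiv.skewProd (ContinuousLinearEquiv.refl ℝ _)
    (ContinuousLinearEquiv.refl ℝ _) L, ?_⟩
  have h3 := (hasFDerivAt_snd (𝕜 := ℝ) (E := P × ℝ) (F := C(Set.Icc (-1 : ℝ) 1, F))
    (p := ((p, 0), γ))).sub (h2.comp ((p, 0), γ) hasFDerivAt_fst)
  have h4 := ((ContinuousLinearMap.snd ℝ P ℝ ∘L ContinuousLinearMap.fst ℝ (P × ℝ)
    C(Set.Icc (-1 : ℝ) 1, F)).hasFDerivAt (x := ((p, 0), γ))).smul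
      ((h1.differentiable (by simp) ((p, 0), γ)).hasFDerivAt)
  refine ((hasFDerivAt_fst (p := ((p, 0), γ))).prodMk (h3.sub h4)).congr_fderiv ?_
  refine ContinuousLinearMap.ext fun z => Prod.ext rfl ?_
  simp [L, sub_eq_add_neg, add_assoc]

/-- Smooth dependence on parameters of solutions of ordinary differential equations, for globally
defined `C^∞` data. -/
theorem exists_ode_solution_of_contDiff [CompleteSpace P] [CompleteSpace F]
    {f : P × ℝ × F → F} {g : P → F} (hf : ContDiff ℝ ∞ f) (hg : ContDiff ℝ ∞ g) (p₀ : P) :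
    ∃ v : P × ℝ → F, (∀ᶠ q in 𝓝 (p₀, (0 : ℝ)), ContDiffAt ℝ ∞ v q) ∧
      (∀ᶠ q in 𝓝 (p₀, (0 : ℝ)), HasDerivAt (fun t => v (q.1, t)) (f (q.1, q.2, v q)) q.2) ∧
      ∀ᶠ p in 𝓝 p₀, v (p, 0) = g p := by
  let fc : C(P × ℝ × F, F) := ⟨f, hf.continuous⟩
  let K := Set.Icc (-1 : ℝ) 1
  -- In rescaled time s ∈ [-1, 1] the equation reads γ(s) = g(p) + t ∫₀ˢ f(p, tσ, γ(σ)) dσ. For t =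
  -- 0 its solution is the constant curve.
  let γ₀ : C(K, F) := ContinuousMap.const _ (g p₀)
  have hH := contDiff_odeMap (f := fc) hf hg
  obtain ⟨e, he⟩ := hasFDerivAt_odeMap (f := fc) hf hg p₀ γ₀
  obtain ⟨φ, haφ, hφ, -, hsymm, -⟩ := exists_openPartialHomeomorph_of_hasFDerivAt
    (Filter.Eventually.of_forall fun y => hH.contDiffAt) he
  have ha0 : odeMap fc g ((p₀, 0), γ₀) = ((p₀, 0), 0) := by
    simp [odeMap, γ₀, K]
  have hat : ((p₀, (0 : ℝ)), (0 : C(K, F))) ∈ φ.target := by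
    rw [← ha0, ← hφ]; exact φ.map_source haφ
  have hsa : φ.symm ((p₀, (0 : ℝ)), (0 : C(K, F))) = ((p₀, 0), γ₀) := by
    rw [← ha0, ← hφ]; exact φ.left_inv haφ
  -- `ψ (p, t)` is the rescaled solution s ↦ v(p, ts); the solution sought is its value at s = 1.
  let ψ : P × ℝ → C(K, F) := fun q => (φ.symm (q, 0)).2
  let one : K := ⟨1, by norm_num, le_rfl⟩
  have hι : Continuous (fun q : P × ℝ => (q, (0 : C(K, F)))) := by fun_prop
  have htar : ∀ᶠ q in 𝓝 (p₀, (0 : ℝ)), (q, (0 : C(K, F))) ∈ φ.target :=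
    hι.continuousAt.eventually (φ.open_target.mem_nhds hat)
  have hψ : ∀ q, (q, (0 : C(K, F))) ∈ φ.target →
      (q, ψ q) ∈ φ.source ∧ ψ q - ContinuousMap.const _ (g q.1) -
        q.2 • primitiveCLM (fc.comp (curveCLM (q, ψ q))) = 0 := by
    intro q hq
    have h1 := φ.right_inv hq
    rw [hφ] at h1
    have h2 : (φ.symm (q, 0)).1 = q := congrArg Prod.fst h1
    have h3 : φ.symm (q, 0) = (q, ψ q) := Prod.ext h2 rfl
    rw [h3] at h1
    exact ⟨h3 ▸ φ.map_target hq, congrArg Prod.snd h1⟩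
  obtain ⟨r, hr, hball⟩ := Metric.isOpen_iff.1 φ.open_source _ haφ
  have hsc : ∀ᶠ q in 𝓝 (p₀, (0 : ℝ)), ψ q ∈ Metric.ball γ₀ r := by
    have hc : ContinuousAt (fun q : P × ℝ => φ.symm (q, (0 : C(K, F)))) (p₀, 0) :=
      ContinuousAt.comp (φ.continuousAt_symm hat) hι.continuousAt
    have hc2 : ContinuousAt ψ (p₀, 0) := continuous_snd.continuousAt.comp hc
    refine hc2.eventually (Metric.isOpen_ball.mem_nhds ?_)
    simp only [ψ, hsa]
    exact Metric.mem_ball_self hr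
  obtain ⟨δ, hδ, hδb⟩ := Metric.eventually_nhds_iff_ball.1 ((htar.and hsc).and
    (Metric.ball_mem_nhds (p₀, (0 : ℝ)) hr))
  have hmem : ∀ p ∈ Metric.ball p₀ δ, ∀ t ∈ Metric.ball (0 : ℝ) δ,
      (p, t) ∈ Metric.ball (p₀, (0 : ℝ)) δ := by
    intro p hp t ht
    rw [← ball_prod_same]; exact ⟨hp, ht⟩
  have hint : ∀ p ∈ Metric.ball p₀ δ, ∀ t ∈ Metric.ball (0 : ℝ) δ, ∀ s : K,
      ψ (p, t) s = g p + t • ∫ σ in (0 : ℝ)..s, (fc.comp (curveCLM ((p, t), ψ (p, t)))).IccExtend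
        (by norm_num) σ := by
    intro p hp t ht s
    have := (hψ _ (hδb _ (hmem p hp t ht)).1.1).2
    have h2 := congrArg (fun c : C(K, F) => c s) this
    simp only [ContinuousMap.sub_apply, ContinuousMap.const_apply, ContinuousMap.smul_apply,
      ContinuousMap.zero_apply] at h2
    rw [sub_sub, sub_eq_zero] at h2
    exact h2
  -- The curve s ↦ ψ(p, t)(κs) solves the integral equation with t replaced by tκ, and it stays as
  -- close to γ₀ as ψ(p, t) does. Injectivity of `φ` on its source identifies it with ψ(p, tκ). Thus
  -- the curves for different t are pieces of one solution.
  have hscale : ∀ p ∈ Metric.ball p₀ δ, ∀ t ∈ Metric.ball (0 : ℝ) δ, ∀ κ : K,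
      ψ (p, t * κ) one = ψ (p, t) κ := by
    intro p hp t ht κ
    have hκ : |(κ : ℝ)| ≤ 1 := abs_le.2 κ.2
    have ht' : t * κ ∈ Metric.ball (0 : ℝ) δ := by
      rw [mem_ball_zero_iff, Real.norm_eq_abs, abs_mul] at *
      exact (mul_le_of_le_one_right (abs_nonneg _) hκ).trans_lt ht
    let m : C(K, K) := ⟨fun s => ⟨κ * s, abs_le.1 (by
      rw [abs_mul]; exact mul_le_one₀ hκ (abs_nonneg _) (abs_le.2 s.2))⟩, by fun_prop⟩
    have hb := hδb _ (hmem p hp t ht)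
    have hb' := hδb _ (hmem p hp (t * κ) ht')
    have hsrc : ((p, t * κ), (ψ (p, t)).comp m) ∈ φ.source := by
      apply hball
      rw [← ball_prod_same]
      refine ⟨hb'.2, ?_⟩
      have h1 : dist (ψ (p, t)) γ₀ < r := hb.1.2
      refine lt_of_le_of_lt ((ContinuousMap.dist_le dist_nonneg).2 fun s => ?_) h1
      exact ContinuousMap.dist_apply_le_dist (f := ψ (p, t)) (g := γ₀) (m s)
    have heq : ((p, t * κ), (ψ (p, t)).comp m) = ((p, t * κ), ψ (p, t * κ)) := by
      refine φ.injOn hsrc (hψ _ hb'.1.1).1 ?_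
      rw [hφ, hφ]
      refine Prod.ext rfl ?_
      refine Eq.trans ?_ (hψ _ hb'.1.1).2.symm
      ext s
      simp only [odeMap, ContinuousMap.sub_apply, ContinuousMap.const_apply,
        ContinuousMap.smul_apply, primitiveCLM_apply, ContinuousMap.zero_apply,
        ContinuousMap.comp_apply]
      rw [hint p hp t ht (m s), sub_sub, sub_eq_zero]
      congr 1
      rw [mul_smul]
      congr 1
      -- The substitution σ ↦ κσ absorbs the factor κ and carries the interval from 0 to s into that
      -- from 0 to κs.
      have h5 := intervalIntegral.smul_integral_comp_mul_left (a := 0) (b := s)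
        ((fc.comp (curveCLM ((p, t), ψ (p, t)))).IccExtend (by norm_num : (-1 : ℝ) ≤ 1)) (κ : ℝ)
      rw [mul_zero] at h5
      refine h5.symm.trans ?_
      congr 1
      refine intervalIntegral.integral_congr fun σ hσ => ?_
      have hσ' : σ ∈ K := by
        have : Set.uIcc (0 : ℝ) s ⊆ K := Set.uIcc_subset_Icc zero_mem_Icc_neg_one_one s.2
        exact this hσ
      have e1 : Set.projIcc (-1 : ℝ) 1 (by norm_num) σ = ⟨σ, hσ'⟩ := Set.projIcc_of_mem _ hσ'
      have e2 : Set.projIcc (-1 : ℝ) 1 (by norm_num) (κ * σ) = m ⟨σ, hσ'⟩ :=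
        Set.projIcc_of_mem _ (m ⟨σ, hσ'⟩).2
      simp only [ContinuousMap.coe_IccExtend, Set.IccExtend, Function.comp_apply, e1, e2,
        ContinuousMap.comp_apply, curveCLM_apply]
      have e3 : ((m ⟨σ, hσ'⟩ : K) : ℝ) = κ * σ := rfl
      rw [e3]
      have e4 : curveCLM ((p, t * (κ : ℝ)), (ψ (p, t)).comp m) ⟨σ, hσ'⟩ =
          (p, t * (κ : ℝ) * σ, ψ (p, t) (m ⟨σ, hσ'⟩)) := curveCLM_apply _ _ _
      rw [← mul_assoc]
      exact congrArg f e4.symm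
    have h6 := congrArg (fun z : (P × ℝ) × C(K, F) => z.2 one) heq
    refine h6.symm.trans ?_
    change ψ (p, t) (m one) = _
    congr 1
    exact Subtype.ext (mul_one _)
  refine ⟨fun q => ψ q one, ?_, ?_, ?_⟩
  · filter_upwards [htar] with q hq
    have h1 : ContDiffAt ℝ ∞ (fun q : P × ℝ => φ.symm (q, (0 : C(K, F)))) q :=
      (hsymm.contDiffAt (φ.open_target.mem_nhds hq)).comp q
        (contDiff_id.prodMk contDiff_const).contDiffAt
    exact (ContinuousMap.evalCLM ℝ one).contDiff.contDiffAt.comp q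
      (contDiff_snd.contDiffAt.comp q h1)
  · have hδ2 : 0 < δ / 2 := by positivity
    filter_upwards [Metric.ball_mem_nhds (p₀, (0 : ℝ)) hδ2] with q hq
    rw [← ball_prod_same] at hq
    have hp : q.1 ∈ Metric.ball p₀ δ := Metric.ball_subset_ball (by linarith) hq.1
    have ht : δ / 2 ∈ Metric.ball (0 : ℝ) δ := by
      rw [mem_ball_zero_iff, Real.norm_eq_abs, abs_of_pos hδ2]; linarith
    have hloc : ∀ t ∈ Metric.ball (0 : ℝ) (δ / 2), ∃ h : t / (δ / 2) ∈ Set.Ioo (-1 : ℝ) 1,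
        ψ (q.1, t) one = ψ (q.1, δ / 2) ⟨t / (δ / 2), Set.Ioo_subset_Icc_self h⟩ := by
      intro t ht'
      rw [mem_ball_zero_iff, Real.norm_eq_abs] at ht'
      have hin : t / (δ / 2) ∈ Set.Ioo (-1 : ℝ) 1 := by
        rw [Set.mem_Ioo, ← abs_lt, abs_div, abs_of_pos hδ2, div_lt_one hδ2]; exact ht'
      refine ⟨hin, ?_⟩
      have := hscale q.1 hp (δ / 2) ht ⟨_, Set.Ioo_subset_Icc_self hin⟩
      rw [← this]
      congr 2
      rw [Prod.mk.injEq]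
      exact ⟨rfl, by field_simp⟩
    set G : C(ℝ, F) := (fc.comp (curveCLM ((q.1, δ / 2), ψ (q.1, δ / 2)))).IccExtend
      (by norm_num : (-1 : ℝ) ≤ 1) with hG
    have hGc : Continuous G := G.continuous
    have hd : HasDerivAt (fun t : ℝ => g q.1 + (δ / 2) • ∫ σ in (0 : ℝ)..(t / (δ / 2)), G σ)
        (G (q.2 / (δ / 2))) q.2 := by
      have h1 : HasDerivAt (fun u : ℝ => ∫ σ in (0 : ℝ)..u, G σ) (G (q.2 / (δ / 2)))
          (q.2 / (δ / 2)) := intervalIntegral.integral_hasDerivAt_right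
            (hGc.intervalIntegrable _ _) (hGc.stronglyMeasurableAtFilter _ _) hGc.continuousAt
      have h2 : HasDerivAt (fun t : ℝ => t / (δ / 2)) (1 / (δ / 2)) q.2 :=
        (hasDerivAt_id q.2).div_const _
      have h3 := ((h1.scomp q.2 h2).const_smul (δ / 2)).const_add (g q.1)
      refine h3.congr_deriv ?_
      rw [smul_smul, mul_one_div_cancel hδ2.ne', one_smul]
    obtain ⟨hin, hval⟩ := hloc q.2 hq.2
    have hfin : G (q.2 / (δ / 2)) = f (q.1, q.2, ψ q one) := by
      have e1 : Set.projIcc (-1 : ℝ) 1 (by norm_num) (q.2 / (δ / 2)) =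
        ⟨_, Set.Ioo_subset_Icc_self hin⟩ := Set.projIcc_of_mem _ _
      have hval' : ψ q one = _ := hval
      rw [hG, ContinuousMap.coe_IccExtend, Set.IccExtend, Function.comp_apply, e1,
        ContinuousMap.comp_apply, curveCLM_apply, hval']
      change f _ = f _
      congr 3
      simp only
      field_simp
    rw [← hfin]
    refine hd.congr_of_eventuallyEq ?_
    filter_upwards [Metric.isOpen_ball.mem_nhds hq.2] with t ht'
    obtain ⟨h1, h2⟩ := hloc t ht'
    rw [h2, hint q.1 hp (δ / 2) ht]
  · filter_upwards [Metric.ball_mem_nhds p₀ hδ] with p hp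
    rw [hint p hp 0 (Metric.mem_ball_self hδ), zero_smul, add_zero]

/-- A map that is `C^∞` near a point agrees near that point with a globally defined `C^∞` map. -/
theorem exists_contDiff_eventuallyEq {E G : Type*} [NormedAddCommGroup E] [NormedSpace ℝ E]
    [FiniteDimensional ℝ E] [NormedAddCommGroup G] [NormedSpace ℝ G] {f : E → G} {a : E}
    (hf : ∀ᶠ y in 𝓝 a, ContDiffAt ℝ ∞ f y) : ∃ f' : E → G, ContDiff ℝ ∞ f' ∧ f' =ᶠ[𝓝 a] f := by
  obtain ⟨r, hr, hball⟩ := Metric.eventually_nhds_iff_ball.1 hf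
  -- The outer radius r/2 keeps the support inside the ball of radius r on which `f` is smooth.
  let χ : ContDiffBump a := ⟨r / 4, r / 2, by positivity, by linarith⟩
  refine ⟨fun y => χ y • f y, contDiff_iff_contDiffAt.2 fun y => ?_, ?_⟩
  · by_cases hy : y ∈ Metric.ball a r
    · exact χ.contDiffAt.smul (hball y hy)
    · have hy' : y ∈ (tsupport χ)ᶜ := by
        rw [χ.tsupport_eq]
        intro h
        have h1 : dist y a ≤ r / 2 := h
        exact hy (Metric.mem_ball.2 (by linarith))
      have : (fun y => χ y • f y) =ᶠ[𝓝 y] fun _ => 0 := by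
        filter_upwards [(isClosed_tsupport χ).isOpen_compl.mem_nhds hy'] with z hz
        rw [image_eq_zero_of_notMem_tsupport hz, zero_smul]
      exact contDiffAt_const.congr_of_eventuallyEq this
  · filter_upwards [χ.eventuallyEq_one] with y hy
    simp [hy]

/-- Smooth dependence on parameters of solutions of ordinary differential equations. -/
theorem exists_ode_solution [FiniteDimensional ℝ P] [FiniteDimensional ℝ F]
    {f : P × ℝ × F → F} {g : P → F} {p₀ : P}
    (hf : ∀ᶠ z in 𝓝 (p₀, (0 : ℝ), g p₀), ContDiffAt ℝ ∞ f z)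
    (hg : ∀ᶠ p in 𝓝 p₀, ContDiffAt ℝ ∞ g p) : ∃ v : P × ℝ → F,
      (∀ᶠ q in 𝓝 (p₀, (0 : ℝ)), ContDiffAt ℝ ∞ v q) ∧
      (∀ᶠ q in 𝓝 (p₀, (0 : ℝ)), HasDerivAt (fun t => v (q.1, t)) (f (q.1, q.2, v q)) q.2) ∧
      ∀ᶠ p in 𝓝 p₀, v (p, 0) = g p := by
  have := FiniteDimensional.complete ℝ P
  have := FiniteDimensional.complete ℝ F
  obtain ⟨f', hf', hff⟩ := exists_contDiff_eventuallyEq hf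
  obtain ⟨g', hg', hgg⟩ := exists_contDiff_eventuallyEq hg
  obtain ⟨v, hv, hd, hi⟩ := exists_ode_solution_of_contDiff hf' hg' p₀
  have hv0 : v (p₀, 0) = g p₀ := hi.self_of_nhds.trans hgg.self_of_nhds
  refine ⟨v, hv, ?_, by filter_upwards [hi, hgg] with p h1 h2 using h1.trans h2⟩
  -- For q near (p₀, 0) the point (q, v(q)) stays in the region where the globalized right-hand side
  -- agrees with `f`.
  have hc : ContinuousAt (fun q : P × ℝ => (q.1, q.2, v q)) (p₀, 0) :=
    continuousAt_fst.prodMk (continuousAt_snd.prodMk hv.self_of_nhds.continuousAt)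
  have hff' : ∀ᶠ z in 𝓝 (p₀, (0 : ℝ), v (p₀, 0)), f' z = f z := by rw [hv0]; exact hff
  filter_upwards [hd, hc.eventually hff'] with q hq h
  rw [← h]
  exact hq

end ODE

/-! ### Directional derivatives and smooth vector fields on manifolds -/

section Calculus

variable {E : Type*} [NormedAddCommGroup E] [NormedSpace ℝ E]
  {M : Type*} [TopologicalSpace M] [ChartedSpace E M]
  {G : Type*} [NormedAddCommGroup G] [NormedSpace ℝ G]

theorem SmoothFunOn.mdifferentiableAt {U : Set M} {f : M → ℝ} (hf : SmoothFunOn E U f)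
    (hU : IsOpen U) {x : M} (hx : x ∈ U) : MDifferentiableAt 𝓘(ℝ, E) 𝓘(ℝ, ℝ) f x :=
  (ContMDiffOn.contMDiffAt hf (hU.mem_nhds hx)).mdifferentiableAt (by simp)

theorem SmoothFunOn.mono {U U' : Set M} {f : M → ℝ} (hf : SmoothFunOn E U f) (h : U' ⊆ U) :
    SmoothFunOn E U' f := ContMDiffOn.mono hf h

theorem SmoothFunOn.comp_contDiffAt {U : Set M} {φ : M → G} {F : G → ℝ}
    (hF : ∀ x ∈ U, ContDiffAt ℝ ∞ F (φ x)) (hφ : ContMDiffOn 𝓘(ℝ, E) 𝓘(ℝ, G) ∞ φ U) :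
    SmoothFunOn E U (fun x => F (φ x)) :=
  fun x hx => (hF x hx).contMDiffAt.comp_contMDiffWithinAt x (hφ x hx)

theorem SmoothFunOn.const {U : Set M} (c : ℝ) : SmoothFunOn E U (fun _ => c) := contMDiffOn_const

theorem SmoothFunOn.add {U : Set M} {f g : M → ℝ} (hf : SmoothFunOn E U f)
    (hg : SmoothFunOn E U g) : SmoothFunOn E U (fun x => f x + g x) := ContMDiffOn.add hf hg

theorem SmoothFunOn.sub {U : Set M} {f g : M → ℝ} (hf : SmoothFunOn E U f)
    (hg : SmoothFunOn E U g) : SmoothFunOn E U (fun x => f x - g x) := ContMDiffOn.sub hf hg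

theorem SmoothFunOn.neg {U : Set M} {f : M → ℝ} (hf : SmoothFunOn E U f) :
    SmoothFunOn E U (fun x => -f x) := ContMDiffOn.neg hf

theorem SmoothFunOn.mul {U : Set M} {f g : M → ℝ} (hf : SmoothFunOn E U f)
    (hg : SmoothFunOn E U g) : SmoothFunOn E U (fun x => f x * g x) := ContMDiffOn.mul hf hg

theorem SmoothFunOn.inv {U : Set M} {f : M → ℝ} (hf : SmoothFunOn E U f)
    (h0 : ∀ x ∈ U, f x ≠ 0) : SmoothFunOn E U (fun x => (f x)⁻¹) :=
  SmoothFunOn.comp_contDiffAt (F := fun t : ℝ => t⁻¹) (fun x hx => contDiffAt_inv ℝ (h0 x hx)) hf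

theorem SmoothFunOn.continuousOn {U : Set M} {f : M → ℝ} (hf : SmoothFunOn E U f) :
    ContinuousOn f U := ContMDiffOn.continuousOn hf

theorem dirDeriv_add_right (f : M → ℝ) (x : M) (u v : TangentSpace 𝓘(ℝ, E) x) :
    dirDeriv f x (u + v) = dirDeriv f x u + dirDeriv f x v :=
  map_add (mfderiv 𝓘(ℝ, E) 𝓘(ℝ, ℝ) f x) u v

theorem dirDeriv_smul_right (f : M → ℝ) (x : M) (c : ℝ) (u : TangentSpace 𝓘(ℝ, E) x) :
    dirDeriv f x (c • u) = c * dirDeriv f x u :=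
  map_smul (mfderiv 𝓘(ℝ, E) 𝓘(ℝ, ℝ) f x) c u

theorem dirDeriv_congr {f g : M → ℝ} {x : M} (h : f =ᶠ[𝓝 x] g) (u : TangentSpace 𝓘(ℝ, E) x) :
    dirDeriv f x u = dirDeriv g x u := by
  unfold dirDeriv
  rw [h.mfderiv_eq]
  rfl

theorem dirDeriv_congr_of_isOpen {f g : M → ℝ} {U : Set M} (hU : IsOpen U) {x : M} (hx : x ∈ U)
    (h : ∀ y ∈ U, f y = g y) (u : TangentSpace 𝓘(ℝ, E) x) : dirDeriv f x u = dirDeriv g x u :=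
  dirDeriv_congr (Filter.eventually_of_mem (hU.mem_nhds hx) h) u

theorem dirDeriv_const (c : ℝ) (x : M) (u : TangentSpace 𝓘(ℝ, E) x) :
    dirDeriv (fun _ : M => c) x u = 0 := by
  unfold dirDeriv
  rw [mfderiv_const]
  rfl

theorem dirDeriv_comp {F : G → ℝ} {φ : M → G} {x : M} (hF : DifferentiableAt ℝ F (φ x))
    (hφ : MDifferentiableAt 𝓘(ℝ, E) 𝓘(ℝ, G) φ x) (u : TangentSpace 𝓘(ℝ, E) x) :
    dirDeriv (fun y => F (φ y)) x u =
      fderiv ℝ F (φ x) (mfderiv 𝓘(ℝ, E) 𝓘(ℝ, G) φ x u) := by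
  have h := mfderiv_comp_apply (I := 𝓘(ℝ, E)) (I' := 𝓘(ℝ, G)) (I'' := 𝓘(ℝ, ℝ)) x
    hF.mdifferentiableAt hφ u
  rw [mfderiv_eq_fderiv] at h
  exact h

theorem dirDeriv_clm_comp (L : G →L[ℝ] ℝ) {φ : M → G} {x : M}
    (hφ : MDifferentiableAt 𝓘(ℝ, E) 𝓘(ℝ, G) φ x) (u : TangentSpace 𝓘(ℝ, E) x) :
    dirDeriv (fun y => L (φ y)) x u = L (mfderiv 𝓘(ℝ, E) 𝓘(ℝ, G) φ x u) := by
  rw [dirDeriv_comp L.differentiableAt hφ, L.fderiv]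

theorem dirDeriv_comp_real {F : ℝ → ℝ} {F' : ℝ} {f : M → ℝ} {x : M} (hF : HasDerivAt F F' (f x))
    (hf : MDifferentiableAt 𝓘(ℝ, E) 𝓘(ℝ, ℝ) f x) (u : TangentSpace 𝓘(ℝ, E) x) :
    dirDeriv (fun y => F (f y)) x u = F' * dirDeriv f x u := by
  rw [dirDeriv_comp hF.differentiableAt hf, hF.hasFDerivAt.fderiv]
  exact mul_comm _ _

theorem dirDeriv_comp_two {F : ℝ × ℝ → ℝ} {f g : M → ℝ} {x : M}
    (hF : DifferentiableAt ℝ F (f x, g x))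
    (hf : MDifferentiableAt 𝓘(ℝ, E) 𝓘(ℝ, ℝ) f x) (hg : MDifferentiableAt 𝓘(ℝ, E) 𝓘(ℝ, ℝ) g x)
    (u : TangentSpace 𝓘(ℝ, E) x) :
    dirDeriv (fun y => F (f y, g y)) x u =
      fderiv ℝ F (f x, g x) (dirDeriv f x u, dirDeriv g x u) := by
  have h : MDifferentiableAt 𝓘(ℝ, E) 𝓘(ℝ, ℝ × ℝ) (fun y => (f y, g y)) x := hf.prodMk_space hg
  rw [dirDeriv_comp (φ := fun y => (f y, g y)) hF h]
  have h1 := dirDeriv_clm_comp (ContinuousLinearMap.fst ℝ ℝ ℝ) h u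
  have h2 := dirDeriv_clm_comp (ContinuousLinearMap.snd ℝ ℝ ℝ) h u
  exact congrArg _ (Prod.ext h1.symm h2.symm)

theorem dirDeriv_add {f g : M → ℝ} {x : M} (hf : MDifferentiableAt 𝓘(ℝ, E) 𝓘(ℝ, ℝ) f x)
    (hg : MDifferentiableAt 𝓘(ℝ, E) 𝓘(ℝ, ℝ) g x) (u : TangentSpace 𝓘(ℝ, E) x) :
    dirDeriv (fun y => f y + g y) x u = dirDeriv f x u + dirDeriv g x u := by
  have h : HasFDerivAt (fun q : ℝ × ℝ => q.1 + q.2) _ (f x, g x) :=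
    (hasFDerivAt_fst (𝕜 := ℝ) (E := ℝ) (F := ℝ) (p := (f x, g x))).add
      (hasFDerivAt_snd (𝕜 := ℝ) (E := ℝ) (F := ℝ) (p := (f x, g x)))
  rw [dirDeriv_comp_two h.differentiableAt hf hg, h.fderiv]
  rfl

theorem dirDeriv_sub {f g : M → ℝ} {x : M} (hf : MDifferentiableAt 𝓘(ℝ, E) 𝓘(ℝ, ℝ) f x)
    (hg : MDifferentiableAt 𝓘(ℝ, E) 𝓘(ℝ, ℝ) g x) (u : TangentSpace 𝓘(ℝ, E) x) :
    dirDeriv (fun y => f y - g y) x u = dirDeriv f x u - dirDeriv g x u := by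
  have h : HasFDerivAt (fun q : ℝ × ℝ => q.1 - q.2) _ (f x, g x) :=
    (hasFDerivAt_fst (𝕜 := ℝ) (E := ℝ) (F := ℝ) (p := (f x, g x))).sub
      (hasFDerivAt_snd (𝕜 := ℝ) (E := ℝ) (F := ℝ) (p := (f x, g x)))
  rw [dirDeriv_comp_two h.differentiableAt hf hg, h.fderiv]
  rfl

theorem dirDeriv_mul {f g : M → ℝ} {x : M} (hf : MDifferentiableAt 𝓘(ℝ, E) 𝓘(ℝ, ℝ) f x)
    (hg : MDifferentiableAt 𝓘(ℝ, E) 𝓘(ℝ, ℝ) g x) (u : TangentSpace 𝓘(ℝ, E) x) :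
    dirDeriv (fun y => f y * g y) x u = f x * dirDeriv g x u + g x * dirDeriv f x u := by
  have h : HasFDerivAt (fun q : ℝ × ℝ => q.1 * q.2) _ (f x, g x) :=
    (hasFDerivAt_fst (𝕜 := ℝ) (E := ℝ) (F := ℝ) (p := (f x, g x))).mul
      (hasFDerivAt_snd (𝕜 := ℝ) (E := ℝ) (F := ℝ) (p := (f x, g x)))
  rw [dirDeriv_comp_two h.differentiableAt hf hg, h.fderiv]
  rfl

theorem dirDeriv_neg {f : M → ℝ} {x : M} (hf : MDifferentiableAt 𝓘(ℝ, E) 𝓘(ℝ, ℝ) f x)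
    (u : TangentSpace 𝓘(ℝ, E) x) : dirDeriv (fun y => -f y) x u = -dirDeriv f x u := by
  rw [dirDeriv_comp_real (hasDerivAt_neg (f x)) hf, neg_one_mul]

theorem dirDeriv_inv {f : M → ℝ} {x : M} (hf : MDifferentiableAt 𝓘(ℝ, E) 𝓘(ℝ, ℝ) f x)
    (h0 : f x ≠ 0) (u : TangentSpace 𝓘(ℝ, E) x) :
    dirDeriv (fun y => (f y)⁻¹) x u = -((f x ^ 2)⁻¹) * dirDeriv f x u :=
  dirDeriv_comp_real (hasDerivAt_inv h0) hf u

theorem dirDeriv_const_mul {f : M → ℝ} {x : M} (c : ℝ)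
    (hf : MDifferentiableAt 𝓘(ℝ, E) 𝓘(ℝ, ℝ) f x)
    (u : TangentSpace 𝓘(ℝ, E) x) : dirDeriv (fun y => c * f y) x u = c * dirDeriv f x u :=
  dirDeriv_comp_real (by simpa using (hasDerivAt_id (f x)).const_mul c) hf u

variable [IsManifold 𝓘(ℝ, E) ∞ M]

theorem SmoothFieldOn.mono {U U' : Set M} {w : VecField E M} (hw : SmoothFieldOn U w)
    (h : U' ⊆ U) : SmoothFieldOn U' w := ContMDiffOn.mono hw h

theorem SmoothFieldOn.add {U : Set M} {w w' : VecField E M} (hw : SmoothFieldOn U w)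
    (hw' : SmoothFieldOn U w') : SmoothFieldOn U (fun x => w x + w' x) :=
  ContMDiffOn.add_section hw hw'

theorem SmoothFieldOn.smul {U : Set M} {f : M → ℝ} {w : VecField E M} (hf : SmoothFunOn E U f)
    (hw : SmoothFieldOn U w) : SmoothFieldOn U (fun x => f x • w x) :=
  ContMDiffOn.smul_section hf hw

theorem SmoothFieldOn.congr {U : Set M} {w w' : VecField E M} (hw : SmoothFieldOn U w)
    (h : ∀ x ∈ U, w' x = w x) : SmoothFieldOn U w' :=
  ContMDiffOn.congr hw fun x hx => by rw [h x hx]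

theorem contMDiffOn_mfderiv_apply {U : Set M} (hU : IsOpen U) {φ : M → G} {w : VecField E M}
    (hφ : ContMDiffOn 𝓘(ℝ, E) 𝓘(ℝ, G) ∞ φ U) (hw : SmoothFieldOn U w) :
    ContMDiffOn 𝓘(ℝ, E) 𝓘(ℝ, G) ∞
      (fun x => (mfderiv 𝓘(ℝ, E) 𝓘(ℝ, G) φ x (w x) : G)) U := by
  have h1 := hφ.contMDiffOn_tangentMapWithin (m := ∞) (by simp) hU.uniqueMDiffOn
  have h2 := h1.comp hw (fun x hx => hx)
  have h3 := (contMDiff_snd_tangentBundle_modelSpace G 𝓘(ℝ, G) (n := ∞)).comp_contMDiffOn h2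
  refine h3.congr fun x hx => ?_
  change _ = (mfderivWithin 𝓘(ℝ, E) 𝓘(ℝ, G) φ U x (w x) : G)
  rw [mfderivWithin_of_isOpen hU hx]

theorem SmoothFieldOn.dirDeriv {U : Set M} (hU : IsOpen U) {f : M → ℝ} {w : VecField E M}
    (hf : SmoothFunOn E U f) (hw : SmoothFieldOn U w) :
    SmoothFunOn E U (fun x => dirDeriv f x (w x)) :=
  contMDiffOn_mfderiv_apply hU hf hw

variable [CompleteSpace E]

/-- The commutator of vector fields acts on functions as the commutator of derivations. -/
theorem dirDeriv_mlieBracket {U : Set M} (hU : IsOpen U) {f : M → ℝ} {u v : VecField E M}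
    (hf : SmoothFunOn E U f) (hu : SmoothFieldOn U u) (hv : SmoothFieldOn U v) {x : M}
    (hx : x ∈ U) :
    dirDeriv f x (VectorField.mlieBracket 𝓘(ℝ, E) u v x) =
      dirDeriv (fun y => dirDeriv f y (v y)) x (u x) -
        dirDeriv (fun y => dirDeriv f y (u y)) x (v x) := by
  have h2 : IsManifold 𝓘(ℝ, E) 2 M := inferInstance
  have hfx := hf.mdifferentiableAt hU hx
  set c := extChartAt 𝓘(ℝ, E) x with hc
  have hux : MDifferentiableAt 𝓘(ℝ, E) 𝓘(ℝ, E).tangent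
      (fun y => (⟨y, u y⟩ : TangentBundle 𝓘(ℝ, E) M)) x :=
    (hu.contMDiffAt (hU.mem_nhds hx)).mdifferentiableAt (by simp)
  have hvx : MDifferentiableAt 𝓘(ℝ, E) 𝓘(ℝ, E).tangent
      (fun y => (⟨y, v y⟩ : TangentBundle 𝓘(ℝ, E) M)) x :=
    (hv.contMDiffAt (hU.mem_nhds hx)).mdifferentiableAt (by simp)
  -- Read in the chart, the bracket of u and v is Dv·u - Du·v. The two iterated derivatives of the
  -- function differ by its differential applied to this vector, since their second-order terms
  -- cancel by symmetry of the second derivative.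
  let pb : VecField E M → E → E := fun w =>
    VectorField.mpullbackWithin 𝓘(ℝ, E) 𝓘(ℝ, E) c.symm w (Set.range 𝓘(ℝ, E))
  let F : E → ℝ := fun e => f (c.symm e)
  have hdpb : ∀ w : VecField E M, MDifferentiableAt 𝓘(ℝ, E) 𝓘(ℝ, E).tangent
      (fun y => (⟨y, w y⟩ : TangentBundle 𝓘(ℝ, E) M)) x → DifferentiableAt ℝ (pb w) (c x) := by
    intro w hw
    have := (mdifferentiableWithinAt_univ.2 hw).differentiableWithinAt_mpullbackWithin_vectorField
    rw [Set.preimage_univ, Set.univ_inter, modelWithCornersSelf_coe, Set.range_id] at this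
    have h3 := differentiableWithinAt_univ.1 this
    simp only [pb, modelWithCornersSelf_coe, Set.range_id]
    exact h3
  have hpbx : ∀ w : VecField E M, pb w (c x) = w x := by
    intro w
    have hx' : c.symm (c x) = x := extChartAt_to_inv x
    have h3 : pb w (c x) = (mfderivWithin 𝓘(ℝ, E) 𝓘(ℝ, E) c.symm (Set.range 𝓘(ℝ, E))
      (c x)).inverse (w (c.symm (c x))) := rfl
    rw [h3, hc, mfderivWithin_range_extChartAt_symm]
    erw [ContinuousLinearMap.inverse_id]
    change w (c.symm (c x)) = w x
    exact congr_arg_heq w hx' |> eq_of_heq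
  have hU' : ∀ᶠ e in 𝓝 (c x), e ∈ c.target ∧ c.symm e ∈ U := by
    refine Filter.Eventually.and (extChartAt_target_mem_nhds x) ?_
    have h3 : ContinuousAt c.symm (c x) := continuousAt_extChartAt_symm x
    refine h3.eventually (hU.mem_nhds ?_)
    rw [hc, extChartAt_to_inv]
    exact hx
  have hF : ContDiffAt ℝ ∞ F (c x) := by
    have h3 := (contMDiffAt_iff.1 (hf.contMDiffAt (hU.mem_nhds hx))).2
    rw [modelWithCornersSelf_coe, Set.range_id, contDiffWithinAt_univ] at h3
    exact h3
  have hdir : ∀ g : M → ℝ, MDifferentiableAt 𝓘(ℝ, E) 𝓘(ℝ, ℝ) g x → ∀ z : E,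
      dirDeriv g x z = fderiv ℝ (fun e => g (c.symm e)) (c x) z := by
    intro g hg z
    have h3 := hg.mfderiv
    rw [modelWithCornersSelf_coe, Set.range_id, fderivWithin_univ] at h3
    unfold dirDeriv
    rw [h3]
    rfl
  have hkey : ∀ w : VecField E M, SmoothFieldOn U w → ∀ᶠ e in 𝓝 (c x),
      dirDeriv f (c.symm e) (w (c.symm e)) = fderiv ℝ F e (pb w e) := by
    intro w hw
    filter_upwards [hU'] with e he
    have h3 : HasMFDerivAt 𝓘(ℝ, E) 𝓘(ℝ, E) c.symm e
        (mfderivWithin 𝓘(ℝ, E) 𝓘(ℝ, E) c.symm (Set.range 𝓘(ℝ, E)) e) := by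
      have := (mdifferentiableWithinAt_extChartAt_symm he.1).hasMFDerivWithinAt
      simp only [modelWithCornersSelf_coe, Set.range_id, hasMFDerivWithinAt_univ] at this ⊢
      exact this
    have h5 := mfderiv_comp_apply (I := 𝓘(ℝ, E)) (I' := 𝓘(ℝ, E)) (I'' := 𝓘(ℝ, ℝ)) e
      (hf.mdifferentiableAt hU he.2) h3.mdifferentiableAt (pb w e)
    rw [mfderiv_eq_fderiv, h3.mfderiv] at h5
    have h6 := isInvertible_mfderivWithin_extChartAt_symm he.1
    refine Eq.trans ?_ h5.symm
    have h7 : (mfderivWithin 𝓘(ℝ, E) 𝓘(ℝ, E) c.symm (Set.range 𝓘(ℝ, E)) e) (pb w e) =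
      w (c.symm e) := by
      obtain ⟨L, hL⟩ := h6
      have h8 : pb w e = L.symm (w (c.symm e)) := by
        change (mfderivWithin 𝓘(ℝ, E) 𝓘(ℝ, E) c.symm (Set.range 𝓘(ℝ, E)) e).inverse _ = _
        rw [← hL, ContinuousLinearMap.inverse_equiv]
        rfl
      rw [h8, ← hL]
      exact L.apply_symm_apply _
    exact (congrArg (dirDeriv f (c.symm e)) h7).symm
  have hd2 : DifferentiableAt ℝ (fderiv ℝ F) (c x) :=
    (hF.fderiv_right (m := 1) (by norm_cast)).differentiableAt (by simp)
  have hterm : ∀ w z : VecField E M, SmoothFieldOn U w → DifferentiableAt ℝ (pb w) (c x) →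
      dirDeriv (fun y => dirDeriv f y (w y)) x (z x) =
        fderiv ℝ (fderiv ℝ F) (c x) (z x) (w x) +
          fderiv ℝ F (c x) (fderiv ℝ (pb w) (c x) (z x)) := by
    intro w z hw hpw
    refine (hdir _ ((SmoothFieldOn.dirDeriv hU hf hw).mdifferentiableAt hU hx) _).trans ?_
    have h3 := (hkey w hw)
    have h4 : (fun e => dirDeriv f (c.symm e) (w (c.symm e))) =ᶠ[𝓝 (c x)]
      fun e => fderiv ℝ F e (pb w e) := h3
    rw [h4.fderiv_eq, fderiv_clm_apply hd2 hpw, ← hpbx w]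
    exact add_comm _ _
  have hbr : VectorField.mlieBracket 𝓘(ℝ, E) u v x =
      (fderiv ℝ (pb v) (c x) (u x) - fderiv ℝ (pb u) (c x) (v x) : E) := by
    change VectorField.mlieBracketWithin _ u v Set.univ x = _
    rw [VectorField.mlieBracketWithin_apply, mfderiv_extChartAt_self]
    erw [ContinuousLinearMap.inverse_id]
    simp only [Set.preimage_univ, Set.univ_inter, modelWithCornersSelf_coe, Set.range_id]
    refine (congrFun (VectorField.lieBracketWithin_univ (𝕜 := ℝ)) (c x)).trans ?_
    rw [← hpbx u, ← hpbx v]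
    simp only [pb, modelWithCornersSelf_coe, Set.range_id]
    rfl
  rw [hterm v u hv (hdpb v hvx), hterm u v hu (hdpb u hux), hbr, hdir f hfx]
  have hs := (hF.isSymmSndFDerivAt (by
    simp only [minSmoothness_of_isRCLikeNormedField]; exact ENat.LEInfty.out)).eq (u x) (v x)
  rw [hs]
  change fderiv ℝ F (c x) _ = _
  rw [map_sub]
  abel

end Calculus

/-! ### Smooth charts with values in a normed space, and their coordinate fields -/

section Charts

variable {E : Type*} [NormedAddCommGroup E] [NormedSpace ℝ E]
  {M : Type*} [TopologicalSpace M] [ChartedSpace E M]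
  {G : Type*} [NormedAddCommGroup G] [NormedSpace ℝ G]

/-- A local diffeomorphism onto an open set in a normed space. -/
structure IsSmoothChart (Ψ : OpenPartialHomeomorph M G) : Prop where
  smooth : ContMDiffOn 𝓘(ℝ, E) 𝓘(ℝ, G) ∞ Ψ Ψ.source
  smooth_symm : ContMDiffOn 𝓘(ℝ, G) 𝓘(ℝ, E) ∞ Ψ.symm Ψ.target

namespace IsSmoothChart

variable {Ψ : OpenPartialHomeomorph M G}

theorem mDifferentiable (hΨ : IsSmoothChart (E := E) Ψ) :
    Ψ.MDifferentiable 𝓘(ℝ, E) 𝓘(ℝ, G) :=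
  ⟨hΨ.smooth.mdifferentiableOn (by simp), hΨ.smooth_symm.mdifferentiableOn (by simp)⟩

theorem mdifferentiableAt (hΨ : IsSmoothChart (E := E) Ψ) {p : M} (hp : p ∈ Ψ.source) :
    MDifferentiableAt 𝓘(ℝ, E) 𝓘(ℝ, G) Ψ p := hΨ.mDifferentiable.mdifferentiableAt hp

theorem isInvertible (hΨ : IsSmoothChart (E := E) Ψ) {p : M} (hp : p ∈ Ψ.source) :
    (mfderiv 𝓘(ℝ, E) 𝓘(ℝ, G) Ψ p).IsInvertible := ⟨hΨ.mDifferentiable.mfderiv hp, rfl⟩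

theorem eq_zero_of_mfderiv_eq_zero (hΨ : IsSmoothChart (E := E) Ψ) {p : M} (hp : p ∈ Ψ.source)
    {w : TangentSpace 𝓘(ℝ, E) p} (hw : mfderiv 𝓘(ℝ, E) 𝓘(ℝ, G) Ψ p w = 0) : w = 0 :=
  (hΨ.mDifferentiable.mfderiv_bijective hp).1 (hw.trans (map_zero _).symm)

/-- A function that is smooth near a point of a chart is smooth in that chart. -/
theorem contDiffAt_symm (hΨ : IsSmoothChart (E := E) Ψ) {U : Set M} (hU : IsOpen U) {f : M → ℝ}
    (hf : SmoothFunOn E U f) {q : G} (hq : q ∈ Ψ.target) (hqU : Ψ.symm q ∈ U) :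
    ContDiffAt ℝ ∞ (fun q => f (Ψ.symm q)) q := by
  rw [← contMDiffAt_iff_contDiffAt]
  exact (hf.contMDiffAt (hU.mem_nhds hqU)).comp q
    (hΨ.smooth_symm.contMDiffAt (Ψ.open_target.mem_nhds hq))

end IsSmoothChart

/-- The vector field with the constant components `g` in the chart `Ψ`. -/
noncomputable def coordField (Ψ : OpenPartialHomeomorph M G) (g : G) : VecField E M :=
  VectorField.mpullback 𝓘(ℝ, E) 𝓘(ℝ, G) Ψ (fun _ => g)

theorem IsSmoothChart.mfderiv_coordField {Ψ : OpenPartialHomeomorph M G}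
    (hΨ : IsSmoothChart (E := E) Ψ) {p : M} (hp : p ∈ Ψ.source) (g : G) :
    mfderiv 𝓘(ℝ, E) 𝓘(ℝ, G) Ψ p (coordField Ψ g p) = g :=
  (hΨ.isInvertible hp).self_apply_inverse g

theorem IsSmoothChart.dirDeriv_comp_coordField {Ψ : OpenPartialHomeomorph M G}
    (hΨ : IsSmoothChart (E := E) Ψ) {p : M} (hp : p ∈ Ψ.source) {F : G → ℝ}
    (hF : DifferentiableAt ℝ F (Ψ p)) (g : G) :
    dirDeriv (fun y => F (Ψ y)) p (coordField (E := E) Ψ g p) = fderiv ℝ F (Ψ p) g := by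
  rw [dirDeriv_comp hF (hΨ.mdifferentiableAt hp), hΨ.mfderiv_coordField hp]

variable [IsManifold 𝓘(ℝ, E) ∞ M]

theorem IsSmoothChart.smooth_coordField [CompleteSpace E] {Ψ : OpenPartialHomeomorph M G}
    (hΨ : IsSmoothChart (E := E) Ψ) (g : G) :
    SmoothFieldOn Ψ.source (coordField (E := E) Ψ g) := by
  intro p hp
  have h1 : ContMDiffAt 𝓘(ℝ, G) 𝓘(ℝ, G).tangent ∞
      (fun q => (⟨q, g⟩ : TangentBundle 𝓘(ℝ, G) G)) (Ψ p) :=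
    contMDiffAt_vectorSpace_iff_contDiffAt.2 contDiffAt_const
  have h2 : IsManifold 𝓘(ℝ, E) 1 M := inferInstance
  exact (ContMDiffAt.mpullback_vectorField_preimage h1
    (hΨ.smooth.contMDiffAt (Ψ.open_source.mem_nhds hp)) (hΨ.isInvertible hp)
    (by simp)).contMDiffWithinAt

/-- A map with an injective differential at a point is a chart near that point, if the dimensions
are equal. -/
theorem exists_isSmoothChart [FiniteDimensional ℝ E] [FiniteDimensional ℝ G]
    (hdim : Module.finrank ℝ E = Module.finrank ℝ G) {φ : M → G} {U : Set M} (hU : IsOpen U)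
    {x : M} (hx : x ∈ U) (hφ : ContMDiffOn 𝓘(ℝ, E) 𝓘(ℝ, G) ∞ φ U)
    (hinj : ∀ w : TangentSpace 𝓘(ℝ, E) x, mfderiv 𝓘(ℝ, E) 𝓘(ℝ, G) φ x w = 0 → w = 0) :
    ∃ Ψ : OpenPartialHomeomorph M G, x ∈ Ψ.source ∧ Ψ.source ⊆ U ∧ IsSmoothChart (E := E) Ψ ∧
      ∀ p ∈ Ψ.source, Ψ p = φ p := by
  have := FiniteDimensional.complete ℝ E
  have h1M : IsManifold 𝓘(ℝ, E) 1 M := inferInstance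
  let c := chartAt E x
  have hxc : x ∈ c.source := mem_chart_source E x
  have hcs : ContMDiffOn 𝓘(ℝ, E) 𝓘(ℝ, E) ∞ c.symm c.target := contMDiffOn_chart_symm
  have hcc : ContMDiffOn 𝓘(ℝ, E) 𝓘(ℝ, E) ∞ c c.source := contMDiffOn_chart
  let f : E → G := fun e => φ (c.symm e)
  have hfev : ∀ᶠ e in 𝓝 (c x), ContDiffAt ℝ ∞ f e := by
    have h1 : ∀ᶠ q in 𝓝 (c x), c.symm q ∈ U := by
      refine (c.continuousAt_symm (c.map_source hxc)).eventually (hU.mem_nhds ?_)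
      rwa [c.left_inv hxc]
    filter_upwards [c.open_target.mem_nhds (c.map_source hxc), h1] with q h2 h3
    rw [← contMDiffAt_iff_contDiffAt]
    exact (hφ.contMDiffAt (hU.mem_nhds h3)).comp q (hcs.contMDiffAt (c.open_target.mem_nhds h2))
  have hfd := (hfev.self_of_nhds.differentiableAt (by simp)).hasFDerivAt
  have hsx : c.symm (c x) = x := c.left_inv hxc
  have hfinj : Function.Injective (fderiv ℝ f (c x)) := by
    rw [injective_iff_map_eq_zero]
    intro z hz
    have hmd := mdifferentiable_chart (I := 𝓘(ℝ, E)) x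
    have h2 : MDifferentiableAt 𝓘(ℝ, E) 𝓘(ℝ, E) c.symm (c x) :=
      hmd.mdifferentiableAt_symm (c.map_source hxc)
    have h3 : MDifferentiableAt 𝓘(ℝ, E) 𝓘(ℝ, G) φ (c.symm (c x)) := by
      rw [hsx]
      exact (hφ.contMDiffAt (hU.mem_nhds hx)).mdifferentiableAt (by simp)
    have h4 := mfderiv_comp_apply (I := 𝓘(ℝ, E)) (I' := 𝓘(ℝ, E)) (I'' := 𝓘(ℝ, G)) (c x) h3 h2 z
    have h5 : mfderiv 𝓘(ℝ, E) 𝓘(ℝ, G) (φ ∘ c.symm) (c x) z = 0 := by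
      rw [mfderiv_eq_fderiv]; exact hz
    rw [h5] at h4
    have hinj' : ∀ w : TangentSpace 𝓘(ℝ, E) (c.symm (c x)),
        mfderiv 𝓘(ℝ, E) 𝓘(ℝ, G) φ (c.symm (c x)) w = 0 → w = 0 := by
      rw [hsx]; exact hinj
    have h6 := hinj' _ h4.symm
    exact (hmd.symm.mfderiv_bijective (c.map_source hxc)).1 (h6.trans (map_zero _).symm)
  -- Equality of dimensions turns the injective differential into an isomorphism, so the inverse
  -- function theorem applies.
  let e := ((fderiv ℝ f (c x) : E →ₗ[ℝ] G).linearEquivOfInjective hfinj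
    hdim).toContinuousLinearEquiv
  have he : HasFDerivAt f (e : E →L[ℝ] G) (c x) := by
    refine hfd.congr_fderiv ?_
    ext z
    rfl
  obtain ⟨θ, hθ, hθf, hθs, hθss, -⟩ := exists_openPartialHomeomorph_of_hasFDerivAt hfev he
  have hsrc : ∀ p, p ∈ ((c.trans θ).restrOpen U hU).source ↔
      (p ∈ c.source ∧ c p ∈ θ.source) ∧ p ∈ U := by
    intro p
    rw [OpenPartialHomeomorph.restrOpen_source, OpenPartialHomeomorph.trans_source]
    rfl
  refine ⟨(c.trans θ).restrOpen U hU, (hsrc x).2 ⟨⟨hxc, hθ⟩, hx⟩, fun p hp => ((hsrc p).1 hp).2,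
    ⟨?_, ?_⟩, ?_⟩
  · exact hθs.contMDiffOn.comp (hcc.mono fun p hp => ((hsrc p).1 hp).1.1)
      fun p hp => ((hsrc p).1 hp).1.2
  · have htgt : ∀ q ∈ ((c.trans θ).restrOpen U hU).target, q ∈ θ.target ∧ θ.symm q ∈ c.target := by
      intro q hq
      have := hq.1
      rwa [OpenPartialHomeomorph.trans_target] at this
    exact hcs.comp (hθss.contMDiffOn.mono fun q hq => (htgt q hq).1) fun q hq => (htgt q hq).2
  · intro p hp
    change θ (c p) = φ p
    rw [hθf]
    change φ (c.symm (c p)) = φ p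
    rw [c.left_inv ((hsrc p).1 hp).1.1]

end Charts

/-! ### Differential equations along parallel lines -/

section Transport

variable {G F : Type} [NormedAddCommGroup G] [NormedSpace ℝ G]
  [NormedAddCommGroup F] [NormedSpace ℝ F]

/-- Ordinary differential equations along the lines in a fixed direction. -/
theorem exists_transport [FiniteDimensional ℝ G] [FiniteDimensional ℝ F]
    {f : G × F → F} {g : G → F} {q₀ e : G} {ℓ : G →L[ℝ] ℝ} (he : ℓ e = 1)
    (hf : ∀ᶠ z in 𝓝 (q₀, g q₀), ContDiffAt ℝ ∞ f z) (hg : ∀ᶠ q in 𝓝 q₀, ContDiffAt ℝ ∞ g q) :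
    ∃ a : G → F, (∀ᶠ q in 𝓝 q₀, ContDiffAt ℝ ∞ a q) ∧
      (∀ᶠ q in 𝓝 q₀, fderiv ℝ a q e = f (q, a q)) ∧ ∀ᶠ q in 𝓝 q₀, ℓ q = ℓ q₀ → a q = g q := by
  -- The starting point of a line serves as the parameter, and the position on the line along `e` as
  -- the time.
  let m : G × ℝ × F → G × F := fun z => (z.1 + z.2.1 • e, z.2.2)
  have hm : ContDiff ℝ ∞ m := by fun_prop
  have hm0 : m (q₀, 0, g q₀) = (q₀, g q₀) := by simp [m]
  have hfm : ∀ᶠ z in 𝓝 (q₀, (0 : ℝ), g q₀), ContDiffAt ℝ ∞ (fun z => f (m z)) z := by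
    have h1 : ∀ᶠ z in 𝓝 (q₀, (0 : ℝ), g q₀), ContDiffAt ℝ ∞ f (m z) :=
      hm.continuous.continuousAt.eventually (by rw [hm0]; exact hf)
    filter_upwards [h1] with z hz
    exact hz.comp z hm.contDiffAt
  obtain ⟨v, hv, hd, hi⟩ := exists_ode_solution hfm hg
  -- Since ℓ(e) = 1, the line through q along `e` meets the hyperplane ℓ = ℓ(q₀) in the first
  -- component of `B q`, and reaches q from there in the time given by the second.
  let B : G → G × ℝ := fun q => (q - (ℓ q - ℓ q₀) • e, ℓ q - ℓ q₀)
  have hB : ContDiff ℝ ∞ B := by fun_prop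
  have hB0 : B q₀ = (q₀, 0) := by simp [B]
  have hBc : Filter.Tendsto B (𝓝 q₀) (𝓝 (q₀, 0)) := by
    rw [← hB0]; exact hB.continuous.continuousAt
  have hsm : ∀ᶠ q in 𝓝 q₀, ContDiffAt ℝ ∞ (fun q => v (B q)) q := by
    filter_upwards [hBc.eventually hv] with q hq
    exact hq.comp q hB.contDiffAt
  refine ⟨fun q => v (B q), hsm, ?_, ?_⟩
  · filter_upwards [hsm, hBc.eventually hd] with q h1 h2
    have hl : HasDerivAt (fun s : ℝ => q + s • e) e 0 := by
      simpa using ((hasDerivAt_id (0 : ℝ)).smul_const e).const_add q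
    have h3 : HasFDerivAt (fun q => v (B q)) (fderiv ℝ (fun q => v (B q)) q) (q + (0 : ℝ) • e) := by
      rw [zero_smul, add_zero]
      exact (h1.differentiableAt (by simp)).hasFDerivAt
    have h4 := h3.comp_hasDerivAt (0 : ℝ) hl
    have h5 : HasDerivAt (fun s : ℝ => (ℓ q - ℓ q₀) + s) 1 0 := by
      simpa using (hasDerivAt_id (0 : ℝ)).const_add (ℓ q - ℓ q₀)
    have h6 : HasDerivAt (fun t => v ((B q).1, t)) (f (m ((B q).1, (B q).2, v (B q))))
        ((ℓ q - ℓ q₀) + 0) := by rw [add_zero]; exact h2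
    have h7 := h6.scomp (0 : ℝ) h5
    have h8 : (fun s : ℝ => v (B (q + s • e))) =
        (fun t => v ((B q).1, t)) ∘ fun s : ℝ => (ℓ q - ℓ q₀) + s := by
      funext s
      have : B (q + s • e) = ((B q).1, (ℓ q - ℓ q₀) + s) := by
        have h9 : ℓ q + s - ℓ q₀ = ℓ q - ℓ q₀ + s := by ring
        simp only [B, map_add, map_smul, he, smul_eq_mul, mul_one, Prod.mk.injEq, h9, and_true]
        rw [add_smul]
        abel
      simp only [this, Function.comp_apply]
    have h9 : HasDerivAt (fun s : ℝ => v (B (q + s • e)))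
        (fderiv ℝ (fun q => v (B q)) q e) 0 := h4
    rw [h8] at h9
    rw [h9.unique h7, one_smul]
    simp [m, B]
  · filter_upwards [hi] with q hq hℓ
    have : B q = (q, 0) := by simp [B, hℓ]
    rw [this, hq]

/-- Uniqueness for linear differential equations along the lines in a fixed direction. -/
theorem eventually_eq_zero_of_transport {a : G → F} {L : G → F →L[ℝ] F} {q₀ e : G} {ℓ : G →L[ℝ] ℝ}
    (ha : ∀ᶠ q in 𝓝 q₀, DifferentiableAt ℝ a q) (hL : ContinuousAt L q₀)
    (hd : ∀ᶠ q in 𝓝 q₀, fderiv ℝ a q e = L q (a q))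
    (h0 : ∀ᶠ q in 𝓝 q₀, ℓ q = ℓ q₀ → a q = 0) (he : ℓ e = 1) : ∀ᶠ q in 𝓝 q₀, a q = 0 := by
  have hLb : ∀ᶠ q in 𝓝 q₀, ‖L q‖ < ‖L q₀‖ + 1 :=
    hL.norm.eventually (gt_mem_nhds (lt_add_one _))
  obtain ⟨r, hr, hball⟩ := Metric.eventually_nhds_iff_ball.1 (ha.and (hd.and (h0.and hLb)))
  have hc : ∀ᶠ q in 𝓝 q₀, ‖q - q₀‖ + |ℓ q - ℓ q₀| * ‖e‖ < r := by
    have hcont : Continuous (fun q => ‖q - q₀‖ + |ℓ q - ℓ q₀| * ‖e‖) := by fun_prop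
    refine hcont.continuousAt.eventually (gt_mem_nhds ?_)
    simpa using hr
  filter_upwards [hc] with q hq
  set τ := ℓ q - ℓ q₀ with hτ
  -- The segment along `e` from the hyperplane ℓ = ℓ(q₀), at s = 0, to q, at s = 1. The bound `hc`
  -- keeps it in the ball where all hypotheses hold, and a Grönwall estimate propagates the zero
  -- initial value.
  let γ : ℝ → G := fun s => q + ((s - 1) * τ) • e
  have hγ : ∀ s ∈ Set.Icc (0 : ℝ) 1, γ s ∈ Metric.ball q₀ r := by
    intro s hs
    rw [mem_ball_iff_norm]
    have h1 : γ s - q₀ = (q - q₀) + ((s - 1) * τ) • e := by simp only [γ]; abel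
    rw [h1]
    refine (norm_add_le _ _).trans_lt (lt_of_le_of_lt ?_ hq)
    rw [norm_smul, Real.norm_eq_abs, abs_mul]
    have h2 : |s - 1| ≤ 1 := by rw [abs_le]; constructor <;> linarith [hs.1, hs.2]
    gcongr
    exact mul_le_of_le_one_left (abs_nonneg _) h2
  have hγd : ∀ s ∈ Set.Icc (0 : ℝ) 1,
      HasDerivAt (fun s => a (γ s)) (τ • L (γ s) (a (γ s))) s := by
    intro s hs
    have h1 := hball _ (hγ s hs)
    have h2 : HasDerivAt γ (τ • e) s := by
      have h3 : HasDerivAt (fun s : ℝ => (s - 1) * τ) τ s := by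
        simpa using ((hasDerivAt_id s).sub_const 1).mul_const τ
      exact (h3.smul_const e).const_add q
    have h4 := h1.1.hasFDerivAt.comp_hasDerivAt s h2
    rwa [map_smul, h1.2.1] at h4
  have hfin := eq_zero_of_abs_deriv_le_mul_abs_self_of_eq_zero_right
    (f := fun s => a (γ s)) (f' := fun s => τ • L (γ s) (a (γ s)))
    (K := |τ| * (‖L q₀‖ + 1)) (a := 0) (b := 1)
    (fun s hs => (hγd s hs).continuousAt.continuousWithinAt)
    (fun s hs => (hγd s (Set.Ico_subset_Icc_self hs)).hasDerivWithinAt)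
    ((hball _ (hγ 0 ⟨le_rfl, zero_le_one⟩)).2.2.1 (by
      simp only [γ, map_add, map_smul, he, smul_eq_mul, hτ]; ring))
    (fun s hs => by
      have h1 := hball _ (hγ s (Set.Ico_subset_Icc_self hs))
      rw [norm_smul, Real.norm_eq_abs, mul_assoc]
      gcongr
      exact (L (γ s)).le_of_opNorm_le h1.2.2.2.le _)
    1 ⟨zero_le_one, le_rfl⟩
  simpa [γ] using hfin

end Transport

/-! ### Parallel sections of a flat connection, in coordinates -/

section FlatConnections

variable {G F : Type} [NormedAddCommGroup G] [NormedSpace ℝ G]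
  [NormedAddCommGroup F] [NormedSpace ℝ F]

/-- The covariant derivative, in the direction of `e`, with the connection coefficients `L`. -/
noncomputable def covDeriv (L : G → F →L[ℝ] F) (e : G) (a : G → F) (q : G) : F :=
  fderiv ℝ a q e + L q (a q)

theorem covDeriv_congr {L : G → F →L[ℝ] F} {e : G} {a b : G → F} {q : G} (h : a =ᶠ[𝓝 q] b) :
    covDeriv L e a q = covDeriv L e b q := by
  unfold covDeriv
  rw [h.fderiv_eq, h.self_of_nhds]

theorem covDeriv_zero (L : G → F →L[ℝ] F) (e q : G) : covDeriv L e (fun _ => 0) q = 0 := by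
  simp [covDeriv]

theorem contDiffAt_covDeriv {L : G → F →L[ℝ] F} {e : G} {a : G → F} {q : G}
    (hL : ContDiffAt ℝ ∞ L q) (ha : ContDiffAt ℝ ∞ a q) : ContDiffAt ℝ ∞ (covDeriv L e a) q :=
  ((ha.fderiv_right (m := ∞) (by simp)).clm_apply contDiffAt_const).add (hL.clm_apply ha)

/-- The derivative along a hyperplane of a map vanishing on that hyperplane is zero. -/
theorem fderiv_apply_eq_zero_of_eventually {d : G → F} {q e : G} {ℓ : G →L[ℝ] ℝ} {c : ℝ}
    (hd : DifferentiableAt ℝ d q) (h0 : ∀ᶠ p in 𝓝 q, ℓ p = c → d p = 0) (hq : ℓ q = c)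
    (he : ℓ e = 0) : fderiv ℝ d q e = 0 := by
  have hl : HasDerivAt (fun s : ℝ => q + s • e) e 0 := by
    simpa using ((hasDerivAt_id (0 : ℝ)).smul_const e).const_add q
  have h3 : HasFDerivAt d (fderiv ℝ d q) (q + (0 : ℝ) • e) := by
    rw [zero_smul, add_zero]; exact hd.hasFDerivAt
  have h4 := h3.comp_hasDerivAt (0 : ℝ) hl
  have h5 : Filter.Tendsto (fun s : ℝ => q + s • e) (𝓝 0) (𝓝 q) := by
    simpa [ContinuousAt] using hl.continuousAt
  have h6 : (d ∘ fun s : ℝ => q + s • e) =ᶠ[𝓝 0] fun _ => (0 : F) := by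
    filter_upwards [h5.eventually h0] with s hs
    exact hs (by rw [map_add, map_smul, he, smul_zero, add_zero, hq])
  have h7 := h6.deriv_eq
  rw [h4.deriv, deriv_const] at h7
  exact h7

/-- A connection which is flat along the planes spanned by `e₁` and `e₂` has solutions of the
system for parallel sections with any given initial value. -/
theorem exists_covDeriv_eq_zero [FiniteDimensional ℝ G] [FiniteDimensional ℝ F]
    {L₁ L₂ : G → F →L[ℝ] F} {q₀ e₁ e₂ : G} {ℓ₁ ℓ₂ : G →L[ℝ] ℝ} (h₁ : ℓ₁ e₁ = 1) (h₂ : ℓ₂ e₂ = 1)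
    (h₁₂ : ℓ₂ e₁ = 0) (hL₁ : ∀ᶠ q in 𝓝 q₀, ContDiffAt ℝ ∞ L₁ q)
    (hL₂ : ∀ᶠ q in 𝓝 q₀, ContDiffAt ℝ ∞ L₂ q)
    (hflat : ∀ a : G → F, (∀ᶠ q in 𝓝 q₀, ContDiffAt ℝ ∞ a q) → ∀ᶠ q in 𝓝 q₀,
      covDeriv L₁ e₁ (covDeriv L₂ e₂ a) q = covDeriv L₂ e₂ (covDeriv L₁ e₁ a) q) (a₀ : F) :
    ∃ a : G → F, (∀ᶠ q in 𝓝 q₀, ContDiffAt ℝ ∞ a q) ∧ a q₀ = a₀ ∧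
      (∀ᶠ q in 𝓝 q₀, covDeriv L₁ e₁ a q = 0) ∧ ∀ᶠ q in 𝓝 q₀, covDeriv L₂ e₂ a q = 0 := by
  have hsm : ∀ {L : G → F →L[ℝ] F}, (∀ᶠ q in 𝓝 q₀, ContDiffAt ℝ ∞ L q) → ∀ c : F,
      ∀ᶠ z in 𝓝 (q₀, c), ContDiffAt ℝ ∞ (fun z : G × F => -L z.1 z.2) z := by
    intro L hL c
    filter_upwards [(continuous_fst.tendsto (q₀, c)).eventually hL] with z hz
    exact ((hz.comp z contDiffAt_fst).clm_apply contDiffAt_snd).neg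
  -- The value a₀ is transported along e₁; the result then serves, on the hyperplane ℓ₂ = ℓ₂(q₀), as
  -- the initial value for transport along e₂.
  obtain ⟨a', ha', hd', hi'⟩ := exists_transport (f := fun z : G × F => -L₁ z.1 z.2)
    (g := fun _ => a₀) (q₀ := q₀) h₁ (hsm hL₁ _)
    (Filter.Eventually.of_forall fun _ => contDiffAt_const)
  obtain ⟨a, ha, hd, hi⟩ := exists_transport (f := fun z : G × F => -L₂ z.1 z.2)
    (g := a') (q₀ := q₀) h₂ (hsm hL₂ _) ha'
  have hc2 : ∀ᶠ q in 𝓝 q₀, covDeriv L₂ e₂ a q = 0 := by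
    filter_upwards [hd] with q hq
    rw [covDeriv, hq]
    exact neg_add_cancel _
  refine ⟨a, ha, ?_, ?_, hc2⟩
  · rw [hi.self_of_nhds rfl, hi'.self_of_nhds rfl]
  -- Flatness gives ∇₂∇₁a = ∇₁∇₂a = 0, a linear equation along e₂ for ∇₁a. Its initial value is
  -- zero: on the hyperplane `a` agrees with `a'`, and e₁ is tangent to it as ℓ₂(e₁) = 0, so ∇₁a =
  -- ∇₁a' = 0 there.
  · refine eventually_eq_zero_of_transport (L := fun q => -L₂ q) (e := e₂) (ℓ := ℓ₂) ?_
      hL₂.self_of_nhds.continuousAt.neg ?_ ?_ h₂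
    · filter_upwards [ha, hL₁] with q h3 h4
      exact (contDiffAt_covDeriv h4 h3).differentiableAt (by simp)
    · filter_upwards [hflat a ha, hc2.eventually_nhds] with q h3 h4
      rw [covDeriv_congr h4, covDeriv_zero] at h3
      have h5 := eq_neg_of_add_eq_zero_left h3.symm
      rw [h5]
      rfl
    · filter_upwards [ha, ha', hd', hi.eventually_nhds] with q h3 h4 h5 h6 h7
      have h8 := fderiv_apply_eq_zero_of_eventually (d := fun q => a q - a' q) (q := q) (e := e₁)
        (ℓ := ℓ₂) (c := ℓ₂ q₀) ((h3.sub h4).differentiableAt (by simp))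
        (h6.mono fun p hp hpq => sub_eq_zero.2 (hp hpq)) h7 h₁₂
      rw [fderiv_fun_sub (h3.differentiableAt (by simp)) (h4.differentiableAt (by simp))] at h8
      have h9 : fderiv ℝ a q e₁ = fderiv ℝ a' q e₁ := sub_eq_zero.1 h8
      rw [covDeriv, h9, h5, h6.self_of_nhds h7]
      exact neg_add_cancel _

end FlatConnections

/-! ### Charts adapted to a foliation -/

section AdaptedCharts

variable {E : Type*} [NormedAddCommGroup E] [NormedSpace ℝ E]
  {M : Type*} [TopologicalSpace M] [ChartedSpace E M]

theorem mfderiv_clm_comp_apply {G G' : Type*} [NormedAddCommGroup G] [NormedSpace ℝ G]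
    [NormedAddCommGroup G'] [NormedSpace ℝ G'] (L : G →L[ℝ] G') {φ : M → G} {x : M}
    (hφ : MDifferentiableAt 𝓘(ℝ, E) 𝓘(ℝ, G) φ x) (u : TangentSpace 𝓘(ℝ, E) x) :
    mfderiv 𝓘(ℝ, E) 𝓘(ℝ, G') (fun y => L (φ y)) x u = L (mfderiv 𝓘(ℝ, E) 𝓘(ℝ, G) φ x u) := by
  have h := mfderiv_comp_apply (I := 𝓘(ℝ, E)) (I' := 𝓘(ℝ, G)) (I'' := 𝓘(ℝ, G')) x
    (L.mdifferentiableAt (x := φ x)) hφ u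
  refine h.trans ?_
  rw [mfderiv_eq_fderiv, L.fderiv]
  rfl

theorem mfderiv_prodMk_apply {G G' : Type*} [NormedAddCommGroup G] [NormedSpace ℝ G]
    [NormedAddCommGroup G'] [NormedSpace ℝ G'] {φ : M → G} {ψ : M → G'} {x : M}
    (hφ : MDifferentiableAt 𝓘(ℝ, E) 𝓘(ℝ, G) φ x) (hψ : MDifferentiableAt 𝓘(ℝ, E) 𝓘(ℝ, G') ψ x)
    (u : TangentSpace 𝓘(ℝ, E) x) :
    mfderiv 𝓘(ℝ, E) 𝓘(ℝ, G × G') (fun y => (φ y, ψ y)) x u =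
      ((mfderiv 𝓘(ℝ, E) 𝓘(ℝ, G) φ x u : G), (mfderiv 𝓘(ℝ, E) 𝓘(ℝ, G') ψ x u : G')) := by
  have h := hφ.prodMk_space hψ
  have h1 := mfderiv_clm_comp_apply (ContinuousLinearMap.fst ℝ G G') h u
  have h2 := mfderiv_clm_comp_apply (ContinuousLinearMap.snd ℝ G G') h u
  exact Prod.ext h1.symm h2.symm

/-- On `U`, the map `y` is a `C^∞` submersion into the plane with the vertical distribution `V`. -/
structure IsSubmersionOn (V : TangentSubspaces E M) (U : Set M) (y : M → ℝ × ℝ) : Prop where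
  smooth : ContMDiffOn 𝓘(ℝ, E) 𝓘(ℝ, ℝ × ℝ) ∞ y U
  surjective : ∀ p ∈ U, Function.Surjective (mfderiv 𝓘(ℝ, E) 𝓘(ℝ, ℝ × ℝ) y p)
  mem_iff : ∀ p ∈ U, ∀ w : TangentSpace 𝓘(ℝ, E) p,
    w ∈ V p ↔ mfderiv 𝓘(ℝ, E) 𝓘(ℝ, ℝ × ℝ) y p w = 0

theorem IsSubmersionOn.mono {V : TangentSubspaces E M} {U U' : Set M} {y : M → ℝ × ℝ}
    (hy : IsSubmersionOn V U y) (h : U' ⊆ U) : IsSubmersionOn V U' y :=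
  ⟨hy.smooth.mono h, fun p hp => hy.surjective p (h hp), fun p hp => hy.mem_iff p (h hp)⟩

/-- A chart in which the leaves of `V` are given by constancy of the first component. -/
structure IsAdaptedChart (V : TangentSubspaces E M)
    (Ψ : OpenPartialHomeomorph M ((ℝ × ℝ) × (ℝ × ℝ))) : Prop extends
    IsSmoothChart (E := E) Ψ where
  mem_iff : ∀ p ∈ Ψ.source, ∀ w : TangentSpace 𝓘(ℝ, E) p, w ∈ V p ↔
    (mfderiv 𝓘(ℝ, E) 𝓘(ℝ, (ℝ × ℝ) × (ℝ × ℝ)) Ψ p w : (ℝ × ℝ) × (ℝ × ℝ)).1 = 0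

theorem finrank_eq_two_of_submersion (hdim : Module.finrank ℝ E = 4)
    {V : TangentSubspaces E M} {U : Set M} {y : M → ℝ × ℝ} (hy : IsSubmersionOn V U y) {x : M}
    (hx : x ∈ U) : Module.finrank ℝ (V x) = 2 := by
  have hfin : FiniteDimensional ℝ E := Module.finite_of_finrank_eq_succ hdim
  have hfin' : FiniteDimensional ℝ (TangentSpace 𝓘(ℝ, E) x) := hfin
  let L : TangentSpace 𝓘(ℝ, E) x →ₗ[ℝ] ℝ × ℝ := (mfderiv 𝓘(ℝ, E) 𝓘(ℝ, ℝ × ℝ) y x).toLinearMap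
  have h1 := LinearMap.finrank_range_add_finrank_ker L
  have h2 : LinearMap.range L = ⊤ := LinearMap.range_eq_top.2 (hy.surjective x hx)
  have h3 : LinearMap.ker L = V x := by
    ext w
    exact (hy.mem_iff x hx w).symm
  have h4 : Module.finrank ℝ (TangentSpace 𝓘(ℝ, E) x) = 4 := hdim
  rw [h2, finrank_top, h3, h4] at h1
  simp at h1
  omega

variable [IsManifold 𝓘(ℝ, E) ∞ M]

/-- The kernel of dy at x is V x, so y is completed to a chart by two functions whose differentials
at x restrict to an isomorphism of V x onto the plane. -/
theorem exists_isAdaptedChart (hdim : Module.finrank ℝ E = 4) {V : TangentSubspaces E M}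
    {U : Set M} (hU : IsOpen U) {x : M} (hx : x ∈ U) {y : M → ℝ × ℝ} (hy : IsSubmersionOn V U y) :
    ∃ Ψ : OpenPartialHomeomorph M ((ℝ × ℝ) × (ℝ × ℝ)), x ∈ Ψ.source ∧ Ψ.source ⊆ U ∧
      IsAdaptedChart V Ψ ∧ ∀ p ∈ Ψ.source, (Ψ p).1 = y p := by
  have hfin : FiniteDimensional ℝ E := Module.finite_of_finrank_eq_succ hdim
  have hfin' : FiniteDimensional ℝ (TangentSpace 𝓘(ℝ, E) x) := hfin
  have h1M : IsManifold 𝓘(ℝ, E) 1 M := inferInstance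
  have hV := finrank_eq_two_of_submersion hdim hy hx
  let iso : V x ≃ₗ[ℝ] ℝ × ℝ := LinearEquiv.ofFinrankEq _ _ (by rw [hV]; simp)
  obtain ⟨k, hk⟩ := LinearMap.exists_extend (iso : V x →ₗ[ℝ] ℝ × ℝ)
  let c := chartAt E x
  have hxc : x ∈ c.source := mem_chart_source E x
  have hmd := mdifferentiable_chart (I := 𝓘(ℝ, E)) x
  let d : TangentSpace 𝓘(ℝ, E) x ≃L[ℝ] E := hmd.mfderiv hxc
  -- Composing with the inverse of the differential of `c` ensures that `k' ∘ c` has the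
  -- differential `k` at x.
  let k' : E →L[ℝ] ℝ × ℝ :=
    (k ∘ₗ (d.symm : E →L[ℝ] TangentSpace 𝓘(ℝ, E) x).toLinearMap :
      E →ₗ[ℝ] ℝ × ℝ).toContinuousLinearMap
  let φ : M → (ℝ × ℝ) × (ℝ × ℝ) := fun p => (y p, k' (c p))
  have hφ2 : ContMDiffOn 𝓘(ℝ, E) 𝓘(ℝ, ℝ × ℝ) ∞ (fun p => k' (c p)) c.source :=
    k'.contMDiff.comp_contMDiffOn contMDiffOn_chart
  have hφ : ContMDiffOn 𝓘(ℝ, E) 𝓘(ℝ, (ℝ × ℝ) × (ℝ × ℝ)) ∞ φ (U ∩ c.source) :=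
    (hy.smooth.mono Set.inter_subset_left).prodMk_space (hφ2.mono Set.inter_subset_right)
  have hd1 : ∀ p ∈ U ∩ c.source, ∀ w : TangentSpace 𝓘(ℝ, E) p,
      mfderiv 𝓘(ℝ, E) 𝓘(ℝ, (ℝ × ℝ) × (ℝ × ℝ)) φ p w =
        ((mfderiv 𝓘(ℝ, E) 𝓘(ℝ, ℝ × ℝ) y p w : ℝ × ℝ),
          (mfderiv 𝓘(ℝ, E) 𝓘(ℝ, ℝ × ℝ) (fun p => k' (c p)) p w : ℝ × ℝ)) := by
    intro p hp w
    have h1 := (hy.smooth.contMDiffAt (hU.mem_nhds hp.1)).mdifferentiableAt (by simp)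
    have h2 := (hφ2.contMDiffAt (c.open_source.mem_nhds hp.2)).mdifferentiableAt (by simp)
    exact mfderiv_prodMk_apply h1 h2 w
  have hinj : ∀ w : TangentSpace 𝓘(ℝ, E) x,
      mfderiv 𝓘(ℝ, E) 𝓘(ℝ, (ℝ × ℝ) × (ℝ × ℝ)) φ x w = 0 → w = 0 := by
    intro w hw
    rw [hd1 x ⟨hx, hxc⟩] at hw
    have hw1 : w ∈ V x := (hy.mem_iff x hx w).2 (congrArg Prod.fst hw)
    have hw2 := congrArg Prod.snd hw
    have h3 : mfderiv 𝓘(ℝ, E) 𝓘(ℝ, ℝ × ℝ) (fun p => k' (c p)) x w = k w := by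
      refine (mfderiv_clm_comp_apply k' (hmd.mdifferentiableAt hxc) w).trans ?_
      change k (d.symm (d w)) = k w
      rw [d.symm_apply_apply]
    have h4 : iso ⟨w, hw1⟩ = 0 := by
      have := congrArg (fun L => L ⟨w, hw1⟩) hk
      exact this.symm.trans (h3.symm.trans hw2)
    exact congrArg Subtype.val (iso.map_eq_zero_iff.1 h4)
  obtain ⟨Ψ, hΨx, hΨU, hΨ, hΨφ⟩ := exists_isSmoothChart (G := (ℝ × ℝ) × (ℝ × ℝ)) (by simp [hdim])
    (hU.inter c.open_source) ⟨hx, hxc⟩ hφ hinj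
  refine ⟨Ψ, hΨx, fun p hp => (hΨU hp).1, ⟨hΨ, fun p hp w => ?_⟩, fun p hp => by rw [hΨφ p hp]⟩
  have h5 : Ψ =ᶠ[𝓝 p] φ := Filter.eventually_of_mem (Ψ.open_source.mem_nhds hp) hΨφ
  have h6 : mfderiv 𝓘(ℝ, E) 𝓘(ℝ, (ℝ × ℝ) × (ℝ × ℝ)) Ψ p w =
      (mfderiv 𝓘(ℝ, E) 𝓘(ℝ, (ℝ × ℝ) × (ℝ × ℝ)) φ p w : (ℝ × ℝ) × (ℝ × ℝ)) := by
    rw [h5.mfderiv_eq]; rfl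
  rw [hy.mem_iff p (hΨU hp).1 w]
  have h7 : (mfderiv 𝓘(ℝ, E) 𝓘(ℝ, (ℝ × ℝ) × (ℝ × ℝ)) Ψ p w : (ℝ × ℝ) × (ℝ × ℝ)).1 =
      mfderiv 𝓘(ℝ, E) 𝓘(ℝ, ℝ × ℝ) y p w := by
    rw [h6, hd1 p (hΨU hp)]
  rw [h7]
  rfl

end AdaptedCharts

/-! ### Sections and connections in an adapted chart; existence of parallel sections -/

section Frames

variable {E : Type*} [NormedAddCommGroup E] [NormedSpace ℝ E]
  {M : Type*} [TopologicalSpace M] [ChartedSpace E M] [IsManifold 𝓘(ℝ, E) ∞ M]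
  {V : TangentSubspaces E M} {D : Sec V → Sec V → Sec V}
  {Ψ : OpenPartialHomeomorph M ((ℝ × ℝ) × (ℝ × ℝ))}

/-- `v` is `V`-parallel on every open subset of `W`. -/
def IsParallelWithin (D : Sec V → Sec V → Sec V) (W : Set M) (v : Sec V) : Prop :=
  ∀ U : Set M, IsOpen U → U ⊆ W → IsParallelOn D U v

theorem IsParallelWithin.mono {W W' : Set M} {v : Sec V} (h : IsParallelWithin D W v)
    (hW : W' ⊆ W) : IsParallelWithin D W' v := fun U hU hUW => h U hU (hUW.trans hW)

theorem SmoothSecOn.mono {U U' : Set M} {v : Sec V} (hv : SmoothSecOn U v) (h : U' ⊆ U) :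
    SmoothSecOn U' v := SmoothFieldOn.mono hv h

theorem SmoothSecOn.add {U : Set M} {u v : Sec V} (hu : SmoothSecOn U u) (hv : SmoothSecOn U v) :
    SmoothSecOn U (fun x => u x + v x) := SmoothFieldOn.add hu hv

theorem SmoothSecOn.smul {U : Set M} {f : M → ℝ} {v : Sec V} (hf : SmoothFunOn E U f)
    (hv : SmoothSecOn U v) : SmoothSecOn U (fun x => f x • v x) := SmoothFieldOn.smul hf hv

open Classical in
/-- The section of `V` with the constant component `g` in an adapted chart. -/
noncomputable def coordSec (V : TangentSubspaces E M)
    (Ψ : OpenPartialHomeomorph M ((ℝ × ℝ) × (ℝ × ℝ))) (g : ℝ × ℝ) : Sec V := fun p =>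
  if h : coordField Ψ (0, g) p ∈ V p then ⟨coordField Ψ (0, g) p, h⟩ else 0

theorem IsAdaptedChart.coe_coordSec (hΨ : IsAdaptedChart V Ψ) {p : M} (hp : p ∈ Ψ.source)
    (g : ℝ × ℝ) : (coordSec V Ψ g p).1 = coordField Ψ (0, g) p := by
  have h : coordField Ψ (0, g) p ∈ V p := by
    rw [hΨ.mem_iff p hp, hΨ.mfderiv_coordField hp]
  rw [coordSec, dif_pos h]

theorem IsAdaptedChart.mfderiv_coordSec (hΨ : IsAdaptedChart V Ψ) {p : M} (hp : p ∈ Ψ.source)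
    (g : ℝ × ℝ) : mfderiv 𝓘(ℝ, E) 𝓘(ℝ, (ℝ × ℝ) × (ℝ × ℝ)) Ψ p (coordSec V Ψ g p).1 =
      ((0, g) : (ℝ × ℝ) × (ℝ × ℝ)) := by
  rw [hΨ.coe_coordSec hp, hΨ.mfderiv_coordField hp]

theorem IsAdaptedChart.smooth_coordSec [CompleteSpace E] (hΨ : IsAdaptedChart V Ψ) (g : ℝ × ℝ) :
    SmoothSecOn Ψ.source (coordSec V Ψ g) :=
  SmoothFieldOn.congr (hΨ.smooth_coordField (0, g)) fun _ hp => hΨ.coe_coordSec hp g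

/-- The component, in an adapted chart, of a vector tangent to `V`. -/
noncomputable def vertComp (Ψ : OpenPartialHomeomorph M ((ℝ × ℝ) × (ℝ × ℝ))) (p : M) (v : V p) :
    ℝ × ℝ :=
  (mfderiv 𝓘(ℝ, E) 𝓘(ℝ, (ℝ × ℝ) × (ℝ × ℝ)) Ψ p v.1 : (ℝ × ℝ) × (ℝ × ℝ)).2

theorem IsAdaptedChart.mfderiv_eq_vertComp (hΨ : IsAdaptedChart V Ψ) {p : M} (hp : p ∈ Ψ.source)
    (v : V p) : mfderiv 𝓘(ℝ, E) 𝓘(ℝ, (ℝ × ℝ) × (ℝ × ℝ)) Ψ p v.1 =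
      ((0, vertComp Ψ p v) : (ℝ × ℝ) × (ℝ × ℝ)) :=
  Prod.ext ((hΨ.mem_iff p hp v.1).1 v.2) rfl

theorem IsAdaptedChart.eq_of_vertComp_eq (hΨ : IsAdaptedChart V Ψ) {p : M} (hp : p ∈ Ψ.source)
    {v v' : V p} (h : vertComp Ψ p v = vertComp Ψ p v') : v = v' := by
  refine Subtype.ext ((hΨ.mDifferentiable.mfderiv_bijective hp).1 ?_)
  rw [hΨ.mfderiv_eq_vertComp hp, hΨ.mfderiv_eq_vertComp hp, h]

theorem IsAdaptedChart.vertComp_coordSec (hΨ : IsAdaptedChart V Ψ) {p : M} (hp : p ∈ Ψ.source)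
    (g : ℝ × ℝ) : vertComp Ψ p (coordSec V Ψ g p) = g := by
  rw [vertComp, hΨ.mfderiv_coordSec hp]

theorem vertComp_add (p : M) (u v : V p) :
    vertComp Ψ p (u + v) = vertComp Ψ p u + vertComp Ψ p v :=
  congrArg Prod.snd (map_add (mfderiv 𝓘(ℝ, E) 𝓘(ℝ, (ℝ × ℝ) × (ℝ × ℝ)) Ψ p) u.1 v.1)

theorem vertComp_smul (p : M) (c : ℝ) (v : V p) :
    vertComp Ψ p (c • v) = c • vertComp Ψ p v :=
  congrArg Prod.snd (map_smul (mfderiv 𝓘(ℝ, E) 𝓘(ℝ, (ℝ × ℝ) × (ℝ × ℝ)) Ψ p) c v.1)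

theorem IsAdaptedChart.contMDiffOn_vertComp (hΨ : IsAdaptedChart V Ψ) {U : Set M} (hU : IsOpen U)
    (hUΨ : U ⊆ Ψ.source) {v : Sec V} (hv : SmoothSecOn U v) :
    ContMDiffOn 𝓘(ℝ, E) 𝓘(ℝ, ℝ × ℝ) ∞ (fun p => vertComp Ψ p (v p)) U :=
  (ContinuousLinearMap.snd ℝ (ℝ × ℝ) (ℝ × ℝ)).contMDiff.comp_contMDiffOn
    (contMDiffOn_mfderiv_apply hU (hΨ.smooth.mono hUΨ) hv)

/-- The section of `V` with the components `a`, as functions of the coordinates. -/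
noncomputable def chartSec (V : TangentSubspaces E M)
    (Ψ : OpenPartialHomeomorph M ((ℝ × ℝ) × (ℝ × ℝ))) (a : (ℝ × ℝ) × (ℝ × ℝ) → ℝ × ℝ) : Sec V :=
  fun p => (a (Ψ p)).1 • coordSec V Ψ (1, 0) p + (a (Ψ p)).2 • coordSec V Ψ (0, 1) p

theorem IsAdaptedChart.vertComp_chartSec (hΨ : IsAdaptedChart V Ψ) {p : M} (hp : p ∈ Ψ.source)
    (a : (ℝ × ℝ) × (ℝ × ℝ) → ℝ × ℝ) : vertComp Ψ p (chartSec V Ψ a p) = a (Ψ p) := by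
  rw [chartSec, vertComp_add, vertComp_smul, vertComp_smul, hΨ.vertComp_coordSec hp,
    hΨ.vertComp_coordSec hp]
  simp

theorem IsAdaptedChart.smooth_comp (hΨ : IsAdaptedChart V Ψ) {U : Set M} (hUΨ : U ⊆ Ψ.source)
    {F : (ℝ × ℝ) × (ℝ × ℝ) → ℝ} (hF : ∀ p ∈ U, ContDiffAt ℝ ∞ F (Ψ p)) :
    SmoothFunOn E U (fun p => F (Ψ p)) :=
  SmoothFunOn.comp_contDiffAt hF (hΨ.smooth.mono hUΨ)

theorem IsAdaptedChart.smooth_chartSec [CompleteSpace E] (hΨ : IsAdaptedChart V Ψ) {U : Set M}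
    (hUΨ : U ⊆ Ψ.source) {a : (ℝ × ℝ) × (ℝ × ℝ) → ℝ × ℝ}
    (ha : ∀ p ∈ U, ContDiffAt ℝ ∞ a (Ψ p)) : SmoothSecOn U (chartSec V Ψ a) :=
  (SmoothSecOn.smul (hΨ.smooth_comp hUΨ fun p hp => (ha p hp).fst)
    ((hΨ.smooth_coordSec _).mono hUΨ)).add
    (SmoothSecOn.smul (hΨ.smooth_comp hUΨ fun p hp => (ha p hp).snd)
    ((hΨ.smooth_coordSec _).mono hUΨ))

/-- The coefficients, in an adapted chart, of the connection `D` in the direction `g`. -/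
noncomputable def connCoeff (D : Sec V → Sec V → Sec V)
    (Ψ : OpenPartialHomeomorph M ((ℝ × ℝ) × (ℝ × ℝ))) (g : ℝ × ℝ) (q : (ℝ × ℝ) × (ℝ × ℝ)) :
    ℝ × ℝ →L[ℝ] ℝ × ℝ :=
  (ContinuousLinearMap.fst ℝ ℝ ℝ).smulRight
      (vertComp Ψ (Ψ.symm q) (D (coordSec V Ψ g) (coordSec V Ψ (1, 0)) (Ψ.symm q))) +
    (ContinuousLinearMap.snd ℝ ℝ ℝ).smulRight
      (vertComp Ψ (Ψ.symm q) (D (coordSec V Ψ g) (coordSec V Ψ (0, 1)) (Ψ.symm q)))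

variable [CompleteSpace E]

theorem IsAdaptedChart.contDiffAt_connCoeff (hΨ : IsAdaptedChart V Ψ) (hD : IsFlatTorsionFree V D)
    (g : ℝ × ℝ) {q : (ℝ × ℝ) × (ℝ × ℝ)} (hq : q ∈ Ψ.target) :
    ContDiffAt ℝ ∞ (connCoeff D Ψ g) q := by
  have h : ∀ g', ContDiffAt ℝ ∞ (fun q => vertComp Ψ (Ψ.symm q)
      (D (coordSec V Ψ g) (coordSec V Ψ g') (Ψ.symm q))) q := by
    intro g'
    have h1 := hΨ.contMDiffOn_vertComp Ψ.open_source subset_rfl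
      (hD.smooth _ Ψ.open_source _ _ (hΨ.smooth_coordSec g) (hΨ.smooth_coordSec g'))
    rw [← contMDiffAt_iff_contDiffAt]
    exact (h1.contMDiffAt (Ψ.open_source.mem_nhds (Ψ.map_target hq))).comp q
      (hΨ.smooth_symm.contMDiffAt (Ψ.open_target.mem_nhds hq))
  exact (((ContinuousLinearMap.smulRightL ℝ (ℝ × ℝ) (ℝ × ℝ)
    (ContinuousLinearMap.fst ℝ ℝ ℝ)).contDiff.contDiffAt.comp q (h _))).add
    ((ContinuousLinearMap.smulRightL ℝ (ℝ × ℝ) (ℝ × ℝ)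
    (ContinuousLinearMap.snd ℝ ℝ ℝ)).contDiff.contDiffAt.comp q (h _))

/-- The Leibniz rule for D, in components: this turns statements about D into statements about
`covDeriv`. -/
theorem IsAdaptedChart.conn_chartSec (hΨ : IsAdaptedChart V Ψ) (hD : IsFlatTorsionFree V D)
    (g : ℝ × ℝ) {U : Set M} (hU : IsOpen U) (hUΨ : U ⊆ Ψ.source)
    {a : (ℝ × ℝ) × (ℝ × ℝ) → ℝ × ℝ} (ha : ∀ p ∈ U, ContDiffAt ℝ ∞ a (Ψ p)) {p : M} (hp : p ∈ U) :
    D (coordSec V Ψ g) (chartSec V Ψ a) p =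
      chartSec V Ψ (covDeriv (connCoeff D Ψ g) (0, g) a) p := by
  have hs : ∀ g', SmoothSecOn U (coordSec V Ψ g') := fun g' => (hΨ.smooth_coordSec g').mono hUΨ
  have hf1 : SmoothFunOn E U (fun p => (a (Ψ p)).1) := hΨ.smooth_comp hUΨ fun p hp => (ha p hp).fst
  have hf2 : SmoothFunOn E U (fun p => (a (Ψ p)).2) := hΨ.smooth_comp hUΨ fun p hp => (ha p hp).snd
  have hda := (ha p hp).differentiableAt (by simp)
  have hd : ∀ L : ℝ × ℝ →L[ℝ] ℝ, dirDeriv (fun p => L (a (Ψ p))) p (coordSec V Ψ g p).1 =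
      L (fderiv ℝ a (Ψ p) (0, g)) := by
    intro L
    have h1 : HasFDerivAt (fun q => L (a q)) (L ∘L fderiv ℝ a (Ψ p)) (Ψ p) :=
      L.hasFDerivAt.comp _ hda.hasFDerivAt
    rw [hΨ.coe_coordSec (hUΨ hp), hΨ.dirDeriv_comp_coordField (hUΨ hp) h1.differentiableAt,
      h1.fderiv]
    rfl
  have hd1 := hd (ContinuousLinearMap.fst ℝ ℝ ℝ)
  have hd2 := hd (ContinuousLinearMap.snd ℝ ℝ ℝ)
  simp only [ContinuousLinearMap.coe_fst', ContinuousLinearMap.coe_snd'] at hd1 hd2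
  apply hΨ.eq_of_vertComp_eq (hUΨ hp)
  rw [hΨ.vertComp_chartSec (hUΨ hp)]
  unfold chartSec
  rw [hD.add_right U hU _ _ _ (hs g) ((hs _).smul hf1) ((hs _).smul hf2) p hp,
    hD.leibniz U hU _ _ _ hf1 (hs g) (hs _) p hp, hD.leibniz U hU _ _ _ hf2 (hs g) (hs _) p hp,
    hd1, hd2]
  simp only [vertComp_add, vertComp_smul, hΨ.vertComp_coordSec (hUΨ hp)]
  have hinv : Ψ.symm (Ψ p) = p := Ψ.left_inv (hUΨ hp)
  rw [covDeriv, connCoeff, hinv]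
  ext <;> simp <;> ring

/-- Each linear function of the coordinates has constant derivatives along both sections, so its
derivative along their bracket vanishes. -/
theorem IsAdaptedChart.mlieBracket_coordSec (hΨ : IsAdaptedChart V Ψ) (g g' : ℝ × ℝ) {p : M}
    (hp : p ∈ Ψ.source) : VectorField.mlieBracket 𝓘(ℝ, E) (coordSec V Ψ g).toField
      (coordSec V Ψ g').toField p = 0 := by
  have hl : ∀ L : (ℝ × ℝ) × (ℝ × ℝ) →L[ℝ] ℝ, L (mfderiv 𝓘(ℝ, E) 𝓘(ℝ, (ℝ × ℝ) × (ℝ × ℝ)) Ψ p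
      (VectorField.mlieBracket 𝓘(ℝ, E) (coordSec V Ψ g).toField
      (coordSec V Ψ g').toField p)) = 0 := by
    intro L
    have hc : ∀ g, ∀ p ∈ Ψ.source, dirDeriv (fun p => L (Ψ p)) p (coordSec V Ψ g p).1 =
        L (0, g) := by
      intro g p hp
      rw [dirDeriv_clm_comp L (hΨ.mdifferentiableAt hp), hΨ.mfderiv_coordSec hp]
    rw [← dirDeriv_clm_comp L (hΨ.mdifferentiableAt hp), dirDeriv_mlieBracket Ψ.open_source
      (hΨ.smooth_comp subset_rfl fun p _ => L.contDiff.contDiffAt) (hΨ.smooth_coordSec g)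
      (hΨ.smooth_coordSec g') hp, dirDeriv_congr_of_isOpen Ψ.open_source hp (hc g'),
      dirDeriv_congr_of_isOpen Ψ.open_source hp (hc g), dirDeriv_const, dirDeriv_const, sub_zero]
  refine hΨ.eq_zero_of_mfderiv_eq_zero hp (Prod.ext (Prod.ext ?_ ?_) (Prod.ext ?_ ?_))
  · exact hl (ContinuousLinearMap.fst ℝ ℝ ℝ ∘L ContinuousLinearMap.fst ℝ _ _)
  · exact hl (ContinuousLinearMap.snd ℝ ℝ ℝ ∘L ContinuousLinearMap.fst ℝ _ _)
  · exact hl (ContinuousLinearMap.fst ℝ ℝ ℝ ∘L ContinuousLinearMap.snd ℝ _ _)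
  · exact hl (ContinuousLinearMap.snd ℝ ℝ ℝ ∘L ContinuousLinearMap.snd ℝ _ _)

/-- Coordinate sections commute, so for them flatness of D means that the two covariant derivatives
commute. This supplies the flatness hypothesis of `exists_covDeriv_eq_zero`. -/
theorem IsAdaptedChart.covDeriv_comm (hΨ : IsAdaptedChart V Ψ) (hD : IsFlatTorsionFree V D)
    (g g' : ℝ × ℝ) {U : Set M} (hU : IsOpen U) (hUΨ : U ⊆ Ψ.source)
    {a : (ℝ × ℝ) × (ℝ × ℝ) → ℝ × ℝ} (ha : ∀ p ∈ U, ContDiffAt ℝ ∞ a (Ψ p)) {p : M} (hp : p ∈ U) :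
    covDeriv (connCoeff D Ψ g) (0, g) (covDeriv (connCoeff D Ψ g') (0, g') a) (Ψ p) =
      covDeriv (connCoeff D Ψ g') (0, g') (covDeriv (connCoeff D Ψ g) (0, g) a) (Ψ p) := by
  have hs : ∀ g', SmoothSecOn U (coordSec V Ψ g') := fun g' => (hΨ.smooth_coordSec g').mono hUΨ
  have hsa := hΨ.smooth_chartSec hUΨ ha
  -- The zero bracket is written as 0 times a section, so that linearity of D in its first argument
  -- makes the bracket term of the curvature vanish.
  have hz : SmoothSecOn U (fun x => (0 : ℝ) • coordSec V Ψ g x) :=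
    SmoothSecOn.smul (SmoothFunOn.const 0) (hs g)
  have hc : ∀ g, ∀ p ∈ U, ContDiffAt ℝ ∞ (covDeriv (connCoeff D Ψ g) (0, g) a) (Ψ p) :=
    fun g p hp => contDiffAt_covDeriv
      (hΨ.contDiffAt_connCoeff hD g (Ψ.map_source (hUΨ hp))) (ha p hp)
  have hit : ∀ g g', D (coordSec V Ψ g) (D (coordSec V Ψ g') (chartSec V Ψ a)) p =
      chartSec V Ψ (covDeriv (connCoeff D Ψ g) (0, g)
        (covDeriv (connCoeff D Ψ g') (0, g') a)) p := by
    intro g g'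
    rw [hD.isLocal U hU _ _ _ (chartSec V Ψ (covDeriv (connCoeff D Ψ g') (0, g') a)) (hs g)
      (hD.smooth U hU _ _ (hs g') hsa) (hs g) (hΨ.smooth_chartSec hUΨ (hc g'))
      (fun _ _ => rfl) (fun p hp => hΨ.conn_chartSec hD g' hU hUΨ ha hp) p hp,
      hΨ.conn_chartSec hD g hU hUΨ (hc g') hp]
  have hflat := hD.flat U hU (coordSec V Ψ g) (coordSec V Ψ g') (chartSec V Ψ a)
    (fun x => (0 : ℝ) • coordSec V Ψ g x) (hs g) (hs g') hsa hz (fun x hx => by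
      rw [hΨ.mlieBracket_coordSec g g' (hUΨ hx), zero_smul]; rfl) p hp
  rw [hD.smul_left U hU (fun _ => (0 : ℝ)) _ _ (SmoothFunOn.const 0) (hs g) hsa p hp, zero_smul,
    sub_zero, hit, hit, sub_eq_zero] at hflat
  have h := congrArg (vertComp Ψ p) hflat
  rwa [hΨ.vertComp_chartSec (hUΨ hp), hΨ.vertComp_chartSec (hUΨ hp)] at h

/-- D is linear over functions in its first argument, so it suffices to test the two coordinate
directions. -/
theorem IsAdaptedChart.isParallelWithin (hΨ : IsAdaptedChart V Ψ) (hD : IsFlatTorsionFree V D)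
    {W : Set M} (hWΨ : W ⊆ Ψ.source) {v : Sec V} (hv : SmoothSecOn W v)
    (h₁ : ∀ p ∈ W, D (coordSec V Ψ (1, 0)) v p = 0)
    (h₂ : ∀ p ∈ W, D (coordSec V Ψ (0, 1)) v p = 0) : IsParallelWithin D W v := by
  intro U hU hUW
  have hUΨ := hUW.trans hWΨ
  have hvU := hv.mono hUW
  refine ⟨hvU, fun u hu p hp => ?_⟩
  have hs : ∀ g', SmoothSecOn U (coordSec V Ψ g') := fun g' => (hΨ.smooth_coordSec g').mono hUΨ
  have hc := hΨ.contMDiffOn_vertComp hU hUΨ hu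
  have hc1 : SmoothFunOn E U (fun p => (vertComp Ψ p (u p)).1) :=
    SmoothFunOn.comp_contDiffAt (F := Prod.fst) (fun _ _ => contDiffAt_fst) hc
  have hc2 : SmoothFunOn E U (fun p => (vertComp Ψ p (u p)).2) :=
    SmoothFunOn.comp_contDiffAt (F := Prod.snd) (fun _ _ => contDiffAt_snd) hc
  have hu' := ((hs (1, 0)).smul hc1).add ((hs (0, 1)).smul hc2)
  rw [hD.isLocal U hU u v _ v hu hvU hu' hvU (fun p hp => ?_) (fun _ _ => rfl) p hp,
    hD.add_left U hU _ _ _ ((hs _).smul hc1) ((hs _).smul hc2) hvU p hp,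
    hD.smul_left U hU _ _ _ hc1 (hs _) hvU p hp, hD.smul_left U hU _ _ _ hc2 (hs _) hvU p hp,
    h₁ p (hUW hp), h₂ p (hUW hp), smul_zero, smul_zero, add_zero]
  refine hΨ.eq_of_vertComp_eq (hUΨ hp) ?_
  rw [vertComp_add, vertComp_smul, vertComp_smul, hΨ.vertComp_coordSec (hUΨ hp),
    hΨ.vertComp_coordSec (hUΨ hp)]
  simp

/-- A flat connection has parallel sections with any given value at a point. -/
theorem IsAdaptedChart.exists_isParallelWithin (hΨ : IsAdaptedChart V Ψ)
    (hD : IsFlatTorsionFree V D) {x : M} (hx : x ∈ Ψ.source) (v₀ : V x) :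
    ∃ W : Set M, IsOpen W ∧ x ∈ W ∧ W ⊆ Ψ.source ∧ ∃ v : Sec V, IsParallelWithin D W v ∧
      v x = v₀ := by
  have htgt := Ψ.open_target.mem_nhds (Ψ.map_source hx)
  have hL : ∀ g, ∀ᶠ q in 𝓝 (Ψ x), ContDiffAt ℝ ∞ (connCoeff D Ψ g) q := fun g =>
    Filter.eventually_of_mem htgt fun q hq => hΨ.contDiffAt_connCoeff hD g hq
  obtain ⟨a, ha, ha0, h1, h2⟩ := exists_covDeriv_eq_zero
    (L₁ := connCoeff D Ψ (1, 0)) (L₂ := connCoeff D Ψ (0, 1)) (q₀ := Ψ x)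
    (e₁ := (0, (1, 0))) (e₂ := (0, (0, 1)))
    (ℓ₁ := ContinuousLinearMap.fst ℝ ℝ ℝ ∘L ContinuousLinearMap.snd ℝ (ℝ × ℝ) (ℝ × ℝ))
    (ℓ₂ := ContinuousLinearMap.snd ℝ ℝ ℝ ∘L ContinuousLinearMap.snd ℝ (ℝ × ℝ) (ℝ × ℝ))
    (by simp) (by simp) (by simp) (hL _) (hL _) (fun a ha => by
      obtain ⟨t, hta, hto, hxt⟩ := eventually_nhds_iff.1 ha
      filter_upwards [htgt, hto.mem_nhds hxt] with q hq hqt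
      have h := hΨ.covDeriv_comm hD (1, 0) (0, 1) (U := Ψ.source ∩ Ψ ⁻¹' t) (a := a)
        (Ψ.isOpen_inter_preimage hto) Set.inter_subset_left (fun p hp => hta _ hp.2)
        (p := Ψ.symm q) ⟨Ψ.map_target hq, by rwa [Set.mem_preimage, Ψ.right_inv hq]⟩
      rwa [Ψ.right_inv hq] at h) (vertComp Ψ x v₀)
  obtain ⟨t, hta, hto, hxt⟩ := eventually_nhds_iff.1 (ha.and (h1.and h2))
  have hWo : IsOpen (Ψ.source ∩ Ψ ⁻¹' t) := Ψ.isOpen_inter_preimage hto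
  have hsub : Ψ.source ∩ Ψ ⁻¹' t ⊆ Ψ.source := Set.inter_subset_left
  have hsm : ∀ p ∈ Ψ.source ∩ Ψ ⁻¹' t, ContDiffAt ℝ ∞ a (Ψ p) := fun p hp => (hta _ hp.2).1
  refine ⟨_, hWo, ⟨hx, hxt⟩, hsub, chartSec V Ψ a, hΨ.isParallelWithin hD hsub
    (hΨ.smooth_chartSec hsub hsm) (fun p hp => ?_) (fun p hp => ?_),
    hΨ.eq_of_vertComp_eq hx (by rw [hΨ.vertComp_chartSec hx, ha0])⟩
  · rw [hΨ.conn_chartSec hD _ hWo hsub hsm hp]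
    simp [chartSec, (hta _ hp.2).2.1]
  · rw [hΨ.conn_chartSec hD _ hWo hsub hsm hp]
    simp [chartSec, (hta _ hp.2).2.2]

end Frames

/-! ### Integrating factors and primitives in the plane -/

section PlaneForms

/-- A nonvanishing `1`-form in the plane is locally a nonzero multiple of a coordinate
differential. -/
theorem exists_integratingFactor_of_left {F₁ F₂ : ℝ × ℝ → ℝ} {q₀ : ℝ × ℝ}
    (h₁ : ∀ᶠ q in 𝓝 q₀, ContDiffAt ℝ ∞ F₁ q) (h₂ : ∀ᶠ q in 𝓝 q₀, ContDiffAt ℝ ∞ F₂ q)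
    (h0 : F₁ q₀ ≠ 0) : ∃ (Y : ℝ × ℝ → ℝ × ℝ) (g : ℝ × ℝ → ℝ), ∀ᶠ q in 𝓝 q₀,
      ContDiffAt ℝ ∞ Y q ∧ ContDiffAt ℝ ∞ g q ∧ g q ≠ 0 ∧ (fderiv ℝ Y q).IsInvertible ∧
      ∀ w : ℝ × ℝ, F₁ q * w.1 + F₂ q * w.2 = g q * (fderiv ℝ Y q w).1 := by
  have hne : ∀ᶠ q in 𝓝 q₀, F₁ q ≠ 0 := h₁.self_of_nhds.continuousAt.eventually_ne h0
  -- The kernel of the form is spanned by (-F₂/F₁, 1), and its integral curves are graphs of the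
  -- first coordinate over the second. The unknown is that first coordinate, and `m` assembles the
  -- point of the plane at which the slope is taken.
  let m : (ℝ × ℝ) × ℝ → ℝ × ℝ := fun z => (z.2, z.1.2)
  have hm : ContDiff ℝ ∞ m := by fun_prop
  have hmt : Filter.Tendsto m (𝓝 (q₀, q₀.1)) (𝓝 q₀) := hm.continuous.continuousAt
  obtain ⟨a, ha, hd, hi⟩ := exists_transport (f := fun z : (ℝ × ℝ) × ℝ => -(F₂ (m z) / F₁ (m z)))
    (g := fun q => q.1) (q₀ := q₀) (e := (0, 1)) (ℓ := ContinuousLinearMap.snd ℝ ℝ ℝ) (by simp)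
    (by
      filter_upwards [hmt.eventually h₁, hmt.eventually h₂, hmt.eventually hne] with z h3 h4 h5
      exact ((h4.comp z hm.contDiffAt).div (h3.comp z hm.contDiffAt) h5).neg)
    (Filter.Eventually.of_forall fun _ => contDiffAt_fst)
  -- `Θ` maps vertical lines to integral curves of the kernel; its local inverse straightens them.
  let Θ : ℝ × ℝ → ℝ × ℝ := fun q => (a q, q.2)
  have hΘ : ∀ᶠ q in 𝓝 q₀, ContDiffAt ℝ ∞ Θ q := ha.mono fun q hq => hq.prodMk contDiffAt_snd
  have hΘ0 : Θ q₀ = q₀ := Prod.ext (hi.self_of_nhds rfl) rfl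
  have hΘd : ∀ q, ContDiffAt ℝ ∞ a q → ∀ w, fderiv ℝ Θ q w = (fderiv ℝ a q w, w.2) := by
    intro q hq w
    rw [((hq.differentiableAt (by simp)).hasFDerivAt.prodMk hasFDerivAt_snd).fderiv]
    rfl
  have ha0 := ha.self_of_nhds
  -- On the horizontal line through q₀ the function `a` is the first coordinate. As `Θ` preserves
  -- the second coordinate, this makes its differential at q₀ injective.
  have hda : fderiv ℝ a q₀ (1, 0) = 1 := by
    have h := fderiv_apply_eq_zero_of_eventually (d := fun q => a q - q.1) (q := q₀) (e := (1, 0))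
      (ℓ := ContinuousLinearMap.snd ℝ ℝ ℝ) (c := q₀.2)
      ((ha0.sub contDiffAt_fst).differentiableAt (by simp))
      (hi.mono fun q hq h => sub_eq_zero.2 (hq h)) rfl rfl
    rw [fderiv_fun_sub (ha0.differentiableAt (by simp)) differentiableAt_fst, fderiv_fst] at h
    exact sub_eq_zero.1 h
  have hinj : Function.Injective (fderiv ℝ Θ q₀ : ℝ × ℝ →ₗ[ℝ] ℝ × ℝ) := by
    rw [injective_iff_map_eq_zero]
    rintro ⟨s, t⟩ hw
    have hw' : fderiv ℝ Θ q₀ (s, t) = 0 := hw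
    rw [hΘd q₀ ha0] at hw'
    obtain ⟨h3, h4⟩ := Prod.mk.inj hw'
    simp only at h4
    subst h4
    have h5 : ((s, 0) : ℝ × ℝ) = s • ((1, 0) : ℝ × ℝ) := by simp
    rw [h5, map_smul, hda] at h3
    simpa using h3
  let e := (LinearEquiv.ofInjectiveEndo _ hinj).toContinuousLinearEquiv
  have he : HasFDerivAt Θ (e : ℝ × ℝ →L[ℝ] ℝ × ℝ) q₀ := by
    refine (hΘ.self_of_nhds.differentiableAt (by simp)).hasFDerivAt.congr_fderiv ?_
    exact ContinuousLinearMap.ext fun z => rfl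
  obtain ⟨φ, hφ, hφΘ, hφs, hφss, hφi⟩ := exists_openPartialHomeomorph_of_hasFDerivAt hΘ he
  have hφ0 : φ q₀ = q₀ := (hφΘ q₀).trans hΘ0
  have htgt : ∀ᶠ q in 𝓝 q₀, q ∈ φ.target :=
    φ.open_target.mem_nhds (by rw [← hφ0]; exact φ.map_source hφ)
  have hQ0 : φ.symm q₀ = q₀ := by
    have := φ.left_inv hφ
    rwa [hφ0] at this
  have hQt : Filter.Tendsto φ.symm (𝓝 q₀) (𝓝 q₀) := by
    have := φ.continuousAt_symm htgt.self_of_nhds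
    rwa [ContinuousAt, hQ0] at this
  have hQs : ∀ q ∈ φ.target, ContDiffAt ℝ ∞ φ.symm q := fun q hq =>
    hφss.contDiffAt (φ.open_target.mem_nhds hq)
  -- The first component of the inverse is constant along the kernel curves, so its differential is
  -- proportional to the given form. Comparing coefficients of the first coordinate determines the
  -- factor.
  refine ⟨φ.symm, fun q => F₁ q / (fderiv ℝ φ.symm q (1, 0)).1, ?_⟩
  filter_upwards [htgt, htgt.eventually_nhds, h₁, hne, hQt.eventually ha, hQt.eventually hd]
    with q hq hqn hq1 hq0 hqa hqd
  have hr : φ.symm q ∈ φ.source := φ.map_target hq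
  have hΘr : Θ (φ.symm q) = q := by rw [← hφΘ, φ.right_inv hq]
  have hdiffQ := (hQs q hq).differentiableAt (by simp)
  have hdiffΘ : DifferentiableAt ℝ Θ (φ.symm q) :=
    (hqa.prodMk contDiffAt_snd).differentiableAt (by simp)
  have hinv1 : ∀ w, fderiv ℝ φ.symm q (fderiv ℝ Θ (φ.symm q) w) = w := by
    intro w
    have h3 : HasFDerivAt (fun r => φ.symm (Θ r))
        (fderiv ℝ φ.symm q ∘L fderiv ℝ Θ (φ.symm q)) (φ.symm q) := by
      refine HasFDerivAt.comp _ ?_ hdiffΘ.hasFDerivAt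
      rw [hΘr]; exact hdiffQ.hasFDerivAt
    have h4 : (fun r => φ.symm (Θ r)) =ᶠ[𝓝 (φ.symm q)] id := by
      filter_upwards [φ.open_source.mem_nhds hr] with r hr
      rw [← hφΘ, φ.left_inv hr, id]
    have h5 := h3.unique ((hasFDerivAt_id _).congr_of_eventuallyEq h4)
    exact congrArg (fun L => L w) h5
  have hinv2 : ∀ w, fderiv ℝ Θ (φ.symm q) (fderiv ℝ φ.symm q w) = w := by
    intro w
    have h3 : HasFDerivAt (fun r => Θ (φ.symm r))
        (fderiv ℝ Θ (φ.symm q) ∘L fderiv ℝ φ.symm q) q :=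
      hdiffΘ.hasFDerivAt.comp _ hdiffQ.hasFDerivAt
    have h4 : (fun r => Θ (φ.symm r)) =ᶠ[𝓝 q] id := by
      filter_upwards [hqn] with r hr
      rw [← hφΘ, φ.right_inv hr, id]
    have h5 := h3.unique ((hasFDerivAt_id _).congr_of_eventuallyEq h4)
    exact congrArg (fun L => L w) h5
  -- The straightening map takes the kernel direction to the vertical one. The first component of
  -- this relation is the proportionality of the two forms.
  have hrel : fderiv ℝ φ.symm q (-(F₂ q / F₁ q), 1) = (0, 1) := by
    have h3 := hinv1 (0, 1)
    have hmq : m (φ.symm q, a (φ.symm q)) = q := hΘr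
    rwa [hΘd _ hqa, hqd, hmq] at h3
  have hsplit : ∀ w : ℝ × ℝ, (fderiv ℝ φ.symm q w).1 =
      w.1 * (fderiv ℝ φ.symm q (1, 0)).1 + w.2 * (fderiv ℝ φ.symm q (0, 1)).1 := by
    intro w
    have h3 : w = w.1 • ((1, 0) : ℝ × ℝ) + w.2 • ((0, 1) : ℝ × ℝ) := by ext <;> simp
    conv_lhs => rw [h3, map_add, map_smul, map_smul]
    simp
  set A := (fderiv ℝ φ.symm q (1, 0)).1 with hA
  set B := (fderiv ℝ φ.symm q (0, 1)).1 with hB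
  have hAB : B = F₂ q / F₁ q * A := by
    have h3 := hsplit (-(F₂ q / F₁ q), 1)
    rw [hrel] at h3
    simp only at h3
    linarith
  have hA0 : A ≠ 0 := by
    intro hA0
    have h3 := hsplit (fderiv ℝ Θ (φ.symm q) (1, 0))
    rw [hinv1, hAB, hA0] at h3
    simp at h3
  have hsA : ContDiffAt ℝ ∞ (fun q => (fderiv ℝ φ.symm q (1, 0)).1) q :=
    (((hQs q hq).fderiv_right (m := ∞) (by simp)).clm_apply contDiffAt_const).fst
  refine ⟨hQs q hq, hq1.div hsA hA0, div_ne_zero hq0 hA0, ?_, fun w => ?_⟩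
  · exact ⟨ContinuousLinearEquiv.equivOfInverse _ _ hinv2 hinv1, rfl⟩
  · rw [hsplit w, hAB]
    field_simp

theorem exists_integratingFactor {F₁ F₂ : ℝ × ℝ → ℝ} {q₀ : ℝ × ℝ}
    (h₁ : ∀ᶠ q in 𝓝 q₀, ContDiffAt ℝ ∞ F₁ q) (h₂ : ∀ᶠ q in 𝓝 q₀, ContDiffAt ℝ ∞ F₂ q)
    (h0 : F₁ q₀ ≠ 0 ∨ F₂ q₀ ≠ 0) : ∃ (Y : ℝ × ℝ → ℝ × ℝ) (g : ℝ × ℝ → ℝ), ∀ᶠ q in 𝓝 q₀,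
      ContDiffAt ℝ ∞ Y q ∧ ContDiffAt ℝ ∞ g q ∧ g q ≠ 0 ∧ (fderiv ℝ Y q).IsInvertible ∧
      ∀ w : ℝ × ℝ, F₁ q * w.1 + F₂ q * w.2 = g q * (fderiv ℝ Y q w).1 := by
  rcases h0 with h0 | h0
  · exact exists_integratingFactor_of_left h₁ h₂ h0
  let S : (ℝ × ℝ) ≃L[ℝ] ℝ × ℝ := ContinuousLinearEquiv.prodComm ℝ ℝ ℝ
  have hS : ∀ q, S (S q) = q := fun q => rfl
  have ht1 : Filter.Tendsto S (𝓝 (S q₀)) (𝓝 q₀) := S.continuous.tendsto (S q₀)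
  have ht2 : Filter.Tendsto S (𝓝 q₀) (𝓝 (S q₀)) := S.continuous.tendsto q₀
  obtain ⟨Y, g, h⟩ := exists_integratingFactor_of_left (F₁ := fun q => F₂ (S q))
    (F₂ := fun q => F₁ (S q)) (q₀ := S q₀)
    ((ht1.eventually h₂).mono fun q hq => hq.comp q S.contDiff.contDiffAt)
    ((ht1.eventually h₁).mono fun q hq => hq.comp q S.contDiff.contDiffAt) h0
  refine ⟨fun q => Y (S q), fun q => g (S q), (ht2.eventually h).mono ?_⟩
  rintro q ⟨hY, hg, hg0, hYi, hw⟩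
  have hd : fderiv ℝ (fun q => Y (S q)) q = fderiv ℝ Y (S q) ∘L (S : ℝ × ℝ →L[ℝ] ℝ × ℝ) :=
    ((hY.differentiableAt (by simp)).hasFDerivAt.comp q S.hasFDerivAt).fderiv
  refine ⟨hY.comp q S.contDiff.contDiffAt, hg.comp q S.contDiff.contDiffAt, hg0, ?_, fun w => ?_⟩
  · rw [hd]
    exact hYi.comp ⟨S, rfl⟩
  · rw [hd, add_comm]
    exact hw (S w)

/-- A nonvanishing `1`-form in the plane is locally a positive multiple of a coordinate
differential. -/
theorem exists_pos_integratingFactor {F₁ F₂ : ℝ × ℝ → ℝ} {q₀ : ℝ × ℝ}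
    (h₁ : ∀ᶠ q in 𝓝 q₀, ContDiffAt ℝ ∞ F₁ q) (h₂ : ∀ᶠ q in 𝓝 q₀, ContDiffAt ℝ ∞ F₂ q)
    (h0 : F₁ q₀ ≠ 0 ∨ F₂ q₀ ≠ 0) : ∃ (Y : ℝ × ℝ → ℝ × ℝ) (g : ℝ × ℝ → ℝ), ∀ᶠ q in 𝓝 q₀,
      ContDiffAt ℝ ∞ Y q ∧ ContDiffAt ℝ ∞ g q ∧ 0 < g q ∧ (fderiv ℝ Y q).IsInvertible ∧
      ∀ w : ℝ × ℝ, F₁ q * w.1 + F₂ q * w.2 = g q * (fderiv ℝ Y q w).1 := by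
  obtain ⟨Y, g, h⟩ := exists_integratingFactor h₁ h₂ h0
  have hg := h.self_of_nhds.2.1.continuousAt
  rcases h.self_of_nhds.2.2.1.lt_or_gt with hneg | hpos
  -- Reversing the first coordinate changes the sign of the factor.
  · let S : (ℝ × ℝ) ≃L[ℝ] ℝ × ℝ :=
      (ContinuousLinearEquiv.neg ℝ).prodCongr (ContinuousLinearEquiv.refl ℝ ℝ)
    refine ⟨fun q => S (Y q), fun q => -g q, ?_⟩
    filter_upwards [h, hg.eventually (gt_mem_nhds hneg)]
    rintro q ⟨hY, hg, hg0, hYi, hw⟩ hq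
    have hd : fderiv ℝ (fun q => S (Y q)) q = (S : ℝ × ℝ →L[ℝ] ℝ × ℝ) ∘L fderiv ℝ Y q :=
      (S.hasFDerivAt.comp q (hY.differentiableAt (by simp)).hasFDerivAt).fderiv
    refine ⟨S.contDiff.contDiffAt.comp q hY, hg.neg, neg_pos.2 hq, ?_, fun w => ?_⟩
    · rw [hd]
      exact ContinuousLinearMap.IsInvertible.comp ⟨S, rfl⟩ hYi
    · rw [hd, hw]
      change _ = -g q * -(fderiv ℝ Y q w).1
      ring
  · refine ⟨Y, g, ?_⟩
    filter_upwards [h, hg.eventually (lt_mem_nhds hpos)]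
    rintro q ⟨hY, hg, hg0, hYi, hw⟩ hq
    exact ⟨hY, hg, hq, hYi, hw⟩

theorem exists_fderiv_snd_eq {F : ℝ × ℝ → ℝ} {q₀ : ℝ × ℝ}
    (hF : ∀ᶠ q in 𝓝 q₀, ContDiffAt ℝ ∞ F q) : ∃ Z : ℝ × ℝ → ℝ, ∀ᶠ q in 𝓝 q₀,
      ContDiffAt ℝ ∞ Z q ∧ fderiv ℝ Z q (0, 1) = F q := by
  obtain ⟨a, ha, hd, -⟩ := exists_transport (f := fun z : (ℝ × ℝ) × ℝ => F z.1)
    (g := fun _ => (0 : ℝ)) (q₀ := q₀) (e := (0, 1)) (ℓ := ContinuousLinearMap.snd ℝ ℝ ℝ) (by simp)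
    (((continuous_fst.tendsto (q₀, (0 : ℝ))).eventually hF).mono
      fun z hz => hz.comp z contDiffAt_fst)
    (Filter.Eventually.of_forall fun _ => contDiffAt_const)
  exact ⟨a, ha.and hd⟩

end PlaneForms

/-! ### Leafwise constant functions and projectable coordinate fields -/

section LeafwiseConstant

variable {E : Type*} [NormedAddCommGroup E] [NormedSpace ℝ E]
  {M : Type*} [TopologicalSpace M] [ChartedSpace E M]
  {V : TangentSubspaces E M} {Ψ : OpenPartialHomeomorph M ((ℝ × ℝ) × (ℝ × ℝ))}

/-- `f` is `C^∞` on `W` and its derivative vanishes along `V`. -/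
structure IsLeafwiseConstOn (V : TangentSubspaces E M) (W : Set M) (f : M → ℝ) : Prop where
  smooth : SmoothFunOn E W f
  dirDeriv_eq_zero : ∀ p ∈ W, ∀ u ∈ V p, dirDeriv f p u = 0

/-- A function that is constant along the leaves is locally a function on the leaf space. -/
theorem IsAdaptedChart.exists_descent (hΨ : IsAdaptedChart V Ψ) {W : Set M} (hW : IsOpen W)
    {f : M → ℝ} (hf : IsLeafwiseConstOn V W f) {x : M} (hx : x ∈ Ψ.source) (hxW : x ∈ W) :
    ∃ F : ℝ × ℝ → ℝ, (∀ᶠ q in 𝓝 (Ψ x).1, ContDiffAt ℝ ∞ F q) ∧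
      ∀ᶠ p in 𝓝 x, f p = F (Ψ p).1 := by
  have hWev : ∀ᶠ q in 𝓝 (Ψ x), q ∈ Ψ.target ∧ Ψ.symm q ∈ W := by
    refine Filter.Eventually.and (Ψ.open_target.mem_nhds (Ψ.map_source hx)) ?_
    refine (Ψ.continuousAt_symm (Ψ.map_source hx)).eventually (hW.mem_nhds ?_)
    rwa [Ψ.left_inv hx]
  obtain ⟨r, hr, hball⟩ := Metric.eventually_nhds_iff_ball.1 hWev
  let f' : (ℝ × ℝ) × (ℝ × ℝ) → ℝ := fun q => f (Ψ.symm q)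
  have hf' : ∀ q ∈ Metric.ball (Ψ x) r, ContDiffAt ℝ ∞ f' q := fun q hq =>
    hΨ.contDiffAt_symm hW hf.smooth (hball q hq).1 (hball q hq).2
  have hd : ∀ q ∈ Metric.ball (Ψ x) r, ∀ t : ℝ × ℝ, fderiv ℝ f' q (0, t) = 0 := by
    intro q hq t
    have hp : Ψ.symm q ∈ Ψ.source := Ψ.map_target (hball q hq).1
    have h1 : DifferentiableAt ℝ f' (Ψ (Ψ.symm q)) := by
      rw [Ψ.right_inv (hball q hq).1]
      exact (hf' q hq).differentiableAt (by simp)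
    have h2 := hΨ.dirDeriv_comp_coordField hp h1 (0, t)
    rw [Ψ.right_inv (hball q hq).1] at h2
    rw [← h2, dirDeriv_congr_of_isOpen Ψ.open_source hp (g := f) (fun p hp => by
      simp only [f', Ψ.left_inv hp])]
    refine hf.dirDeriv_eq_zero _ (hball q hq).2 _ ?_
    rw [hΨ.mem_iff _ hp, hΨ.mfderiv_coordField hp]
  -- In the sup metric a ball is a product of balls. The slices along the leaves are thus convex,
  -- and vanishing leafwise derivatives make the function constant on each of them.
  have hbp : ∀ q : (ℝ × ℝ) × (ℝ × ℝ), q ∈ Metric.ball (Ψ x) r ↔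
      q.1 ∈ Metric.ball (Ψ x).1 r ∧ q.2 ∈ Metric.ball (Ψ x).2 r := by
    intro q
    rw [← Prod.mk.eta (p := Ψ x), ← ball_prod_same]
    rfl
  refine ⟨fun y => f' (y, (Ψ x).2), ?_, ?_⟩
  · filter_upwards [Metric.ball_mem_nhds _ hr] with y hy
    exact ContDiffAt.comp (g := f') y (hf' _ ((hbp (y, (Ψ x).2)).2 ⟨hy, Metric.mem_ball_self hr⟩))
      (contDiffAt_id.prodMk contDiffAt_const)
  · have hev : ∀ᶠ p in 𝓝 x, Ψ p ∈ Metric.ball (Ψ x) r :=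
      (Ψ.continuousAt hx).eventually (Metric.ball_mem_nhds _ hr)
    filter_upwards [hev, Ψ.open_source.mem_nhds hx] with p hp hps
    have hp' := (hbp _).1 hp
    have hdt : ∀ t ∈ Metric.ball (Ψ x).2 r, HasFDerivAt (fun t => f' ((Ψ p).1, t))
        (fderiv ℝ f' ((Ψ p).1, t) ∘L ContinuousLinearMap.inr ℝ (ℝ × ℝ) (ℝ × ℝ)) t := by
      intro t ht
      refine (((hf' _ ((hbp ((Ψ p).1, t)).2 ⟨hp'.1, ht⟩)).differentiableAt
        (by simp)).hasFDerivAt).comp t (hasFDerivAt_prodMk_right _ _)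
    have hconst := Metric.isOpen_ball.is_const_of_fderiv_eq_zero
      (convex_ball _ _).isPreconnected
      (fun t ht => (hdt t ht).differentiableAt.differentiableWithinAt)
      (fun t ht => by
        rw [(hdt t ht).fderiv]
        exact ContinuousLinearMap.ext fun s => hd _ ((hbp ((Ψ p).1, t)).2 ⟨hp'.1, ht⟩) s)
      hp'.2 (Metric.mem_ball_self hr)
    have h3 : f p = f' ((Ψ p).1, (Ψ p).2) := by
      simp only [f', Prod.mk.eta, Ψ.left_inv hps]
    exact h3.trans hconst

variable [IsManifold 𝓘(ℝ, E) ∞ M] {D : Sec V → Sec V → Sec V}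

theorem IsParallelWithin.add (hD : IsFlatTorsionFree V D) {W : Set M} {u v : Sec V}
    (hu : IsParallelWithin D W u) (hv : IsParallelWithin D W v) :
    IsParallelWithin D W (fun x => u x + v x) := by
  intro U hU hUW
  have h1 := hu U hU hUW
  have h2 := hv U hU hUW
  refine ⟨h1.1.add h2.1, fun w hw x hx => ?_⟩
  rw [hD.add_right U hU w u v hw h1.1 h2.1 x hx, h1.2 w hw x hx, h2.2 w hw x hx, add_zero]

/-- The derivative term of the Leibniz rule vanishes. This is what allows parallel frames to be
rescaled by functions on the leaf space. -/
theorem IsParallelWithin.smul (hD : IsFlatTorsionFree V D) {W : Set M} {f : M → ℝ} {v : Sec V}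
    (hf : IsLeafwiseConstOn V W f) (hv : IsParallelWithin D W v) :
    IsParallelWithin D W (fun x => f x • v x) := by
  intro U hU hUW
  have h2 := hv U hU hUW
  refine ⟨h2.1.smul (hf.smooth.mono hUW), fun w hw x hx => ?_⟩
  rw [hD.leibniz U hU f w v (hf.smooth.mono hUW) hw h2.1 x hx, h2.2 w hw x hx,
    hf.dirDeriv_eq_zero x (hUW hx) _ (w x).2, smul_zero, zero_smul, add_zero]

/-- The leaf-space coordinates have constant derivatives along a coordinate field and zero
derivatives along sections of V, so the bracket of the two annihilates them. These fields are the
`w` to be inserted in the equations for h and β. -/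
theorem IsAdaptedChart.isProjectableOn_coordField [CompleteSpace E] (hΨ : IsAdaptedChart V Ψ)
    {U : Set M} (hU : IsOpen U) (hUΨ : U ⊆ Ψ.source) (g : (ℝ × ℝ) × (ℝ × ℝ)) :
    IsProjectableOn V U (coordField Ψ g) := by
  have hg := (hΨ.smooth_coordField g).mono hUΨ
  refine ⟨hg, fun v hv p hp => ?_⟩
  rw [hΨ.mem_iff p (hUΨ hp)]
  have hl : ∀ L : ℝ × ℝ →L[ℝ] ℝ, L (mfderiv 𝓘(ℝ, E) 𝓘(ℝ, (ℝ × ℝ) × (ℝ × ℝ)) Ψ p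
      (VectorField.mlieBracket 𝓘(ℝ, E) (coordField Ψ g) v.toField p) :
        (ℝ × ℝ) × (ℝ × ℝ)).1 = 0 := by
    intro L
    let L' : (ℝ × ℝ) × (ℝ × ℝ) →L[ℝ] ℝ := L ∘L ContinuousLinearMap.fst ℝ _ _
    have h1 : ∀ p ∈ U, dirDeriv (fun p => L' (Ψ p)) p (coordField (E := E) Ψ g p) = L' g := by
      intro p hp
      rw [dirDeriv_clm_comp L' (hΨ.mdifferentiableAt (hUΨ hp)), hΨ.mfderiv_coordField (hUΨ hp)]
    have h2 : ∀ p ∈ U, dirDeriv (fun p => L' (Ψ p)) p (v p).1 = 0 := by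
      intro p hp
      rw [dirDeriv_clm_comp L' (hΨ.mdifferentiableAt (hUΨ hp))]
      exact (congrArg L ((hΨ.mem_iff p (hUΨ hp) _).1 (v p).2)).trans (map_zero L)
    refine (dirDeriv_clm_comp L' (hΨ.mdifferentiableAt (hUΨ hp)) _).symm.trans ?_
    rw [dirDeriv_mlieBracket hU
      (hΨ.smooth_comp hUΨ fun p _ => L'.contDiff.contDiffAt) hg hv hp,
      dirDeriv_congr_of_isOpen hU hp h1, dirDeriv_congr_of_isOpen hU hp h2, dirDeriv_const,
      dirDeriv_const, sub_zero]
  exact Prod.ext (hl (ContinuousLinearMap.fst ℝ ℝ ℝ)) (hl (ContinuousLinearMap.snd ℝ ℝ ℝ))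

end LeafwiseConstant

/-! ### Submersions defining the foliation -/

section Submersions

variable {E : Type*} [NormedAddCommGroup E] [NormedSpace ℝ E]
  {M : Type*} [TopologicalSpace M] [ChartedSpace E M]
  {V : TangentSubspaces E M}

theorem IsSubmersionOn.mdifferentiableAt {U : Set M} (hU : IsOpen U) {y : M → ℝ × ℝ}
    (hy : IsSubmersionOn V U y) {p : M} (hp : p ∈ U) :
    MDifferentiableAt 𝓘(ℝ, E) 𝓘(ℝ, ℝ × ℝ) y p :=
  (hy.smooth.contMDiffAt (hU.mem_nhds hp)).mdifferentiableAt (by simp)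

theorem IsSubmersionOn.isLeafwiseConstOn_comp {U : Set M} (hU : IsOpen U) {y : M → ℝ × ℝ}
    (hy : IsSubmersionOn V U y) {F : ℝ × ℝ → ℝ} (hF : ∀ p ∈ U, ContDiffAt ℝ ∞ F (y p)) :
    IsLeafwiseConstOn V U (fun p => F (y p)) := by
  refine ⟨SmoothFunOn.comp_contDiffAt hF hy.smooth, fun p hp u hu => ?_⟩
  rw [dirDeriv_comp ((hF p hp).differentiableAt (by simp)) (hy.mdifferentiableAt hU hp),
    (hy.mem_iff p hp u).1 hu]
  exact map_zero _

theorem IsSubmersionOn.mfderiv_comp {U : Set M} (hU : IsOpen U) {y : M → ℝ × ℝ}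
    (hy : IsSubmersionOn V U y) {Y : ℝ × ℝ → ℝ × ℝ} {p : M} (hp : p ∈ U)
    (hY : ContDiffAt ℝ ∞ Y (y p)) (w : TangentSpace 𝓘(ℝ, E) p) :
    mfderiv 𝓘(ℝ, E) 𝓘(ℝ, ℝ × ℝ) (fun p => Y (y p)) p w =
      fderiv ℝ Y (y p) (mfderiv 𝓘(ℝ, E) 𝓘(ℝ, ℝ × ℝ) y p w) := by
  have h := mfderiv_comp_apply (I := 𝓘(ℝ, E)) (I' := 𝓘(ℝ, ℝ × ℝ)) (I'' := 𝓘(ℝ, ℝ × ℝ)) p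
    (hY.differentiableAt (by simp)).mdifferentiableAt (hy.mdifferentiableAt hU hp) w
  refine h.trans ?_
  rw [mfderiv_eq_fderiv]
  rfl

theorem IsSubmersionOn.comp {U : Set M} (hU : IsOpen U) {y : M → ℝ × ℝ}
    (hy : IsSubmersionOn V U y) {Y : ℝ × ℝ → ℝ × ℝ} (hY : ∀ p ∈ U, ContDiffAt ℝ ∞ Y (y p))
    (hY' : ∀ p ∈ U, (fderiv ℝ Y (y p)).IsInvertible) :
    IsSubmersionOn V U (fun p => Y (y p)) := by
  refine ⟨fun p hp => (hY p hp).contMDiffAt.comp_contMDiffWithinAt p (hy.smooth p hp),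
    fun p hp q => ?_, fun p hp w => ?_⟩
  · obtain ⟨L, hL⟩ := hY' p hp
    obtain ⟨w, hw⟩ := hy.surjective p hp (L.symm q)
    refine ⟨w, ?_⟩
    rw [hy.mfderiv_comp hU hp (hY p hp), hw, ← hL]
    exact L.apply_symm_apply q
  · obtain ⟨L, hL⟩ := hY' p hp
    rw [hy.mem_iff p hp, hy.mfderiv_comp hU hp (hY p hp), ← hL]
    exact (L.map_eq_zero_iff (x := mfderiv 𝓘(ℝ, E) 𝓘(ℝ, ℝ × ℝ) y p w)).symm

theorem IsAdaptedChart.mfderiv_fst {Ψ : OpenPartialHomeomorph M ((ℝ × ℝ) × (ℝ × ℝ))}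
    (hΨ : IsAdaptedChart V Ψ) {p : M} (hp : p ∈ Ψ.source) (w : TangentSpace 𝓘(ℝ, E) p) :
    mfderiv 𝓘(ℝ, E) 𝓘(ℝ, ℝ × ℝ) (fun p => (Ψ p).1) p w =
      (mfderiv 𝓘(ℝ, E) 𝓘(ℝ, (ℝ × ℝ) × (ℝ × ℝ)) Ψ p w : (ℝ × ℝ) × (ℝ × ℝ)).1 :=
  mfderiv_clm_comp_apply (ContinuousLinearMap.fst ℝ (ℝ × ℝ) (ℝ × ℝ)) (hΨ.mdifferentiableAt hp) w

theorem IsAdaptedChart.isSubmersionOn {Ψ : OpenPartialHomeomorph M ((ℝ × ℝ) × (ℝ × ℝ))}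
    (hΨ : IsAdaptedChart V Ψ) : IsSubmersionOn V Ψ.source (fun p => (Ψ p).1) := by
  refine ⟨(ContinuousLinearMap.fst ℝ (ℝ × ℝ) (ℝ × ℝ)).contMDiff.comp_contMDiffOn hΨ.smooth,
    fun p hp q => ?_, fun p hp w => ?_⟩
  · refine ⟨coordField Ψ (q, 0) p, ?_⟩
    rw [hΨ.mfderiv_fst hp, hΨ.mfderiv_coordField hp]
  · rw [hΨ.mem_iff p hp, hΨ.mfderiv_fst hp]
    rfl

/-- A linear functional vanishing on `V`, in terms of the components of a vector in an adapted
chart. -/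
theorem IsAdaptedChart.apply_eq {Ψ : OpenPartialHomeomorph M ((ℝ × ℝ) × (ℝ × ℝ))}
    (hΨ : IsAdaptedChart V Ψ) {p : M} (hp : p ∈ Ψ.source) (f : TangentSpace 𝓘(ℝ, E) p →ₗ[ℝ] ℝ)
    (hf : ∀ w ∈ V p, f w = 0) (w : TangentSpace 𝓘(ℝ, E) p) :
    f w = (mfderiv 𝓘(ℝ, E) 𝓘(ℝ, (ℝ × ℝ) × (ℝ × ℝ)) Ψ p w : (ℝ × ℝ) × (ℝ × ℝ)).1.1 *
        f (coordField Ψ ((1, 0), 0) p) +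
      (mfderiv 𝓘(ℝ, E) 𝓘(ℝ, (ℝ × ℝ) × (ℝ × ℝ)) Ψ p w : (ℝ × ℝ) × (ℝ × ℝ)).1.2 *
        f (coordField Ψ ((0, 1), 0) p) := by
  let L : TangentSpace 𝓘(ℝ, E) p →L[ℝ] (ℝ × ℝ) × (ℝ × ℝ) :=
    mfderiv 𝓘(ℝ, E) 𝓘(ℝ, (ℝ × ℝ) × (ℝ × ℝ)) Ψ p
  have hL : ∀ g, L (coordField Ψ g p) = g := fun g => hΨ.mfderiv_coordField hp g
  change f w = (L w).1.1 * _ + (L w).1.2 * _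
  have h : w - ((L w).1.1 • coordField Ψ ((1, 0), 0) p + (L w).1.2 • coordField Ψ ((0, 1), 0) p) ∈
      V p := by
    rw [hΨ.mem_iff p hp]
    change (L _).1 = 0
    rw [map_sub, map_add, map_smul, map_smul, hL, hL]
    ext <;> simp
  have h1 := hf _ h
  rw [map_sub, map_add, map_smul, map_smul, smul_eq_mul, smul_eq_mul] at h1
  exact sub_eq_zero.1 h1

end Submersions

/-! ### Pointwise algebra of a basic octuple, and a parallel frame adapted to α -/

section Octuple

variable {E : Type*} [NormedAddCommGroup E] [NormedSpace ℝ E]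
  {M : Type*} [TopologicalSpace M] [ChartedSpace E M] [IsManifold 𝓘(ℝ, E) ∞ M]
  {O : OctupleData E M}

namespace OctupleData.IsBasic

/-- The map w ↦ h(·, w) has the two-dimensional kernel V x in a four-dimensional space, so it is
onto the dual of V x. Hence h is nondegenerate in its first argument. -/
theorem eq_zero_of_h_eq_zero (hO : O.IsBasic) {x : M} {z : O.V x} (hz : ∀ w, O.h x z w = 0) :
    z = 0 := by
  have hfin : FiniteDimensional ℝ E := Module.finite_of_finrank_eq_succ hO.dim_eq
  have hfin' : FiniteDimensional ℝ (TangentSpace 𝓘(ℝ, E) x) := hfin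
  have hker : LinearMap.ker (O.h x).flip = O.V x := by
    ext w
    rw [LinearMap.mem_ker, ← hO.isPartialMetric.kernel x w]
    exact ⟨fun h v => congrArg (fun L : O.V x →ₗ[ℝ] ℝ => L v) h, fun h => LinearMap.ext h⟩
  have h1 := LinearMap.finrank_range_add_finrank_ker (O.h x).flip
  have h4 : Module.finrank ℝ (TangentSpace 𝓘(ℝ, E) x) = 4 := hO.dim_eq
  have h2 : Module.finrank ℝ (O.V x) = 2 := hO.isPlaneDistribution.finrank_eq x
  rw [hker, h2, h4] at h1
  have h5 : Module.finrank ℝ (O.V x →ₗ[ℝ] ℝ) = 2 := (Subspace.dual_finrank_eq (K := ℝ)).trans h2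
  have htop : LinearMap.range (O.h x).flip = ⊤ :=
    Submodule.eq_top_of_finrank_eq (by rw [h5]; omega)
  rw [← Module.forall_dual_apply_eq_zero_iff ℝ z]
  intro f
  obtain ⟨w, hw⟩ := LinearMap.range_eq_top.1 htop f
  rw [← hw]
  exact hz w

/-- For w in V = Ker ζ one has ζw = 0, and so 2β(w) = α(ζw) = 0. -/
theorem β_eq_zero (hO : O.IsBasic) {x : M} {w : TangentSpace 𝓘(ℝ, E) x} (hw : w ∈ O.V x) :
    O.β x w = 0 := by
  obtain ⟨z, hz, -, hα⟩ := hO.sharp x w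
  have hz0 : z = 0 := hO.eq_zero_of_h_eq_zero fun w' => by
    rw [hO.ker_ζ x, LinearMap.mem_ker] at hw
    rw [hz, hw]
    rfl
  rw [hz0, map_zero] at hα
  linarith

theorem h_eq_zero (hO : O.IsBasic) {x : M} (v : O.V x) {w : TangentSpace 𝓘(ℝ, E) x}
    (hw : w ∈ O.V x) : O.h x v w = 0 := (hO.isPartialMetric.kernel x w).2 hw v

/-- By 2β(w) = α(ζw), a zero of α would be a zero of β. -/
theorem α_ne_zero (hO : O.IsBasic) (x : M) : O.α x ≠ 0 := by
  intro h0
  refine hO.β_ne_zero x (LinearMap.ext fun w => ?_)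
  obtain ⟨z, -, -, hα⟩ := hO.sharp x w
  rw [h0, LinearMap.zero_apply] at hα
  rw [LinearMap.zero_apply]
  linarith

theorem exists_notMem (hO : O.IsBasic) (x : M) : ∃ w, w ∉ O.V x := by
  obtain ⟨w, hw⟩ := DFunLike.ne_iff.1 (hO.β_ne_zero x)
  exact ⟨w, fun h => hw (hO.β_eq_zero h)⟩

theorem θ_swap (hO : O.IsBasic) {x : M} (u v : O.V x) : O.θ x v u = -O.θ x u v :=
  ((hO.θ_alt x).neg u v).symm

/-- If θ vanished at x, then 2h(v, w) = θ(v, ζw) = 0 for all w, although some w lies outside the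
kernel V of h. -/
theorem θ_ne_zero (hO : O.IsBasic) {x : M} {e₁ e₂ : O.V x}
    (hspan : ∀ v : O.V x, ∃ a b : ℝ, v = a • e₁ + b • e₂) : O.θ x e₁ e₂ ≠ 0 := by
  intro h0
  obtain ⟨w, hw⟩ := hO.exists_notMem x
  refine hw ((hO.isPartialMetric.kernel x w).1 fun v => ?_)
  obtain ⟨z, -, hθ, -⟩ := hO.sharp x w
  have h1 := hθ v
  obtain ⟨a, b, rfl⟩ := hspan v
  obtain ⟨c, d, rfl⟩ := hspan z
  have h2 := hO.θ_alt x e₁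
  have h3 := hO.θ_alt x e₂
  have h4 := hO.θ_swap e₁ e₂
  simp only [map_add, map_smul, LinearMap.add_apply, LinearMap.smul_apply, smul_eq_mul, h2, h3, h4,
    h0] at h1 ⊢
  linarith

end OctupleData.IsBasic

/-- A frame of `V` on `W` consisting of parallel sections, the second of which spans the kernel
of `α`. -/
structure OctupleData.IsFrameOn (O : OctupleData E M) (W : Set M) (e₁ e₂ : Sec O.V) : Prop where
  parallel₁ : IsParallelWithin O.D W e₁
  parallel₂ : IsParallelWithin O.D W e₂
  span : ∀ p ∈ W, ∀ v : O.V p, ∃ a b : ℝ, v = a • e₁ p + b • e₂ p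
  α₁ : ∀ p ∈ W, O.α p (e₁ p) ≠ 0
  α₂ : ∀ p ∈ W, O.α p (e₂ p) = 0

theorem isLeafwiseConstOn_of_span {V : TangentSubspaces E M} {W : Set M} {e₁ e₂ : Sec V}
    (hspan : ∀ p ∈ W, ∀ v : V p, ∃ a b : ℝ, v = a • e₁ p + b • e₂ p) {f : M → ℝ}
    (hf : SmoothFunOn E W f) (h₁ : ∀ p ∈ W, dirDeriv f p (e₁ p).1 = 0)
    (h₂ : ∀ p ∈ W, dirDeriv f p (e₂ p).1 = 0) : IsLeafwiseConstOn V W f := by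
  refine ⟨hf, fun p hp u hu => ?_⟩
  obtain ⟨a, b, hab⟩ := hspan p hp ⟨u, hu⟩
  have h := congrArg Subtype.val hab
  change u = a • (e₁ p).1 + b • (e₂ p).1 at h
  rw [h, dirDeriv_add_right, dirDeriv_smul_right, dirDeriv_smul_right, h₁ p hp, h₂ p hp]
  ring

variable [CompleteSpace E]

/-- For parallel e and e', both α(e) and α(e') have the logarithmic derivative α(u), so the ratio r
= α(e')/α(e) is leafwise constant. Then e' - r e is again parallel, and α annihilates it. -/
theorem OctupleData.IsBasic.exists_isFrameOn (hO : O.IsBasic)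
    {Ψ : OpenPartialHomeomorph M ((ℝ × ℝ) × (ℝ × ℝ))} (hΨ : IsAdaptedChart O.V Ψ) {x : M}
    (hx : x ∈ Ψ.source) : ∃ W : Set M, IsOpen W ∧ x ∈ W ∧ W ⊆ Ψ.source ∧
      ∃ e₁ e₂ : Sec O.V, O.IsFrameOn W e₁ e₂ := by
  have hD := hO.isFlatTorsionFree
  -- a parallel frame, the first section of which is not annihilated by `α` at `x`
  obtain ⟨W, hW, hxW, hWΨ, e, e', he, he', hdet, hα⟩ : ∃ W : Set M, IsOpen W ∧ x ∈ W ∧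
      W ⊆ Ψ.source ∧ ∃ e e' : Sec O.V, IsParallelWithin O.D W e ∧ IsParallelWithin O.D W e' ∧
      (vertComp Ψ x (e x)).1 * (vertComp Ψ x (e' x)).2 -
        (vertComp Ψ x (e x)).2 * (vertComp Ψ x (e' x)).1 ≠ 0 ∧ O.α x (e x) ≠ 0 := by
    obtain ⟨W₁, hW₁, hx₁, hΨ₁, f₁, hf₁, hfx₁⟩ := hΨ.exists_isParallelWithin hD hx
      (coordSec O.V Ψ (1, 0) x)
    obtain ⟨W₂, hW₂, hx₂, hΨ₂, f₂, hf₂, hfx₂⟩ := hΨ.exists_isParallelWithin hD hx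
      (coordSec O.V Ψ (0, 1) x)
    have hor : O.α x (f₁ x) ≠ 0 ∨ O.α x (f₂ x) ≠ 0 := by
      by_contra! h
      refine hO.α_ne_zero x (LinearMap.ext fun v => ?_)
      have hv : v = (vertComp Ψ x v).1 • f₁ x + (vertComp Ψ x v).2 • f₂ x := by
        refine hΨ.eq_of_vertComp_eq hx ?_
        rw [hfx₁, hfx₂, vertComp_add, vertComp_smul, vertComp_smul, hΨ.vertComp_coordSec hx,
          hΨ.vertComp_coordSec hx]
        simp
      rw [hv, map_add, map_smul, map_smul, h.1, h.2]
      simp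
    have hsub₁ : W₁ ∩ W₂ ⊆ W₁ := Set.inter_subset_left
    have hsub₂ : W₁ ∩ W₂ ⊆ W₂ := Set.inter_subset_right
    rcases hor with h | h
    · refine ⟨W₁ ∩ W₂, hW₁.inter hW₂, ⟨hx₁, hx₂⟩, hsub₁.trans hΨ₁, f₁, f₂, hf₁.mono hsub₁,
        hf₂.mono hsub₂, ?_, h⟩
      rw [hfx₁, hfx₂, hΨ.vertComp_coordSec hx, hΨ.vertComp_coordSec hx]
      simp
    · refine ⟨W₁ ∩ W₂, hW₁.inter hW₂, ⟨hx₁, hx₂⟩, hsub₁.trans hΨ₁, f₂, f₁, hf₂.mono hsub₂,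
        hf₁.mono hsub₁, ?_, h⟩
      rw [hfx₁, hfx₂, hΨ.vertComp_coordSec hx, hΨ.vertComp_coordSec hx]
      simp
  have hes := (he W hW subset_rfl).1
  have hes' := (he' W hW subset_rfl).1
  have hc := (hΨ.contMDiffOn_vertComp hW hWΨ hes).continuousOn.continuousAt (hW.mem_nhds hxW)
  have hc' := (hΨ.contMDiffOn_vertComp hW hWΨ hes').continuousOn.continuousAt (hW.mem_nhds hxW)
  -- Independence of the frame and nonvanishing of α on its first section are open conditions.
  have ev₁ := ((hc.fst.mul hc'.snd).sub (hc.snd.mul hc'.fst)).eventually_ne hdet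
  have ev₂ := ((hO.α_smooth W hW e hes).continuousOn.continuousAt
    (hW.mem_nhds hxW)).eventually_ne hα
  obtain ⟨t, ht, hto, hxt⟩ := eventually_nhds_iff.1 (ev₁.and ev₂)
  have hU : IsOpen (W ∩ t) := hW.inter hto
  have hUW : W ∩ t ⊆ W := Set.inter_subset_left
  have hspan : ∀ p ∈ W ∩ t, ∀ v : O.V p, ∃ a b : ℝ, v = a • e p + b • e' p := by
    intro p hp v
    have hd : (vertComp Ψ p (e p)).1 * (vertComp Ψ p (e' p)).2 -
        (vertComp Ψ p (e p)).2 * (vertComp Ψ p (e' p)).1 ≠ 0 := (ht p hp.2).1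
    set q := vertComp Ψ p (e p) with hq
    set q' := vertComp Ψ p (e' p) with hq'
    set c := vertComp Ψ p v with hc
    -- Cramer's rule.
    refine ⟨(c.1 * q'.2 - c.2 * q'.1) / (q.1 * q'.2 - q.2 * q'.1),
      (q.1 * c.2 - q.2 * c.1) / (q.1 * q'.2 - q.2 * q'.1),
      hΨ.eq_of_vertComp_eq (hWΨ hp.1) ?_⟩
    rw [vertComp_add, vertComp_smul, vertComp_smul, ← hq, ← hq', ← hc]
    ext
    · simp only [Prod.fst_add, Prod.smul_fst, smul_eq_mul]
      rw [div_mul_eq_mul_div, div_mul_eq_mul_div, ← add_div, eq_div_iff hd]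
      ring
    · simp only [Prod.snd_add, Prod.smul_snd, smul_eq_mul]
      rw [div_mul_eq_mul_div, div_mul_eq_mul_div, ← add_div, eq_div_iff hd]
      ring
  have heU := he.mono hUW
  have heU' := he'.mono hUW
  have hp₁ := heU _ hU subset_rfl
  have hp₂ := heU' _ hU subset_rfl
  have ha := hO.α_smooth _ hU e hp₁.1
  have ha' := hO.α_smooth _ hU e' hp₂.1
  have hne : ∀ p ∈ W ∩ t, O.α p (e p) ≠ 0 := fun p hp => (ht p hp.2).2
  have hd : ∀ u : Sec O.V, IsParallelOn O.D (W ∩ t) u → ∀ p ∈ W ∩ t,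
      dirDeriv (fun p => -(O.α p (e' p) * (O.α p (e p))⁻¹)) p (u p).1 = 0 := by
    intro u hu p hp
    have h1 := ha.mdifferentiableAt hU hp
    have h2 := ha'.mdifferentiableAt hU hp
    have h3 := (ha.inv hne).mdifferentiableAt hU hp
    rw [dirDeriv_neg ((ha'.mul (ha.inv hne)).mdifferentiableAt hU hp), dirDeriv_mul h2 h3,
      dirDeriv_inv h1 (hne p hp), hO.dα _ hU u e hu hp₁ p hp, hO.dα _ hU u e' hu hp₂ p hp]
    have := hne p hp
    field_simp
    ring
  have hr : IsLeafwiseConstOn O.V (W ∩ t) (fun p => -(O.α p (e' p) * (O.α p (e p))⁻¹)) :=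
    isLeafwiseConstOn_of_span hspan (ha'.mul (ha.inv hne)).neg (hd e hp₁) (hd e' hp₂)
  refine ⟨W ∩ t, hU, ⟨hxW, hxt⟩, hUW.trans hWΨ, e, _, heU, heU'.add hD (heU.smul hD hr), ?_, hne,
    fun p hp => ?_⟩
  · intro p hp v
    obtain ⟨a, b, hab⟩ := hspan p hp v
    refine ⟨a + b * (O.α p (e' p) * (O.α p (e p))⁻¹), b, ?_⟩
    rw [hab]
    module
  · have := hne p hp
    rw [map_add, map_smul, smul_eq_mul]
    field_simp
    ring

end Octuple

/-! ### Normalization of β; the standard form -/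

section Normalization

variable {E : Type*} [NormedAddCommGroup E] [NormedSpace ℝ E]
  {M : Type*} [TopologicalSpace M] [ChartedSpace E M] [IsManifold 𝓘(ℝ, E) ∞ M]
  {O : OctupleData E M}

/-- With a = α(e₁), both a² and β(w), for projectable w, have the logarithmic derivative 2α(u), so
β/a² is the pullback of a nonvanishing 1-form g dy₁ on the leaf space. The function y₁ becomes the
first coordinate, and g disappears into a² on rescaling e₁. -/
theorem OctupleData.IsBasic.exists_normalized_frame [CompleteSpace E] (hO : O.IsBasic) (x : M) :
    ∃ Ψ : OpenPartialHomeomorph M ((ℝ × ℝ) × (ℝ × ℝ)), x ∈ Ψ.source ∧ IsAdaptedChart O.V Ψ ∧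
      ∃ e₁ e₂ : Sec O.V, O.IsFrameOn Ψ.source e₁ e₂ ∧
        ∀ p ∈ Ψ.source, ∀ w : TangentSpace 𝓘(ℝ, E) p, O.β p w = O.α p (e₁ p) ^ 2 *
          (mfderiv 𝓘(ℝ, E) 𝓘(ℝ, (ℝ × ℝ) × (ℝ × ℝ)) Ψ p w : (ℝ × ℝ) × (ℝ × ℝ)).1.1 := by
  obtain ⟨U₀, hU₀, hxU₀, π, hπ, hπ'⟩ := hO.isIntegrable x
  obtain ⟨Ψ, hxΨ, -, hΨ, -⟩ := exists_isAdaptedChart (V := O.V) hO.dim_eq hU₀ hxU₀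
    (y := π) ⟨hπ, fun p hp => (hπ' p hp).1, fun p hp => (hπ' p hp).2⟩
  obtain ⟨W, hW, hxW, hWΨ, e₁, e₂, he⟩ := hO.exists_isFrameOn hΨ hxΨ
  have hp₁ := he.parallel₁ W hW subset_rfl
  have hp₂ := he.parallel₂ W hW subset_rfl
  have ha := hO.α_smooth W hW e₁ hp₁.1
  have hne : ∀ p ∈ W, O.α p (e₁ p) * O.α p (e₁ p) ≠ 0 := fun p hp =>
    mul_ne_zero (he.α₁ p hp) (he.α₁ p hp)
  have hb : ∀ c, IsLeafwiseConstOn O.V W (fun p => O.β p (coordField Ψ (c, 0) p) *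
      (O.α p (e₁ p) * O.α p (e₁ p))⁻¹) := by
    intro c
    have hc := hΨ.isProjectableOn_coordField hW hWΨ (c, 0)
    have hs := hO.β_smooth W hW _ hc.1
    have hd : ∀ u : Sec O.V, IsParallelOn O.D W u → ∀ p ∈ W,
        dirDeriv (fun p => O.β p (coordField Ψ (c, 0) p) *
          (O.α p (e₁ p) * O.α p (e₁ p))⁻¹) p (u p).1 = 0 := by
      intro u hu p hp
      have h1 := ha.mdifferentiableAt hW hp
      rw [dirDeriv_mul (hs.mdifferentiableAt hW hp)
        (((ha.mul ha).inv hne).mdifferentiableAt hW hp),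
        dirDeriv_inv ((ha.mul ha).mdifferentiableAt hW hp) (hne p hp), dirDeriv_mul h1 h1,
        hO.dα W hW u e₁ hu hp₁ p hp, hO.dβ W hW u _ hu hc p hp]
      have := he.α₁ p hp
      field_simp
      ring
    exact isLeafwiseConstOn_of_span he.span (hs.mul ((ha.mul ha).inv hne)) (hd e₁ hp₁) (hd e₂ hp₂)
  have hβ : ∀ p ∈ Ψ.source, ∀ w : TangentSpace 𝓘(ℝ, E) p, _ := fun p hp w =>
    hΨ.apply_eq hp (O.β p) (fun w hw => hO.β_eq_zero hw) w
  obtain ⟨F₁, hF₁, hbF₁⟩ := hΨ.exists_descent hW (hb (1, 0)) hxΨ hxW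
  obtain ⟨F₂, hF₂, hbF₂⟩ := hΨ.exists_descent hW (hb (0, 1)) hxΨ hxW
  -- Both coefficients cannot vanish at x: as β annihilates V, they determine it, and β x would be
  -- zero.
  obtain ⟨Y, g, hYg⟩ := exists_pos_integratingFactor hF₁ hF₂ (by
    by_contra! h
    refine hO.β_ne_zero x (LinearMap.ext fun w => ?_)
    have h1 := hbF₁.self_of_nhds
    have h2 := hbF₂.self_of_nhds
    simp only [h.1, h.2, mul_eq_zero, inv_eq_zero, hne x hxW, or_false] at h1 h2
    rw [hβ x hxΨ, h1, h2]
    simp)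
  have hct : Filter.Tendsto (fun p => (Ψ p).1) (𝓝 x) (𝓝 (Ψ x).1) := (Ψ.continuousAt hxΨ).fst
  obtain ⟨t, ht, hto, hxt⟩ := eventually_nhds_iff.1 (hbF₁.and (hbF₂.and (hct.eventually hYg)))
  have hU : IsOpen (W ∩ t) := hW.inter hto
  have hUW : W ∩ t ⊆ W := Set.inter_subset_left
  have hsub := hΨ.isSubmersionOn.mono (hUW.trans hWΨ)
  have hy := hsub.comp hU (Y := Y) (fun p hp => (ht p hp.2).2.2.1)
    (fun p hp => (ht p hp.2).2.2.2.2.2.1)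
  -- Replacing e₁ by √g e₁ multiplies α(e₁)² by g. Positivity of g makes the root real, smooth and
  -- nonzero, and its leafwise constancy keeps e₁ parallel.
  have hg := hsub.isLeafwiseConstOn_comp hU (F := fun q => Real.sqrt (g q)) (fun p hp =>
    (ht p hp.2).2.2.2.1.sqrt (ht p hp.2).2.2.2.2.1.ne')
  obtain ⟨Ψ', hxΨ', hΨU, hΨ', hΨY⟩ := exists_isAdaptedChart hO.dim_eq hU ⟨hxW, hxt⟩ hy
  have hpos : ∀ p ∈ W ∩ t, 0 < g (Ψ p).1 := fun p hp => (ht p hp.2).2.2.2.2.1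
  refine ⟨Ψ', hxΨ', hΨ', fun p => Real.sqrt (g (Ψ p).1) • e₁ p, e₂, ⟨?_, ?_, ?_, ?_, ?_⟩, ?_⟩
  · exact (IsParallelWithin.smul hO.isFlatTorsionFree hg (he.parallel₁.mono hUW)).mono hΨU
  · exact he.parallel₂.mono (hΨU.trans hUW)
  · intro p hp v
    have h1 := hpos p (hΨU hp)
    have h2 := (Real.sqrt_pos.2 h1).ne'
    obtain ⟨a, b, hab⟩ := he.span p (hUW (hΨU hp)) v
    refine ⟨a / Real.sqrt (g (Ψ p).1), b, ?_⟩
    rw [smul_smul, div_mul_cancel₀ _ h2, hab]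
  · intro p hp
    rw [map_smul]
    exact smul_ne_zero (Real.sqrt_pos.2 (hpos p (hΨU hp))).ne' (he.α₁ p (hUW (hΨU hp)))
  · exact fun p hp => he.α₂ p (hUW (hΨU hp))
  · intro p hp w
    have hpU := hΨU hp
    have hps := hWΨ hpU.1
    obtain ⟨h1, h2, hY, hgs, hg0, -, hw⟩ := ht p hpU.2
    have h3 : (mfderiv 𝓘(ℝ, E) 𝓘(ℝ, (ℝ × ℝ) × (ℝ × ℝ)) Ψ' p w : (ℝ × ℝ) × (ℝ × ℝ)).1 =
        fderiv ℝ Y (Ψ p).1 (mfderiv 𝓘(ℝ, E) 𝓘(ℝ, (ℝ × ℝ) × (ℝ × ℝ)) Ψ p w :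
          (ℝ × ℝ) × (ℝ × ℝ)).1 := by
      have h4 : (fun p => (Ψ' p).1) =ᶠ[𝓝 p] fun p => Y (Ψ p).1 :=
        Filter.eventually_of_mem (Ψ'.open_source.mem_nhds hp) hΨY
      have h5 := hsub.mfderiv_comp hU hpU hY w
      rw [← h4.mfderiv_eq, hΨ.mfderiv_fst hps] at h5
      exact (hΨ'.mfderiv_fst hp w).symm.trans h5
    rw [h3, map_smul, smul_eq_mul, mul_pow, Real.sq_sqrt hg0.le, hβ p hps]
    have h6 := hw (mfderiv 𝓘(ℝ, E) 𝓘(ℝ, (ℝ × ℝ) × (ℝ × ℝ)) Ψ p w : (ℝ × ℝ) × (ℝ × ℝ)).1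
    rw [mul_right_comm, ← h6, ← h1, ← h2]
    have := he.α₁ p hpU.1
    field_simp

/-- The octuple has, on `W`, the standard form in the coordinates `y₁, y₂, X₁, X₂`. -/
structure OctupleData.IsNormalOn (O : OctupleData E M) (W : Set M) (y₁ y₂ X₁ X₂ : M → ℝ) :
    Prop where
  smooth_y₁ : SmoothFunOn E W y₁
  smooth_y₂ : SmoothFunOn E W y₂
  smooth_X₁ : SmoothFunOn E W X₁
  smooth_X₂ : SmoothFunOn E W X₂
  ne_zero : ∀ p ∈ W, X₁ p ≠ 0
  eq_zero : ∀ p ∈ W, ∀ w : TangentSpace 𝓘(ℝ, E) p, dirDeriv y₁ p w = 0 → dirDeriv y₂ p w = 0 →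
    dirDeriv X₁ p w = 0 → dirDeriv X₂ p w = 0 → w = 0
  mem_V : ∀ p ∈ W, ∀ w : TangentSpace 𝓘(ℝ, E) p,
    w ∈ O.V p ↔ dirDeriv y₁ p w = 0 ∧ dirDeriv y₂ p w = 0
  α_eq : ∀ p ∈ W, ∀ v : O.V p, O.α p v = -((X₁ p)⁻¹ * dirDeriv X₁ p v.1)
  β_eq : ∀ p ∈ W, ∀ w : TangentSpace 𝓘(ℝ, E) p, O.β p w = (X₁ p ^ 2)⁻¹ * dirDeriv y₁ p w
  θ_eq : ∀ p ∈ W, ∀ u v : O.V p, O.θ p u v = X₁ p ^ 2 *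
    (dirDeriv X₁ p u.1 * dirDeriv X₂ p v.1 - dirDeriv X₂ p u.1 * dirDeriv X₁ p v.1)
  ζ_eq : ∀ p ∈ W, ∀ w w' : TangentSpace 𝓘(ℝ, E) p, O.ζ p w w' = 2 * (X₁ p)⁻¹ *
    (dirDeriv y₁ p w * dirDeriv y₂ p w' - dirDeriv y₂ p w * dirDeriv y₁ p w')
  h_eq : ∀ p ∈ W, ∀ (v : O.V p) (w : TangentSpace 𝓘(ℝ, E) p), O.h p v w =
    dirDeriv y₁ p w * (X₁ p * dirDeriv X₂ p v.1 - X₂ p * dirDeriv X₁ p v.1) -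
      dirDeriv y₂ p w * dirDeriv X₁ p v.1
  -- Along each leaf X₁ and X₂ are affine functions for D. Since their differentials are independent
  -- on V, the last two conditions determine D.
  D_X₁ : ∀ U : Set M, IsOpen U → U ⊆ W → ∀ u v : Sec O.V, SmoothSecOn U u → SmoothSecOn U v →
    ∀ x ∈ U, dirDeriv X₁ x (O.D u v x).1 = dirDeriv (fun p => dirDeriv X₁ p (v p).1) x (u x).1
  D_X₂ : ∀ U : Set M, IsOpen U → U ⊆ W → ∀ u v : Sec O.V, SmoothSecOn U u → SmoothSecOn U v →
    ∀ x ∈ U, dirDeriv X₂ x (O.D u v x).1 = dirDeriv (fun p => dirDeriv X₂ p (v p).1) x (u x).1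

theorem dirDeriv_combination {V : TangentSubspaces E M} {f : M → ℝ} {p : M} {e₁ e₂ v : V p}
    {a b c d : ℝ}
    (h : v = a • e₁ + b • e₂) (h₁ : dirDeriv f p e₁.1 = c) (h₂ : dirDeriv f p e₂.1 = d) :
    dirDeriv f p v.1 = a * c + b * d := by
  rw [h, ← h₁, ← h₂, ← dirDeriv_smul_right, ← dirDeriv_smul_right, ← dirDeriv_add_right]
  rfl

/-- The coefficients of a section in a parallel frame are differentiated by the connection. -/
theorem dirDeriv_conn_of_frame {V : TangentSubspaces E M} {D : Sec V → Sec V → Sec V}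
    (hD : IsFlatTorsionFree V D) {U : Set M} (hU : IsOpen U) {e₁ e₂ u v : Sec V}
    (he₁ : IsParallelOn D U e₁) (he₂ : IsParallelOn D U e₂) {f₁ f₂ f : M → ℝ} {c₁ c₂ : ℝ}
    (hf₁ : SmoothFunOn E U f₁) (hf₂ : SmoothFunOn E U f₂)
    (hv : ∀ p ∈ U, v p = f₁ p • e₁ p + f₂ p • e₂ p) (hus : SmoothSecOn U u)
    (hvs : SmoothSecOn U v) (hc₁ : ∀ p ∈ U, dirDeriv f p (e₁ p).1 = c₁)
    (hc₂ : ∀ p ∈ U, dirDeriv f p (e₂ p).1 = c₂) {x : M} (hx : x ∈ U) :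
    dirDeriv f x (D u v x).1 = dirDeriv (fun p => dirDeriv f p (v p).1) x (u x).1 := by
  have h1 : D u v x = dirDeriv f₁ x (u x).1 • e₁ x + dirDeriv f₂ x (u x).1 • e₂ x := by
    rw [hD.isLocal U hU u v u (fun p => f₁ p • e₁ p + f₂ p • e₂ p) hus hvs hus
      ((he₁.1.smul hf₁).add (he₂.1.smul hf₂)) (fun _ _ => rfl) hv x hx,
      hD.add_right U hU _ _ _ hus (he₁.1.smul hf₁) (he₂.1.smul hf₂) x hx,
      hD.leibniz U hU _ _ _ hf₁ hus he₁.1 x hx, hD.leibniz U hU _ _ _ hf₂ hus he₂.1 x hx,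
      he₁.2 u hus x hx, he₂.2 u hus x hx, smul_zero, smul_zero, zero_add, zero_add]
  have hd₁ := hf₁.mdifferentiableAt hU hx
  have hd₂ := hf₂.mdifferentiableAt hU hx
  rw [dirDeriv_combination h1 (hc₁ x hx) (hc₂ x hx), dirDeriv_congr_of_isOpen
    (f := fun p => dirDeriv f p (v p).1) hU hx (g := fun p => c₁ * f₁ p + c₂ * f₂ p) (fun p hp => by
      rw [dirDeriv_combination (hv p hp) (hc₁ p hp) (hc₂ p hp)]; ring),
    dirDeriv_add ((SmoothFunOn.const c₁).mul hf₁ |>.mdifferentiableAt hU hx)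
      ((SmoothFunOn.const c₂).mul hf₂ |>.mdifferentiableAt hU hx),
    dirDeriv_const_mul _ hd₁, dirDeriv_const_mul _ hd₂]
  ring

end Normalization

/-! ### Existence of the standard form -/

section NormalForm

variable {E : Type*} [NormedAddCommGroup E] [NormedSpace ℝ E]
  {M : Type*} [TopologicalSpace M] [ChartedSpace E M] [IsManifold 𝓘(ℝ, E) ∞ M]
  {O : OctupleData E M}

/-- Consequences of `θ(v, ζw) = 2 h(v, w)` and `α(ζw) = 2 β(w)` in a normalized frame. -/
theorem OctupleData.IsBasic.h_ζ_of_frame (hO : O.IsBasic) {p : M} {e₁ e₂ : O.V p} {a : ℝ}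
    (hspan : ∀ v : O.V p, ∃ a b : ℝ, v = a • e₁ + b • e₂) (ha : a ≠ 0)
    (hα₁ : O.α p e₁ = a) (hα₂ : O.α p e₂ = 0) (hθ : O.θ p e₁ e₂ = -(a ^ 2)⁻¹)
    {m : TangentSpace 𝓘(ℝ, E) p → ℝ} (hβ : ∀ w, O.β p w = a ^ 2 * m w)
    (w : TangentSpace 𝓘(ℝ, E) p) :
    O.h p e₂ w = a⁻¹ * m w ∧
      ∀ w', O.ζ p w w' = 2 * a * (m w * O.h p e₁ w' - O.h p e₁ w * m w') := by
  -- With ζw = A e₁ + B e₂, the value α(ζw) gives A, the value θ(e₁, ζw) gives B, and θ(e₂, ζw) then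
  -- expresses h(e₂, w) through A.
  have key : ∀ w, ∃ A B : ℝ, (∀ w', O.ζ p w w' = A * O.h p e₁ w' + B * O.h p e₂ w') ∧
      A = 2 * a * m w ∧ B = -(2 * a ^ 2 * O.h p e₁ w) ∧ O.h p e₂ w = a⁻¹ * m w := by
    intro w
    obtain ⟨z, hζ, hθz, hαz⟩ := hO.sharp p w
    obtain ⟨A, B, rfl⟩ := hspan z
    have h1 := hθz e₁
    have h2 := hθz e₂
    have h3 := hO.θ_alt p e₁
    have h4 := hO.θ_alt p e₂
    have h5 := hO.θ_swap e₁ e₂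
    rw [hθ] at h5
    simp only [map_add, map_smul, smul_eq_mul, hα₁, hα₂, hβ, mul_zero, add_zero] at hαz
    simp only [map_add, map_smul, smul_eq_mul, h3, h4, h5, hθ, mul_zero, add_zero, zero_add]
      at h1 h2
    have hA : A = 2 * a * m w := by
      apply mul_right_cancel₀ ha
      linarith
    refine ⟨A, B, fun w' => ?_, hA, ?_, ?_⟩
    · rw [← hζ w', map_add, map_smul, map_smul]
      rfl
    · field_simp at h1
      linarith
    · rw [hA] at h2
      field_simp at h2 ⊢
      linarith
  obtain ⟨A, B, h1, hA, hB, h2⟩ := key w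
  refine ⟨h2, fun w' => ?_⟩
  obtain ⟨-, -, -, -, -, h3⟩ := key w'
  rw [h1, hA, hB, h3]
  field_simp
  ring

/-- After normalizing θ on the frame, the only datum left is the 1-form h(e₁, ·), which is brought
to the form dy₂ + X₂ dy₁ by integration on the leaf space. The reciprocal of α(e₁) serves as X₁. -/
theorem OctupleData.IsBasic.exists_isNormalOn [CompleteSpace E] (hO : O.IsBasic) (x : M) :
    ∃ W : Set M, IsOpen W ∧ x ∈ W ∧ ∃ y₁ y₂ X₁ X₂ : M → ℝ, O.IsNormalOn W y₁ y₂ X₁ X₂ := by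
  have hD := hO.isFlatTorsionFree
  obtain ⟨Ψ, hxΨ, hΨ, e₁, e, he, hβ⟩ := hO.exists_normalized_frame x
  have ho := Ψ.open_source
  let m : ∀ p : M, TangentSpace 𝓘(ℝ, E) p → ℝ × ℝ := fun p w =>
    (mfderiv 𝓘(ℝ, E) 𝓘(ℝ, (ℝ × ℝ) × (ℝ × ℝ)) Ψ p w : (ℝ × ℝ) × (ℝ × ℝ)).1
  have hsub := hΨ.isSubmersionOn
  have hm : ∀ p ∈ Ψ.source, ∀ w, mfderiv 𝓘(ℝ, E) 𝓘(ℝ, ℝ × ℝ) (fun p => (Ψ p).1) p w = m p w :=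
    fun p hp w => hΨ.mfderiv_fst hp w
  have hmc : ∀ p ∈ Ψ.source, ∀ c, m p (coordField Ψ (c, 0) p) = c := fun p hp c => by
    simp only [m, hΨ.mfderiv_coordField hp]
  have hp₁ := he.parallel₁ _ ho subset_rfl
  have hp := he.parallel₂ _ ho subset_rfl
  have ha := hO.α_smooth _ ho e₁ hp₁.1
  have ha0 := he.α₁
  set a : M → ℝ := fun p => O.α p (e₁ p) with hadef
  have hda₁ : ∀ p ∈ Ψ.source, dirDeriv a p (e₁ p).1 = a p * a p := hO.dα _ ho _ _ hp₁ hp₁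
  have hda : ∀ p ∈ Ψ.source, dirDeriv a p (e p).1 = 0 := fun p hpΨ => by
    rw [hO.dα _ ho _ _ hp hp₁ p hpΨ, he.α₂ p hpΨ, zero_mul]
  -- rescaling the second section
  let t : M → ℝ := fun p => O.θ p (e₁ p) (e p)
  have ht : SmoothFunOn E Ψ.source t := hO.θ_smooth _ ho _ _ hp₁.1 hp.1
  have hat : ∀ p ∈ Ψ.source, a p * a p * t p ≠ 0 := fun p hpΨ =>
    mul_ne_zero (mul_ne_zero (ha0 p hpΨ) (ha0 p hpΨ)) (hO.θ_ne_zero (he.span p hpΨ))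
  have hats := (ha.mul ha).mul ht
  -- The logarithmic derivatives 2α(u) of a² and -2α(u) of θ(e₁, e) cancel.
  have hk : IsLeafwiseConstOn O.V Ψ.source (fun p => -(a p * a p * t p)⁻¹) := by
    have hd : ∀ u : Sec O.V, IsParallelOn O.D Ψ.source u → ∀ p ∈ Ψ.source,
        dirDeriv (fun p => -(a p * a p * t p)⁻¹) p (u p).1 = 0 := by
      intro u hu p hpΨ
      have h1 := ha.mdifferentiableAt ho hpΨ
      rw [dirDeriv_neg ((hats.inv hat).mdifferentiableAt ho hpΨ),
        dirDeriv_inv (hats.mdifferentiableAt ho hpΨ) (hat p hpΨ),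
        dirDeriv_mul ((ha.mul ha).mdifferentiableAt ho hpΨ) (ht.mdifferentiableAt ho hpΨ),
        dirDeriv_mul h1 h1, hO.dα _ ho _ _ hu hp₁ p hpΨ, hO.dθ _ ho _ _ _ hu hp₁ hp p hpΨ]
      ring
    exact isLeafwiseConstOn_of_span he.span (hats.inv hat).neg (hd e₁ hp₁) (hd e hp)
  -- This factor yields θ(e₁, e₂) = -a⁻², the value of X₁² dX₁ ∧ dX₂ on a frame with dX₁ = (-1, 0)
  -- and dX₂ = (0, 1), for X₁ = 1/a.
  let e₂ : Sec O.V := fun p => (-(a p * a p * t p)⁻¹) • e p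
  have hw₂ : IsParallelWithin O.D Ψ.source e₂ := he.parallel₂.smul hD hk
  have hp₂ := hw₂ _ ho subset_rfl
  have hspan : ∀ p ∈ Ψ.source, ∀ v : O.V p, ∃ b c : ℝ, v = b • e₁ p + c • e₂ p := by
    intro p hpΨ v
    obtain ⟨b, c, hbc⟩ := he.span p hpΨ v
    refine ⟨b, -(a p * a p * t p) * c, ?_⟩
    rw [hbc, smul_smul, mul_right_comm, neg_mul_neg, mul_inv_cancel₀ (hat p hpΨ), one_mul]
  have hα₂ : ∀ p ∈ Ψ.source, O.α p (e₂ p) = 0 := fun p hpΨ => by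
    rw [map_smul, he.α₂ p hpΨ, smul_zero]
  have hθ : ∀ p ∈ Ψ.source, O.θ p (e₁ p) (e₂ p) = -(a p ^ 2)⁻¹ := by
    intro p hpΨ
    have h1 : t p ≠ 0 := hO.θ_ne_zero (he.span p hpΨ)
    have h2 := ha0 p hpΨ
    rw [map_smul, smul_eq_mul]
    change -(a p * a p * t p)⁻¹ * t p = _
    field_simp
  have hhζ : ∀ p ∈ Ψ.source, ∀ w, O.h p (e₂ p) w = (a p)⁻¹ * (m p w).1 ∧
      ∀ w', O.ζ p w w' = 2 * a p *
        ((m p w).1 * O.h p (e₁ p) w' - O.h p (e₁ p) w * (m p w').1) := fun p hpΨ w =>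
    hO.h_ζ_of_frame (hspan p hpΨ) (ha0 p hpΨ) rfl (hα₂ p hpΨ) (hθ p hpΨ)
      (m := fun w => (m p w).1) (hβ p hpΨ) w
  -- the functions `S = h(e₁, ∂₁)` and `T = h(e₁, ∂₂)`
  have hc := fun c : ℝ × ℝ => hΨ.isProjectableOn_coordField ho subset_rfl (c, 0)
  let S : M → ℝ := fun p => O.h p (e₁ p) (coordField Ψ ((1, 0), 0) p)
  let T : M → ℝ := fun p => O.h p (e₁ p) (coordField Ψ ((0, 1), 0) p)
  have hS : SmoothFunOn E Ψ.source S := hO.isPartialMetric.smooth _ ho _ _ hp₁.1 (hc _).1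
  have hT : SmoothFunOn E Ψ.source T := hO.isPartialMetric.smooth _ ho _ _ hp₁.1 (hc _).1
  have hh₁ : ∀ p ∈ Ψ.source, ∀ w, O.h p (e₁ p) w = (m p w).1 * S p + (m p w).2 * T p :=
    fun p hpΨ w => hΨ.apply_eq hpΨ (O.h p (e₁ p)) (fun w hw => hO.h_eq_zero _ hw) w
  -- The derivatives of S and T along u are β(∂₁)θ(u, e₁) and β(∂₂)θ(u, e₁), where β(∂₁) = a² and
  -- β(∂₂) = 0. The sign chosen for θ(e₁, e₂) makes S grow at unit rate along e₂.
  have hSd₁ : ∀ p ∈ Ψ.source, dirDeriv S p (e₁ p).1 = 0 := fun p hpΨ => by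
    rw [hO.dh _ ho _ _ _ hp₁ hp₁ (hc _) p hpΨ, hO.θ_alt p, mul_zero]
  have hSd₂ : ∀ p ∈ Ψ.source, dirDeriv S p (e₂ p).1 = 1 := fun p hpΨ => by
    rw [hO.dh _ ho _ _ _ hp₂ hp₁ (hc _) p hpΨ, hO.θ_swap (e₁ p), hθ p hpΨ, hβ p hpΨ]
    change a p ^ 2 * (m p _).1 * _ = 1
    rw [hmc p hpΨ, mul_one, neg_neg, mul_inv_cancel₀ (pow_ne_zero 2 (ha0 p hpΨ))]
  have hTc : IsLeafwiseConstOn O.V Ψ.source T := by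
    refine isLeafwiseConstOn_of_span hspan hT (fun p hpΨ => ?_) (fun p hpΨ => ?_)
    · rw [hO.dh _ ho _ _ _ hp₁ hp₁ (hc _) p hpΨ, hO.θ_alt p, mul_zero]
    · rw [hO.dh _ ho _ _ _ hp₂ hp₁ (hc _) p hpΨ, hβ p hpΨ]
      change a p ^ 2 * (m p _).1 * _ = 0
      rw [hmc p hpΨ, mul_zero, zero_mul]
  -- Since h(e₂, ∂₂) = 0, a zero of T would put the transverse vector ∂₂ into the kernel V of h.
  -- Nonvanishing of T makes y₁ and y₂ independent.
  have hT0 : ∀ p ∈ Ψ.source, T p ≠ 0 := by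
    intro p hpΨ h0
    have h1 : coordField Ψ ((0, 1), 0) p ∈ O.V p := by
      refine (hO.isPartialMetric.kernel p _).1 fun v => ?_
      obtain ⟨b, c, rfl⟩ := hspan p hpΨ v
      rw [map_add, map_smul, map_smul, LinearMap.add_apply, LinearMap.smul_apply,
        LinearMap.smul_apply, (hhζ p hpΨ _).1, hmc p hpΨ]
      change b • T p + _ = 0
      rw [h0]
      simp
    rw [hΨ.mem_iff p hpΨ] at h1
    have h2 := (hmc p hpΨ (0, 1)).symm.trans h1
    simp at h2
  obtain ⟨F, hF, hTF⟩ := hΨ.exists_descent ho hTc hxΨ hxΨ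
  -- With ∂₂Z = T, the form S dq₁ + T dq₂ equals dZ + (S - ∂₁Z) dq₁. This is the origin of y₂ = Z
  -- and X₂ = S - ∂₁Z.
  obtain ⟨Z, hZ⟩ := exists_fderiv_snd_eq hF
  have hct : Filter.Tendsto (fun p => (Ψ p).1) (𝓝 x) (𝓝 (Ψ x).1) := (Ψ.continuousAt hxΨ).fst
  obtain ⟨s, hs, hso, hxs⟩ := eventually_nhds_iff.1 (hTF.and (hct.eventually hZ))
  have hW : IsOpen (Ψ.source ∩ s) := ho.inter hso
  have hWΨ : Ψ.source ∩ s ⊆ Ψ.source := Set.inter_subset_left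
  have hZs : ∀ p ∈ Ψ.source ∩ s, ContDiffAt ℝ ∞ Z (Ψ p).1 := fun p hpW => (hs p hpW.2).2.1
  have hZd : ∀ p ∈ Ψ.source ∩ s, fderiv ℝ Z (Ψ p).1 (0, 1) = T p := fun p hpW => by
    rw [(hs p hpW.2).1, (hs p hpW.2).2.2]
  have hsubW := hsub.mono hWΨ
  have hy₂ := hsubW.isLeafwiseConstOn_comp hW hZs
  have hZ₁ := hsubW.isLeafwiseConstOn_comp hW (F := fun q => fderiv ℝ Z q (1, 0)) fun p hpW =>
    ((hZs p hpW).fderiv_right (m := ∞) (by simp)).clm_apply contDiffAt_const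
  have hX₂ := (hS.mono hWΨ).sub hZ₁.smooth
  have hX₁ := ha.inv ha0
  have hdy₁ : ∀ p ∈ Ψ.source, ∀ w, dirDeriv (fun p => (Ψ p).1.1) p w = (m p w).1 := by
    intro p hpΨ w
    exact dirDeriv_clm_comp (ContinuousLinearMap.fst ℝ ℝ ℝ ∘L ContinuousLinearMap.fst ℝ _ (ℝ × ℝ))
      (hΨ.mdifferentiableAt hpΨ) w
  have hdy₂ : ∀ p ∈ Ψ.source ∩ s, ∀ w, dirDeriv (fun p => Z (Ψ p).1) p w =
      (m p w).1 * fderiv ℝ Z (Ψ p).1 (1, 0) + (m p w).2 * T p := by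
    intro p hpW w
    refine (dirDeriv_comp (φ := fun p => (Ψ p).1) ((hZs p hpW).differentiableAt (by simp))
      (hsubW.mdifferentiableAt hW hpW) w).trans ?_
    have h1 := hm p hpW.1 w
    have h2 : m p w = (m p w).1 • ((1, 0) : ℝ × ℝ) + (m p w).2 • ((0, 1) : ℝ × ℝ) := by
      ext <;> simp
    refine (congrArg (fderiv ℝ Z (Ψ p).1) (h1.trans h2)).trans ?_
    rw [map_add, map_smul, map_smul, hZd p hpW]
    rfl
  have hdX₁ : ∀ p ∈ Ψ.source, ∀ w, dirDeriv (fun p => (a p)⁻¹) p w =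
      -((a p ^ 2)⁻¹) * dirDeriv a p w := fun p hpΨ w =>
    dirDeriv_inv (ha.mdifferentiableAt ho hpΨ) (ha0 p hpΨ) w
  -- The derivative of a along e₁ is a², so that of 1/a is constant.
  have hX₁e₁ : ∀ p ∈ Ψ.source ∩ s, dirDeriv (fun p => (a p)⁻¹) p (e₁ p).1 = -1 := by
    intro p hpW
    rw [hdX₁ p hpW.1, hda₁ p hpW.1]
    have h1 : a p ≠ 0 := ha0 p hpW.1
    field_simp
  have hX₁e₂ : ∀ p ∈ Ψ.source ∩ s, dirDeriv (fun p => (a p)⁻¹) p (e₂ p).1 = 0 := by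
    intro p hpW
    rw [hdX₁ p hpW.1]
    have h1 : dirDeriv a p (e₂ p).1 = 0 := by
      refine (dirDeriv_smul_right a p _ (e p).1).trans ?_
      rw [hda p hpW.1, mul_zero]
    rw [h1, mul_zero]
  have hdX₂ : ∀ p ∈ Ψ.source ∩ s, ∀ v : O.V p,
      dirDeriv (fun p => S p - fderiv ℝ Z (Ψ p).1 (1, 0)) p v.1 = dirDeriv S p v.1 := by
    intro p hpW v
    rw [dirDeriv_sub (hS.mdifferentiableAt ho hpW.1) (hZ₁.smooth.mdifferentiableAt hW hpW),
      hZ₁.dirDeriv_eq_zero p hpW v.1 v.2, sub_zero]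
  have hX₂e₁ : ∀ p ∈ Ψ.source ∩ s,
      dirDeriv (fun p => S p - fderiv ℝ Z (Ψ p).1 (1, 0)) p (e₁ p).1 = 0 := fun p hpW => by
    rw [hdX₂ p hpW, hSd₁ p hpW.1]
  have hX₂e₂ : ∀ p ∈ Ψ.source ∩ s,
      dirDeriv (fun p => S p - fderiv ℝ Z (Ψ p).1 (1, 0)) p (e₂ p).1 = 1 := fun p hpW => by
    rw [hdX₂ p hpW, hSd₂ p hpW.1]
  have hmemV : ∀ p ∈ Ψ.source ∩ s, ∀ w, w ∈ O.V p ↔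
      dirDeriv (fun p => (Ψ p).1.1) p w = 0 ∧ dirDeriv (fun p => Z (Ψ p).1) p w = 0 := by
    intro p hpW w
    rw [hΨ.mem_iff p hpW.1, hdy₁ p hpW.1, hdy₂ p hpW]
    change m p w = 0 ↔ _
    constructor
    · intro h
      simp [h]
    · rintro ⟨h1, h2⟩
      rw [h1, zero_mul, zero_add, mul_eq_zero] at h2
      exact Prod.ext h1 (h2.resolve_right (hT0 p hpW.1))
  -- On V, the coframe dual to e₁, e₂ is -dX₁, dX₂. Each remaining formula follows by expanding
  -- vertical vectors in this way.
  have hcomb : ∀ p ∈ Ψ.source ∩ s, ∀ v : O.V p,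
      v = (-dirDeriv (fun p => (a p)⁻¹) p v.1) • e₁ p +
        dirDeriv (fun p => S p - fderiv ℝ Z (Ψ p).1 (1, 0)) p v.1 • e₂ p := by
    intro p hpW v
    obtain ⟨b, c, h⟩ := hspan p hpW.1 v
    rw [dirDeriv_combination h (hX₁e₁ p hpW) (hX₁e₂ p hpW),
      dirDeriv_combination h (hX₂e₁ p hpW) (hX₂e₂ p hpW)]
    simpa using h
  refine ⟨Ψ.source ∩ s, hW, ⟨hxΨ, hxs⟩, fun p => (Ψ p).1.1, fun p => Z (Ψ p).1,
    fun p => (a p)⁻¹, fun p => S p - fderiv ℝ Z (Ψ p).1 (1, 0), ?_⟩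
  have hDX : ∀ (U : Set M), IsOpen U → U ⊆ Ψ.source ∩ s → ∀ u v : Sec O.V, SmoothSecOn U u →
      SmoothSecOn U v → ∀ (f : M → ℝ) (c₁ c₂ : ℝ),
      (∀ p ∈ Ψ.source ∩ s, dirDeriv f p (e₁ p).1 = c₁) →
      (∀ p ∈ Ψ.source ∩ s, dirDeriv f p (e₂ p).1 = c₂) → ∀ x ∈ U,
      dirDeriv f x (O.D u v x).1 = dirDeriv (fun p => dirDeriv f p (v p).1) x (u x).1 := by
    intro U hU hUW u v hu hv f c₁ c₂ hc₁ hc₂ x hx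
    exact dirDeriv_conn_of_frame hD hU (he.parallel₁ U hU (hUW.trans hWΨ))
      (hw₂ U hU (hUW.trans hWΨ))
      (SmoothFieldOn.dirDeriv hU (hX₁.mono (hUW.trans hWΨ)) hv).neg
      (SmoothFieldOn.dirDeriv hU (hX₂.mono hUW) hv) (fun p hpU => hcomb p (hUW hpU) (v p)) hu hv
      (fun p hpU => hc₁ p (hUW hpU)) (fun p hpU => hc₂ p (hUW hpU)) hx
  refine ⟨?_, hy₂.smooth, hX₁.mono hWΨ, hX₂, fun p hpW => inv_ne_zero (ha0 p hpW.1), ?_, hmemV,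
    ?_, ?_, ?_, ?_, ?_, ?_, ?_⟩
  · exact (hΨ.smooth_comp subset_rfl (F := fun q => q.1.1)
      fun p _ => contDiffAt_fst.fst).mono hWΨ
  · intro p hpW w h1 h2 h3 h4
    have h5 := hcomb p hpW ⟨w, (hmemV p hpW w).2 ⟨h1, h2⟩⟩
    rw [h3, h4] at h5
    simpa using congrArg Subtype.val h5
  · intro p hpW v
    conv_lhs => rw [hcomb p hpW v, map_add, map_smul, map_smul, hα₂ p hpW.1]
    simp [hadef, mul_comm]
  · intro p hpW w
    rw [hβ p hpW.1, hdy₁ p hpW.1, inv_pow, inv_inv]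
  · intro p hpW u v
    have h1 := hO.θ_alt p (e₁ p)
    have h2 := hO.θ_alt p (e₂ p)
    have h3 := hO.θ_swap (e₁ p) (e₂ p)
    have h4 := ha0 p hpW.1
    rw [hθ p hpW.1, neg_neg] at h3
    conv_lhs => rw [hcomb p hpW u, hcomb p hpW v]
    simp only [map_add, map_smul, LinearMap.add_apply, LinearMap.smul_apply, smul_eq_mul, h1, h2,
      h3, hθ p hpW.1, inv_pow]
    ring
  · intro p hpW w w'
    rw [(hhζ p hpW.1 w).2, hh₁ p hpW.1, hh₁ p hpW.1, hdy₁ p hpW.1, hdy₁ p hpW.1, hdy₂ p hpW,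
      hdy₂ p hpW, inv_inv]
    ring
  · intro p hpW v w
    conv_lhs => rw [hcomb p hpW v, map_add, map_smul, map_smul, LinearMap.add_apply,
      LinearMap.smul_apply, LinearMap.smul_apply, (hhζ p hpW.1 w).1, hh₁ p hpW.1]
    rw [hdy₁ p hpW.1, hdy₂ p hpW, smul_eq_mul, smul_eq_mul]
    ring
  · exact fun U hU hUW u v hu hv => hDX U hU hUW u v hu hv _ _ _ hX₁e₁ hX₁e₂
  · exact fun U hU hUW u v hu hv => hDX U hU hUW u v hu hv _ _ _ hX₂e₁ hX₂e₂

end NormalForm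

/-! ### Coordinate functions under a local diffeomorphism -/

section ChangeOfVariables

variable {E : Type*} [NormedAddCommGroup E] [NormedSpace ℝ E]
  {M : Type*} [TopologicalSpace M] [ChartedSpace E M]
  {E' : Type*} [NormedAddCommGroup E'] [NormedSpace ℝ E']
  {M' : Type*} [TopologicalSpace M'] [ChartedSpace E' M']

theorem dirDeriv_mfderiv_of_comp_eq {Φ : OpenPartialHomeomorph M M'}
    {p : M} (hΦ : MDifferentiableAt 𝓘(ℝ, E) 𝓘(ℝ, E') Φ p) {f : M → ℝ} {f' : M' → ℝ}
    (hf' : MDifferentiableAt 𝓘(ℝ, E') 𝓘(ℝ, ℝ) f' (Φ p)) {U : Set M} (hU : IsOpen U) (hpU : p ∈ U)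
    (h : ∀ p ∈ U, f' (Φ p) = f p) (w : TangentSpace 𝓘(ℝ, E) p) :
    dirDeriv f' (Φ p) (mfderiv 𝓘(ℝ, E) 𝓘(ℝ, E') Φ p w) = dirDeriv f p w := by
  have h1 := mfderiv_comp_apply (I := 𝓘(ℝ, E)) (I' := 𝓘(ℝ, E')) (I'' := 𝓘(ℝ, ℝ)) p hf' hΦ w
  exact h1.symm.trans (dirDeriv_congr_of_isOpen (f := f' ∘ Φ) hU hpU h w)

end ChangeOfVariables

/-! ### Centering the coordinates, and the equivalence of any two basic octuples -/

section Equivalence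

variable {E : Type*} [NormedAddCommGroup E] [NormedSpace ℝ E]
  {M : Type*} [TopologicalSpace M] [ChartedSpace E M] [IsManifold 𝓘(ℝ, E) ∞ M]
  {O : OctupleData E M}
  {E' : Type*} [NormedAddCommGroup E'] [NormedSpace ℝ E']
  {M' : Type*} [TopologicalSpace M'] [ChartedSpace E' M'] [IsManifold 𝓘(ℝ, E') ∞ M']
  {O' : OctupleData E' M'}

/-- The coordinates of a standard form can be changed so that their values at a given point
become `0, 0, 1, 0`. -/
theorem OctupleData.IsNormalOn.exists_centered {W : Set M} (hW : IsOpen W) {y₁ y₂ X₁ X₂ : M → ℝ}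
    (h : O.IsNormalOn W y₁ y₂ X₁ X₂) {x : M} (hx : x ∈ W) : ∃ y₁' y₂' X₁' X₂' : M → ℝ,
      O.IsNormalOn W y₁' y₂' X₁' X₂' ∧ y₁' x = 0 ∧ y₂' x = 0 ∧ X₁' x = 1 ∧ X₂' x = 0 := by
  have hk := h.ne_zero x hx
  set k := X₁ x with hkdef
  set m := X₂ x with hmdef
  have haff : ∀ {f : M → ℝ}, SmoothFunOn E W f → ∀ c d : ℝ,
      SmoothFunOn E W (fun p => c * (f p - d)) ∧ ∀ p ∈ W, ∀ w : TangentSpace 𝓘(ℝ, E) p,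
        dirDeriv (fun p => c * (f p - d)) p w = c * dirDeriv f p w := by
    intro f hf c d
    refine ⟨(SmoothFunOn.const c).mul (hf.sub (SmoothFunOn.const d)), fun p hp w => ?_⟩
    have h1 := hf.mdifferentiableAt hW hp
    have h2 := (SmoothFunOn.const (E := E) (U := W) d).mdifferentiableAt hW hp
    rw [dirDeriv_const_mul c ((hf.sub (SmoothFunOn.const d)).mdifferentiableAt hW hp),
      dirDeriv_sub h1 h2, dirDeriv_const, sub_zero]
  -- The weights k⁻², k, k⁻¹, k³ of y₁, y₂, X₁, X₂ are those that leave every formula of the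
  -- standard form unchanged. The formulas depend on X₁ itself, so X₁ is scaled to 1 at x rather
  -- than shifted. Shifting X₂ by m changes h by a multiple of dy₁ ⊗ dX₁, which is compensated by
  -- the term k m y₁ added to y₂.
  obtain ⟨sy₁, dy₁⟩ := haff h.smooth_y₁ (k ^ 2)⁻¹ (y₁ x)
  obtain ⟨sX₁, dX₁⟩ := haff h.smooth_X₁ k⁻¹ 0
  obtain ⟨sX₂, dX₂⟩ := haff h.smooth_X₂ (k ^ 3) m
  obtain ⟨sy₂, dy₂⟩ := haff h.smooth_y₂ k (y₂ x)
  obtain ⟨sy₃, dy₃⟩ := haff h.smooth_y₁ (k * m) (y₁ x)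
  have dy₂' : ∀ p ∈ W, ∀ w : TangentSpace 𝓘(ℝ, E) p,
      dirDeriv (fun p => k * (y₂ p - y₂ x) + k * m * (y₁ p - y₁ x)) p w =
        k * dirDeriv y₂ p w + k * m * dirDeriv y₁ p w := by
    intro p hp w
    rw [dirDeriv_add (sy₂.mdifferentiableAt hW hp) (sy₃.mdifferentiableAt hW hp), dy₂ p hp,
      dy₃ p hp]
  have hDaff : ∀ {f : M → ℝ}, SmoothFunOn E W f → ∀ c d : ℝ, ∀ U : Set M, IsOpen U → U ⊆ W →
      ∀ u v : Sec O.V, SmoothSecOn U u → SmoothSecOn U v → ∀ x ∈ U,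
      dirDeriv f x (O.D u v x).1 = dirDeriv (fun p => dirDeriv f p (v p).1) x (u x).1 →
      dirDeriv (fun p => c * (f p - d)) x (O.D u v x).1 =
        dirDeriv (fun p => dirDeriv (fun p => c * (f p - d)) p (v p).1) x (u x).1 := by
    intro f hf c d U hU hUW u v hu hv x hx hfx
    rw [(haff hf c d).2 x (hUW hx), dirDeriv_congr_of_isOpen
      (f := fun p => dirDeriv (fun p => c * (f p - d)) p (v p).1) hU hx
      (fun p hp => (haff hf c d).2 p (hUW hp) _), dirDeriv_const_mul c
      ((SmoothFieldOn.dirDeriv hU (hf.mono hUW) hv).mdifferentiableAt hU hx), hfx]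
  have hk2 : (k ^ 2)⁻¹ ≠ 0 := inv_ne_zero (pow_ne_zero 2 hk)
  refine ⟨_, _, _, _, ⟨sy₁, sy₂.add sy₃, sX₁, sX₂, ?_, ?_, ?_, ?_, ?_, ?_, ?_, ?_, ?_, ?_⟩,
    ?_, ?_, ?_, ?_⟩
  · intro p hp
    rw [sub_zero]
    exact mul_ne_zero (inv_ne_zero hk) (h.ne_zero p hp)
  · intro p hp w h1 h2 h3 h4
    rw [dy₁ p hp, mul_eq_zero, or_iff_right hk2] at h1
    rw [dy₂' p hp, h1, mul_zero, add_zero, mul_eq_zero, or_iff_right hk] at h2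
    rw [dX₁ p hp, mul_eq_zero, or_iff_right (inv_ne_zero hk)] at h3
    rw [dX₂ p hp, mul_eq_zero, or_iff_right (pow_ne_zero 3 hk)] at h4
    exact h.eq_zero p hp w h1 h2 h3 h4
  · intro p hp w
    rw [h.mem_V p hp, dy₁ p hp, dy₂' p hp, mul_eq_zero, or_iff_right hk2]
    refine and_congr_right fun h1 => ?_
    rw [h1, mul_zero, add_zero, mul_eq_zero, or_iff_right hk]
  · intro p hp v
    have := h.ne_zero p hp
    rw [h.α_eq p hp, dX₁ p hp]
    field_simp
    ring
  · intro p hp w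
    have := h.ne_zero p hp
    rw [h.β_eq p hp, dy₁ p hp]
    field_simp
    ring
  · intro p hp u v
    rw [h.θ_eq p hp, dX₁ p hp, dX₁ p hp, dX₂ p hp, dX₂ p hp]
    field_simp
    ring
  · intro p hp w w'
    have := h.ne_zero p hp
    rw [h.ζ_eq p hp, dy₁ p hp, dy₁ p hp, dy₂' p hp, dy₂' p hp, sub_zero]
    field_simp
    ring
  · intro p hp v w
    rw [h.h_eq p hp, dy₁ p hp, dy₂' p hp, dX₁ p hp, dX₂ p hp]
    field_simp
    ring
  · exact fun U hU hUW u v hu hv x hx => hDaff h.smooth_X₁ _ _ U hU hUW u v hu hv x hx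
      (h.D_X₁ U hU hUW u v hu hv x hx)
  · exact fun U hU hUW u v hu hv x hx => hDaff h.smooth_X₂ _ _ U hU hUW u v hu hv x hx
      (h.D_X₂ U hU hUW u v hu hv x hx)
  · simp
  · simp
  · simp only [sub_zero]
    exact inv_mul_cancel₀ hk
  · simp [hmdef]

/-- A diffeomorphism matching the coordinates of two standard forms is an equivalence. -/
theorem OctupleData.IsNormalOn.isTransportedBy {W : Set M} {y₁ y₂ X₁ X₂ : M → ℝ}
    (h : O.IsNormalOn W y₁ y₂ X₁ X₂) {W' : Set M'} (hW' : IsOpen W') {y₁' y₂' X₁' X₂' : M' → ℝ}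
    (h' : O'.IsNormalOn W' y₁' y₂' X₁' X₂') {Φ : OpenPartialHomeomorph M M'} (hΦW : Φ.source ⊆ W)
    (hΦW' : ∀ p ∈ Φ.source, Φ p ∈ W')
    (hΦ : ∀ p ∈ Φ.source, MDifferentiableAt 𝓘(ℝ, E) 𝓘(ℝ, E') Φ p)
    (hy₁ : ∀ p ∈ Φ.source, y₁' (Φ p) = y₁ p) (hy₂ : ∀ p ∈ Φ.source, y₂' (Φ p) = y₂ p)
    (hX₁ : ∀ p ∈ Φ.source, X₁' (Φ p) = X₁ p) (hX₂ : ∀ p ∈ Φ.source, X₂' (Φ p) = X₂ p) :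
    O.IsTransportedBy O' Φ := by
  have hd : ∀ {f : M → ℝ} {f' : M' → ℝ}, SmoothFunOn E' W' f' →
      (∀ p ∈ Φ.source, f' (Φ p) = f p) → ∀ p ∈ Φ.source, ∀ w : TangentSpace 𝓘(ℝ, E) p,
      dirDeriv f' (Φ p) (mfderiv 𝓘(ℝ, E) 𝓘(ℝ, E') Φ p w) = dirDeriv f p w :=
    fun hf' hff p hp w => dirDeriv_mfderiv_of_comp_eq (hΦ p hp)
      (hf'.mdifferentiableAt hW' (hΦW' p hp)) Φ.open_source hp hff w
  have dy₁ := hd h'.smooth_y₁ hy₁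
  have dy₂ := hd h'.smooth_y₂ hy₂
  have dX₁ := hd h'.smooth_X₁ hX₁
  have dX₂ := hd h'.smooth_X₂ hX₂
  refine ⟨?_, ?_, ?_, ?_, ?_, ?_, ?_⟩
  · intro p hp w
    rw [h'.mem_V _ (hΦW' p hp), h.mem_V p (hΦW hp), dy₁ p hp, dy₂ p hp]
  · intro U hU hUΦ u v u' v' hu hv hu' hv' huu hvv x hx
    have hxs := hUΦ hx
    have hΦU : IsOpen (Φ '' U) := Φ.isOpen_image_of_subset_source hU hUΦ
    have hΦx : Φ x ∈ Φ '' U := ⟨x, hx, rfl⟩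
    have hUW' : Φ '' U ⊆ W' := by
      rintro _ ⟨p, hp, rfl⟩
      exact hΦW' p (hUΦ hp)
    have hmem := (h.mem_V x (hΦW hxs) _).1 (O.D u v x).2
    have hmem' := (h'.mem_V _ (hΦW' x hxs) _).1 (O'.D u' v' (Φ x)).2
    have hX : ∀ {f : M → ℝ} {f' : M' → ℝ}, SmoothFunOn E' W' f' →
        (∀ p ∈ Φ.source, f' (Φ p) = f p) →
        dirDeriv f x (O.D u v x).1 = dirDeriv (fun p => dirDeriv f p (v p).1) x (u x).1 →
        dirDeriv f' (Φ x) (O'.D u' v' (Φ x)).1 =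
          dirDeriv (fun p => dirDeriv f' p (v' p).1) (Φ x) (u' (Φ x)).1 →
        dirDeriv f' (Φ x) (O'.D u' v' (Φ x)).1 =
          dirDeriv f' (Φ x) (mfderiv 𝓘(ℝ, E) 𝓘(ℝ, E') Φ x (O.D u v x).1) := by
      intro f f' hf' hff hD hD'
      rw [hd hf' hff x hxs, hD, hD', huu x hx]
      refine dirDeriv_mfderiv_of_comp_eq (hΦ x hxs) ((SmoothFieldOn.dirDeriv hΦU
        (hf'.mono hUW') hv').mdifferentiableAt hΦU hΦx) hU hx (fun p hp => ?_) _
      exact (congrArg (dirDeriv f' (Φ p)) (hvv p hp)).trans (hd hf' hff p (hUΦ hp) _)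
    have e₁ := hX h'.smooth_X₁ hX₁ (h.D_X₁ U hU (hUΦ.trans hΦW) u v hu hv x hx)
      (h'.D_X₁ _ hΦU hUW' u' v' hu' hv' _ hΦx)
    have e₂ := hX h'.smooth_X₂ hX₂ (h.D_X₂ U hU (hUΦ.trans hΦW) u v hu hv x hx)
      (h'.D_X₂ _ hΦU hUW' u' v' hu' hv' _ hΦx)
    have e₃ := hmem'.1.trans (hmem.1.symm.trans (dy₁ x hxs _).symm)
    have e₄ := hmem'.2.trans (hmem.2.symm.trans (dy₂ x hxs _).symm)
    -- The two vectors to be compared have equal components: those along y₁ and y₂ vanish because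
    -- both vectors are vertical, and those along X₁ and X₂ agree because these functions are affine
    -- on the leaves.
    have hsub : ∀ {f' : M' → ℝ} {w w' : TangentSpace 𝓘(ℝ, E') (Φ x)},
        dirDeriv f' (Φ x) w = dirDeriv f' (Φ x) w' → dirDeriv f' (Φ x) (w - w') = 0 :=
      fun {f'} {w w'} hw => (map_sub (mfderiv 𝓘(ℝ, E') 𝓘(ℝ, ℝ) f' (Φ x)) w w').trans
        (sub_eq_zero.2 hw)
    exact sub_eq_zero.1 (h'.eq_zero _ (hΦW' x hxs) _ (hsub e₃) (hsub e₄) (hsub e₁) (hsub e₂))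
  · intro p hp v v' w hv
    rw [h'.h_eq _ (hΦW' p hp), h.h_eq p (hΦW hp), hv, dy₁ p hp, dy₂ p hp, dX₁ p hp, dX₂ p hp,
      hX₁ p hp, hX₂ p hp]
  · intro p hp v v' hv
    rw [h'.α_eq _ (hΦW' p hp), h.α_eq p (hΦW hp), hv, dX₁ p hp, hX₁ p hp]
  · intro p hp w
    rw [h'.β_eq _ (hΦW' p hp), h.β_eq p (hΦW hp), dy₁ p hp, hX₁ p hp]
  · intro p hp u v u' v' hu hv
    rw [h'.θ_eq _ (hΦW' p hp), h.θ_eq p (hΦW hp), hu, hv, dX₁ p hp, dX₂ p hp, dX₁ p hp, dX₂ p hp,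
      hX₁ p hp]
  · intro p hp w w'
    rw [h'.ζ_eq _ (hΦW' p hp), h.ζ_eq p (hΦW hp), dy₁ p hp, dy₂ p hp, dy₁ p hp, dy₂ p hp,
      hX₁ p hp]

/-- The functions in a standard form are the components of a chart. -/
theorem OctupleData.IsNormalOn.exists_isSmoothChart (hdim : Module.finrank ℝ E = 4) {W : Set M}
    (hW : IsOpen W) {y₁ y₂ X₁ X₂ : M → ℝ} (h : O.IsNormalOn W y₁ y₂ X₁ X₂) {x : M} (hx : x ∈ W) :
    ∃ Ψ : OpenPartialHomeomorph M ((ℝ × ℝ) × (ℝ × ℝ)), x ∈ Ψ.source ∧ Ψ.source ⊆ W ∧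
      IsSmoothChart (E := E) Ψ ∧ ∀ p ∈ Ψ.source, Ψ p = ((y₁ p, y₂ p), (X₁ p, X₂ p)) := by
  have hfin : FiniteDimensional ℝ E := Module.finite_of_finrank_eq_succ hdim
  have d₁ := h.smooth_y₁.mdifferentiableAt hW hx
  have d₂ := h.smooth_y₂.mdifferentiableAt hW hx
  have d₃ := h.smooth_X₁.mdifferentiableAt hW hx
  have d₄ := h.smooth_X₂.mdifferentiableAt hW hx
  refine Octuples.exists_isSmoothChart (G := (ℝ × ℝ) × (ℝ × ℝ)) (by simp [hdim]) hW hx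
    ((ContMDiffOn.prodMk_space h.smooth_y₁ h.smooth_y₂).prodMk_space
      (ContMDiffOn.prodMk_space h.smooth_X₁ h.smooth_X₂)) fun w hw => ?_
  rw [mfderiv_prodMk_apply (d₁.prodMk_space d₂) (d₃.prodMk_space d₄), mfderiv_prodMk_apply d₁ d₂,
    mfderiv_prodMk_apply d₃ d₄] at hw
  obtain ⟨h1, h2⟩ := Prod.mk.inj hw
  obtain ⟨h3, h4⟩ := Prod.mk.inj h1
  obtain ⟨h5, h6⟩ := Prod.mk.inj h2
  exact h.eq_zero x hx w h3 h4 h5 h6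

/-- Centered standard coordinates send both base points to ((0, 0), (1, 0)). One chart followed by
the inverse of the other is therefore defined near x, and it matches all four coordinate functions.
-/
theorem BasicOctuple.locallyEquivalentAt (O : BasicOctuple E M) (x : M) (O' : BasicOctuple E' M')
    (x' : M') : O.LocallyEquivalentAt x O' x' := by
  have hO := O.isBasic
  have hO' := O'.isBasic
  have : FiniteDimensional ℝ E := Module.finite_of_finrank_eq_succ hO.dim_eq
  have : FiniteDimensional ℝ E' := Module.finite_of_finrank_eq_succ hO'.dim_eq
  have := FiniteDimensional.complete ℝ E
  have := FiniteDimensional.complete ℝ E'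
  obtain ⟨W, hW, hxW, _, _, _, _, h₀⟩ := hO.exists_isNormalOn x
  obtain ⟨W', hW', hxW', _, _, _, _, h₀'⟩ := hO'.exists_isNormalOn x'
  obtain ⟨y₁, y₂, X₁, X₂, h, h1, h2, h3, h4⟩ := h₀.exists_centered hW hxW
  obtain ⟨y₁', y₂', X₁', X₂', h', h1', h2', h3', h4'⟩ := h₀'.exists_centered hW' hxW'
  obtain ⟨Ψ, hxΨ, hΨW, hΨ, hΨe⟩ := h.exists_isSmoothChart hO.dim_eq hW hxW
  obtain ⟨Ψ', hxΨ', hΨW', hΨ', hΨe'⟩ := h'.exists_isSmoothChart hO'.dim_eq hW' hxW'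
  have hxx : Ψ x = Ψ' x' := by
    rw [hΨe x hxΨ, hΨe' x' hxΨ', h1, h2, h3, h4, h1', h2', h3', h4']
  have hsrc : ∀ p ∈ (Ψ.trans Ψ'.symm).source, p ∈ Ψ.source ∧ Ψ p ∈ Ψ'.target := fun p hp => by
    rwa [OpenPartialHomeomorph.trans_source] at hp
  have htgt : ∀ p ∈ (Ψ.trans Ψ'.symm).target, p ∈ Ψ'.source ∧ Ψ' p ∈ Ψ.target := fun p hp => by
    rwa [OpenPartialHomeomorph.trans_target] at hp
  have hs : ContMDiffOn 𝓘(ℝ, E) 𝓘(ℝ, E') ∞ (Ψ.trans Ψ'.symm) (Ψ.trans Ψ'.symm).source :=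
    hΨ'.smooth_symm.comp (hΨ.smooth.mono fun p hp => (hsrc p hp).1) fun p hp => (hsrc p hp).2
  have hmap : ∀ p ∈ (Ψ.trans Ψ'.symm).source, Ψ' ((Ψ.trans Ψ'.symm) p) = Ψ p := fun p hp =>
    Ψ'.right_inv (hsrc p hp).2
  have hmem : ∀ p ∈ (Ψ.trans Ψ'.symm).source, (Ψ.trans Ψ'.symm) p ∈ Ψ'.source := fun p hp =>
    Ψ'.map_target (hsrc p hp).2
  have hcoord : ∀ p ∈ (Ψ.trans Ψ'.symm).source, _ := fun p hp =>
    (hΨe' _ (hmem p hp)).symm.trans ((hmap p hp).trans (hΨe p (hsrc p hp).1))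
  refine ⟨Ψ.trans Ψ'.symm, ?_, ?_, hs, ?_, h.isTransportedBy hW' h'
    (fun p hp => hΨW (hsrc p hp).1) (fun p hp => hΨW' (hmem p hp))
    (fun p hp => (hs.contMDiffAt ((Ψ.trans Ψ'.symm).open_source.mem_nhds hp)).mdifferentiableAt
      (by simp))
    (fun p hp => congrArg (fun q => q.1.1) (hcoord p hp))
    (fun p hp => congrArg (fun q => q.1.2) (hcoord p hp))
    (fun p hp => congrArg (fun q => q.2.1) (hcoord p hp))
    (fun p hp => congrArg (fun q => q.2.2) (hcoord p hp))⟩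
  · rw [OpenPartialHomeomorph.trans_source]
    exact ⟨hxΨ, by rw [Set.mem_preimage, hxx]; exact Ψ'.map_source hxΨ'⟩
  · change Ψ'.symm (Ψ x) = x'
    rw [hxx, Ψ'.left_inv hxΨ']
  · exact hΨ.smooth_symm.comp (hΨ'.smooth.mono fun p hp => (htgt p hp).1) fun p hp => (htgt p hp).2

end Equivalence

end Octuples
theorem theorem9p2
    {E : Type*} [NormedAddCommGroup E] [NormedSpace ℝ E]
    {M : Type*} [TopologicalSpace M] [ChartedSpace E M] [IsManifold 𝓘(ℝ, E) ∞ M]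
    (O : Octuples.BasicOctuple E M) (x : M) :
    -- any two basic octuples, at any two points, are locally diffeomorphically equivalent
    (∀ {E' : Type*} [NormedAddCommGroup E'] [NormedSpace ℝ E']
      {M' : Type*} [TopologicalSpace M'] [ChartedSpace E' M'] [IsManifold 𝓘(ℝ, E') ∞ M']
      (O' : Octuples.BasicOctuple E' M') (x' : M'), O.LocallyEquivalentAt x O' x') ∧
    -- every basic octuple is locally equivalent to the one associated with any two-plane system
    (∀ {A : Type*} [NormedAddCommGroup A] [NormedSpace ℝ A]
      {S : Type*} [MetricSpace S] [NormedAddTorsor A S]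
      {P : Type*} [NormedAddCommGroup P] [NormedSpace ℝ P]
      (T : Octuples.TwoPlaneSystem A S P) (z : T.Space),
      O.LocallyEquivalentAt x T.basicOctuple z) := by
  exact ⟨fun O' x' => O.locallyEquivalentAt x O' x',
    fun T z => O.locallyEquivalentAt x T.basicOctuple z⟩
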